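/- **Setting.** Let $(\Lambda,d)$ be a metric space whose Borel $\sigma$-algebra is standard (for example a Borel subset of a complete separable metric space), let $\mu$ be a Borel probability measure on $\Lambda$ and let $T:\Lambda\to\Lambda$ be measurable, measure-preserving and ergodic. Let $X\subset\Lambda$ be a Borel set with $\mu(X)>0$, $\mu_X=\mu|_X/\mu(X)$, $\varphi(x)=\inf\{n\ge1:T^nx\in X\}$ the first return time, $f=T^\varphi:X\to X$ the first return map, and $\bar\varphi=\int_X\varphi\,d\mu_X$. Fix $\eta\in(0,1]$; $C^\eta(\Lambda)$ denotes the bounded real functions on $\Lambda$ that are Hölder continuous with exponent $\eta$. **Young tower with exponential tails.** The map $f:X\to X$ is modelled by a Young tower with exponential tails if there are a measurable set $Y\subset X$ with $\mu_X(Y)>0$, a measurable $\tau:Y\to\{1,2,\dots\}$, a map $F:Y\to Y$ and an ergodic $F$-invariant probability measure $\mu_Y$ on $Y$ such that the following hold. 1. $F(y)=f^{\tau(y)}y$ for $\mu_Y$-a.e. $y$, and $\tau$ is $\mu_Y$-integrable. Put $\bar\tau=\int_Y\tau\,d\mu_Y$ and $\Delta=\{(y,\ell):y\in Y,\ 0\le\ell<\tau(y)\}$,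 with $\hat f(y,\ell)=(y,\ell+1)$ if $\ell\le\tau(y)-2$ and $\hat f(y,\tau(y)-1)=(Fy,0)$. The probability measure $\mu_\Delta=(\mu_Y\times\mathrm{counting})/\bar\tau$ is ergodic for $\hat f$, and $\mu_X=\pi_*\mu_\Delta$ for $\pi(y,\ell)=f^\ell y$. 2. $\mu_Y(\tau>n)=O(e^{-cn})$ for some $c>0$. 3. $Y$ is partitioned into measurable local stable leaves; $W^s_y$ denotes the leaf containing $y$. We have $F(W^s_y)\subset W^s_{Fy}$ for all $y$, and there are $C>0$, $\gamma_0\in(0,1)$ with $d(F^ny,F^ny')\le C\gamma_0^n$ for all $y'\in W^s_y$ and $n\ge0$. 4. Let $\bar Y$ be the space of leaves with the quotient $\sigma$-algebra, $\bar\pi:Y\to\bar Y$ the projection, $\bar\mu_Y=\bar\pi_*\mu_Y$, and $\bar F:\bar Y\to\bar Y$ the quotient map, which is ergodic and preserves $\bar\mu_Y$. There is an at most countable measurable partition $\{a\}$ of $\bar Y$ such that $\bar F|_a:a\to\bar Y$ is a bimeasurable bijection for every $a$. Let $s(z,z')$ be the least $n\ge0$ such that $\bar F^nz,\bar F^nz'$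 lie in distinct partition elements ($\infty$ if there is none); then $s(z,z')=\infty$ if and only if $z=z'$. There is a positive version $g$ of $d\bar\mu_Y/d(\bar\mu_Y\circ\bar F)$, and there are $C>0$, $\theta\in(0,1)$, with $|\log g(z)-\log g(z')|\le C\theta^{s(z,z')}$ for all $z,z'\in a$ and all $a$ (full branch Gibbs–Markov map). 5. $\tau$ is constant on $\bar\pi^{-1}a$ for every $a$. **Chernov–Markarian–Zhang structure.** $T$ possesses a Chernov–Markarian–Zhang structure (with cross-section $X$, for the exponent $\eta$) if $f:X\to X$ is modelled by a Young tower with exponential tails as above and, with $\varphi^Y=\sum_{\ell=0}^{\tau-1}\varphi\circ f^\ell$, the following hold. 6. $\varphi$ is constant on $f^\ell\bar\pi^{-1}a$ for all $a$ and $0\le\ell<\tau(a)$. 7. There are $C>0$, $\gamma_0\in(0,1)$ such that $d(T^\ell F^ny,T^\ell F^ny')\le C\gamma_0^n$ for all $y\in Y$, $y'\in W^s_y$, $n\ge0$ and $0\le\ell<\varphi^Y(F^ny)$. 8. Let $\mathcal B=\{\bar\pi^{-1}A: A\subset\bar Y \text{ measurable}\}$. For every $h\in C^\eta(\Lambda)$,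 with $H^Y=\sum_{\ell=0}^{\varphi^Y-1}h\circ T^\ell$, we have $\mathbb E(H^Y|\mathcal B)=\zeta\circ\bar\pi$ a.e. for some $\zeta\in L^1(\bar Y)$, and there are $C>0$, $\gamma_0\in(0,1)$ with $|\zeta(z)-\zeta(z')|\le C\varphi^Y(a)\gamma_0^{s(z,z')}$ for all $z,z'\in a$ and all $a$. **Theorem (Stable law).** Suppose that $T:\Lambda\to\Lambda$ possesses a Chernov–Markarian–Zhang structure. Let $\alpha\in(1,2)$, let $G$ be a random variable with an $\alpha$-stable law, that is, for some $\sigma>0$, $\beta\in[-1,1]$ and $m\in\mathbb R$, $$\mathbb E e^{iuG}=\exp\{-\sigma^\alpha|u|^\alpha(1-i\beta\,\mathrm{sgn}(u)\tan\tfrac{\pi\alpha}2)+imu\}\quad(u\in\mathbb R),$$ and assume that $$n^{-1/\alpha}\Big(\sum_{j=0}^{n-1}\varphi\circ f^j-n\bar\varphi\Big)\to_d G\quad\text{on }(X,\mu_X).$$ Let $v\in C^\eta(\Lambda)$ with $\int_\Lambda v\,d\mu=0$, let $V(x)=\sum_{\ell=0}^{\varphi(x)-1}v(T^\ell x)$ for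 $x\in X$, and assume that $V-I\varphi\in L^p(X,\mu_X)$ for some $I\ne0$ and $p>\alpha$. Then, with $v_n=\sum_{j=0}^{n-1}v\circ T^j$, $$n^{-1/\alpha}v_n\to_d\bar\varphi^{-1/\alpha}IG\quad\text{on }(\Lambda,\mu).$$ -/

import Mathlib

open MeasureTheory ProbabilityTheory Filter Topology Set
open scoped NNReal ENNReal

noncomputable section

namespace CMZ

/-! ### Stable laws and observables -/

/-- `ν` is an `α`-stable law on `ℝ`, for an index `α ≠ 1` (it is used for `1 < α < 2`):
the law `S_α(σ, β, m)` with scale `σ > 0`, skewness `β ∈ [-1, 1]` and location `m`. -/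
def IsStableLaw (α : ℝ) (ν : Measure ℝ) : Prop :=
  IsProbabilityMeasure ν ∧
    ∃ σ β m : ℝ, 0 < σ ∧ β ∈ Icc (-1 : ℝ) 1 ∧ ∀ u : ℝ,
      charFun ν u = Complex.exp
        (-((σ ^ α * |u| ^ α : ℝ) : ℂ) *
            (1 - Complex.I * ((β * Real.sign u * Real.tan (Real.pi * α / 2) : ℝ) : ℂ))
          + Complex.I * ((m * u : ℝ) : ℂ))

/-- The class `C^η`: bounded functions that are Hölder continuous with exponent `η`. -/
def IsHolderObservable {Λ : Type*} [MetricSpace Λ] (η : ℝ≥0) (h : Λ → ℝ) : Prop :=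
  (∃ K : ℝ≥0, HolderWith K η h) ∧ ∃ M : ℝ, ∀ x, |h x| ≤ M

/-! ### Towers -/

section Tower

variable {Y : Type*}

/-- The tower `Y^τ = {(y, ℓ) : 0 ≤ ℓ < τ y}`. -/
abbrev Tower (τ : Y → ℕ) : Type _ := {p : Y × ℕ // p.2 < τ p.1}

/-- The tower map: climb one level, or go from the top level to `(F y, 0)`. -/
def towerMap (F : Y → Y) (τ : Y → ℕ) (hτ : ∀ y, 1 ≤ τ y) (p : Tower τ) : Tower τ :=
  if h : p.1.2 + 1 < τ p.1.1 then ⟨(p.1.1, p.1.2 + 1), h⟩ else ⟨(F p.1.1, 0), hτ (F p.1.1)⟩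

/-- The measure `(μ_Y × counting) / ∫ τ dμ_Y` on the tower. -/
def towerMeasure [MeasurableSpace Y] (μY : Measure Y) (τ : Y → ℕ) : Measure (Tower τ) :=
  (ENNReal.ofReal (∫ y, (τ y : ℝ) ∂μY))⁻¹ •
    (μY.prod (Measure.count : Measure ℕ)).comap (Subtype.val : Tower τ → Y × ℕ)

end Tower

/-! ### Full branch Gibbs-Markov maps -/

section GibbsMarkov

variable {Z : Type*}

/-- The separation time `s(z, z')`: the least `n ≥ 0` such that `F^n z` and `F^n z'` lie in
distinct elements of the partition `𝒜`, and `∞` if there is no such `n`. -/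
def separationTime (F : Z → Z) (𝒜 : Set (Set Z)) (z z' : Z) : ℕ∞ :=
  ⨅ (n : ℕ) (_ : ¬ ∃ a ∈ 𝒜, F^[n] z ∈ a ∧ F^[n] z' ∈ a), (n : ℕ∞)

/-- `θ ^ s` for `θ ∈ (0, 1)` and `s ∈ {0, 1, 2, …, ∞}`, with `θ ^ ∞ = 0`. -/
def powSep (θ : ℝ) (s : ℕ∞) : ℝ := if s = ⊤ then 0 else θ ^ s.toNat

/-- `F` is a full branch Gibbs-Markov map of the probability space `(Z, μ)` with respect to
the partition `𝒜`. The measure `μ ∘ F` on `a ∈ 𝒜`, `A ↦ μ (F A)`, is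
`Measure.comap (fun z : a => F z) μ`, and `g` is the density of `μ` with respect to it. -/
structure IsFullBranchGibbsMarkov [MeasurableSpace Z] (μ : Measure Z) (F : Z → Z)
    (𝒜 : Set (Set Z)) : Prop where
  ergodic : Ergodic F μ
  countable : 𝒜.Countable
  isPartition : Setoid.IsPartition 𝒜
  measurableSet : ∀ a ∈ 𝒜, MeasurableSet a
  separates : ∀ z z', separationTime F 𝒜 z z' = ⊤ ↔ z = z'
  bijOn : ∀ a ∈ 𝒜, BijOn F a univ
  bimeasurable : ∀ a ∈ 𝒜, MeasurableEmbedding (fun z : a => F z)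
  distortion : ∃ g : Z → ℝ, Measurable g ∧ (∀ z, 0 < g z) ∧
    (∀ a ∈ 𝒜, μ.comap (Subtype.val : a → Z) =
      (Measure.comap (fun z : a => F z) μ).withDensity (fun z => ENNReal.ofReal (g z))) ∧
    ∃ C θ : ℝ, 0 < C ∧ θ ∈ Ioo (0 : ℝ) 1 ∧ ∀ a ∈ 𝒜, ∀ z ∈ a, ∀ z' ∈ a,
      |Real.log (g z) - Real.log (g z')| ≤ C * powSep θ (separationTime F 𝒜 z z')

end GibbsMarkov

/-! ### Young towers with exponential tails -/

/-- The map `f : 𝒳 → 𝒳` on the metric probability space `(𝒳, m)` is modelled by a Young tower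
`Y^τ` with exponential tails, with return map `F = f^τ : Y → Y`. The relation `leaf` is "lie on
the same local stable leaf"; its classes form the cover `𝒲ˢ`, and `Quotient leaf`, with the
quotient `σ`-algebra, is `Ȳ`. (That `f` preserves `m` and is ergodic follows from
`ergodic_tower` and `map_proj`.) -/
structure YoungTower {𝒳 : Type*} [MetricSpace 𝒳] [MeasurableSpace 𝒳]
    (f : 𝒳 → 𝒳) (m : Measure 𝒳) where
  /-- the base -/
  Y : Set 𝒳
  /-- the return time, not necessarily the first one -/
  τ : Y → ℕ
  /-- the return map -/
  F : Y → Y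
  /-- the invariant probability measure on the base -/
  μY : Measure Y
  /-- the equivalence relation of the partition of `Y` into local stable leaves -/
  leaf : Setoid Y
  /-- the partition of the quotient `Ȳ` -/
  parts : Set (Set (Quotient leaf))
  measurableSet_Y : MeasurableSet Y
  measure_Y_ne_zero : m Y ≠ 0
  isProbabilityMeasure : IsProbabilityMeasure μY
  one_le_τ : ∀ y, 1 ≤ τ y
  measurable_τ : Measurable τ
  integrable_τ : Integrable (fun y => (τ y : ℝ)) μY
  F_eq : ∀ᵐ y ∂μY, ((F y : Y) : 𝒳) = f^[τ y] (y : 𝒳)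
  ergodic_base : Ergodic F μY
  ergodic_tower : Ergodic (towerMap F τ one_le_τ) (towerMeasure μY τ)
  /-- `m = π_* μ_Δ` for the projection `π (y, ℓ) = f^ℓ y` -/
  map_proj : m = (towerMeasure μY τ).map (fun p : Tower τ => f^[p.1.2] (p.1.1 : 𝒳))
  exp_tails : ∃ C c : ℝ, 0 < C ∧ 0 < c ∧
    ∀ n : ℕ, μY.real {y | n < τ y} ≤ C * Real.exp (-c * n)
  measurableSet_leaf : ∀ y, MeasurableSet {y' | leaf y y'}
  F_leaf : ∀ y y', leaf y y' → leaf (F y) (F y')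
  gibbsMarkov : IsFullBranchGibbsMarkov (μY.map (Quotient.mk leaf))
    (Quotient.map (sa := leaf) (sb := leaf) F F_leaf) parts
  τ_const : ∀ a ∈ parts, ∀ y y', Quotient.mk leaf y ∈ a → Quotient.mk leaf y' ∈ a → τ y = τ y'
  leaf_contraction : ∃ C γ : ℝ, 0 < C ∧ γ ∈ Ioo (0 : ℝ) 1 ∧ ∀ y y', leaf y y' →
    ∀ n : ℕ, dist (F^[n] y) (F^[n] y') ≤ C * γ ^ n

namespace YoungTower

variable {𝒳 : Type*} [MetricSpace 𝒳] [MeasurableSpace 𝒳] {f : 𝒳 → 𝒳} {m : Measure 𝒳}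

/-- The quotient `Ȳ` of `Y` along local stable leaves. -/
abbrev Ybar (S : YoungTower f m) : Type _ := Quotient S.leaf

/-- The projection `π̄ : Y → Ȳ`. -/
def proj (S : YoungTower f m) (y : S.Y) : S.Ybar := Quotient.mk S.leaf y

/-- The quotient map `F̄ : Ȳ → Ȳ`. -/
def Fbar (S : YoungTower f m) : S.Ybar → S.Ybar :=
  Quotient.map (sa := S.leaf) (sb := S.leaf) S.F S.F_leaf

/-- The `σ`-algebra `ℬ` on `Y` of measurable unions of local stable leaves. -/
abbrev leafAlgebra (S : YoungTower f m) : MeasurableSpace S.Y :=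
  MeasurableSpace.comap S.proj inferInstance

end YoungTower

/-! ### First return maps and the Chernov-Markarian-Zhang structure -/

section CMZStructure

variable {Λ : Type*}

/-- The first return time `φ x = inf {n ≥ 1 : T^n x ∈ X}`; its value is `0` if `x` never returns
(a null set of points, for a measure-preserving `T`). -/
def returnTime (T : Λ → Λ) (X : Set Λ) (x : X) : ℕ := sInf {n : ℕ | 1 ≤ n ∧ T^[n] (x : Λ) ∈ X}

theorem returnTime_mem (T : Λ → Λ) (X : Set Λ) (x : X) :
    T^[returnTime T X x] (x : Λ) ∈ X := by
  rcases Set.eq_empty_or_nonempty {n : ℕ | 1 ≤ n ∧ T^[n] (x : Λ) ∈ X} with h | h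
  · have h0 : returnTime T X x = 0 := by rw [returnTime, h, Nat.sInf_empty]
    rw [h0]
    exact x.2
  · exact (Nat.sInf_mem h).2

/-- The first return map `f = T^φ : X → X`. -/
def returnMap (T : Λ → Λ) (X : Set Λ) (x : X) : X :=
  ⟨T^[returnTime T X x] (x : Λ), returnTime_mem T X x⟩

/-- The observable `∑_{ℓ < φ} v ∘ T^ℓ` on `X` induced by an observable `v` on `Λ`. -/
def induced (T : Λ → Λ) (X : Set Λ) (v : Λ → ℝ) (x : X) : ℝ :=
  birkhoffSum T v (returnTime T X x) (x : Λ)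

/-- The normalised restriction `μ_X = μ|_X / μ(X)`, as a measure on `X`. -/
def restrictedMeasure [MeasurableSpace Λ] (μ : Measure Λ) (X : Set Λ) : Measure X :=
  (μ X)⁻¹ • μ.comap (Subtype.val : X → Λ)

theorem isProbabilityMeasure_restrictedMeasure [MeasurableSpace Λ] (μ : Measure Λ)
    [IsFiniteMeasure μ] {X : Set Λ} (hX : MeasurableSet X) (h0 : μ X ≠ 0) :
    IsProbabilityMeasure (restrictedMeasure μ X) := by
  constructor
  rw [restrictedMeasure, Measure.smul_apply, comap_subtype_coe_apply hX μ univ,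
    Set.image_univ, Subtype.range_coe, smul_eq_mul]
  exact ENNReal.inv_mul_cancel h0 (measure_ne_top μ X)

/-- The mean return time `φ̄ = ∫_X φ dμ_X`. -/
def meanReturnTime [MeasurableSpace Λ] (T : Λ → Λ) (μ : Measure Λ) (X : Set Λ) : ℝ :=
  ∫ x, (returnTime T X x : ℝ) ∂(restrictedMeasure μ X)

variable [MetricSpace Λ] [MeasurableSpace Λ]

/-- The induced return time `φ^Y = ∑_{ℓ < τ} φ ∘ f^ℓ` on the base of a Young tower. -/
def inducedReturnTime {T : Λ → Λ} {μ : Measure Λ} {X : Set Λ}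
    (S : YoungTower (returnMap T X) (restrictedMeasure μ X)) (y : S.Y) : ℕ :=
  birkhoffSum (returnMap T X) (returnTime T X) (S.τ y) (y : X)

/-- The observable `∑_{ℓ < φ^Y} h ∘ T^ℓ` on the base `Y` induced by an observable on `Λ`. -/
def inducedY {T : Λ → Λ} {μ : Measure Λ} {X : Set Λ}
    (S : YoungTower (returnMap T X) (restrictedMeasure μ X)) (h : Λ → ℝ) (y : S.Y) : ℝ :=
  birkhoffSum T h (inducedReturnTime S y) ((y : X) : Λ)

/-- A Chernov-Markarian-Zhang structure for `T : Λ → Λ`, with cross-section `X`, relative to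
Hölder observables of exponent `η`. -/
structure CMZStructure (T : Λ → Λ) (μ : Measure Λ) (X : Set Λ) (η : ℝ≥0) where
  /-- the Young tower with exponential tails that models the first return map -/
  tower : YoungTower (returnMap T X) (restrictedMeasure μ X)
  ergodic : Ergodic T μ
  measurableSet_X : MeasurableSet X
  measure_X_ne_zero : μ X ≠ 0
  returnTime_const : ∀ a ∈ tower.parts, ∀ y y', tower.proj y ∈ a → tower.proj y' ∈ a →
    ∀ ℓ < tower.τ y, returnTime T X ((returnMap T X)^[ℓ] (y : X)) =
      returnTime T X ((returnMap T X)^[ℓ] (y' : X))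
  /-- local stable leaves also contract at the iterates of `T` between the returns to `Y` -/
  excursion_contraction : ∃ C γ : ℝ, 0 < C ∧ γ ∈ Ioo (0 : ℝ) 1 ∧
    ∀ y y', tower.leaf y y' → ∀ n ℓ : ℕ, ℓ < inducedReturnTime tower (tower.F^[n] y) →
      dist (T^[ℓ] ((tower.F^[n] y : X) : Λ)) (T^[ℓ] ((tower.F^[n] y' : X) : Λ)) ≤ C * γ ^ n
  /-- `𝔼(H^Y | ℬ) = ζ ∘ π̄` with `|ζ z - ζ z'| ≤ C φ^Y(a) γ^{s(z, z')}` for `z, z' ∈ a` -/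
  condExp_regular : ∀ h : Λ → ℝ, IsHolderObservable η h →
    ∃ ζ : tower.Ybar → ℝ, Integrable ζ (tower.μY.map tower.proj) ∧
      tower.μY[inducedY tower h | tower.leafAlgebra] =ᵐ[tower.μY] ζ ∘ tower.proj ∧
      ∃ C γ : ℝ, 0 < C ∧ γ ∈ Ioo (0 : ℝ) 1 ∧
        ∀ a ∈ tower.parts, ∀ y y', tower.proj y ∈ a → tower.proj y' ∈ a →
          |ζ (tower.proj y) - ζ (tower.proj y')| ≤ C * inducedReturnTime tower y *
            powSep γ (separationTime tower.Fbar tower.parts (tower.proj y) (tower.proj y'))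

theorem CMZStructure.isProbabilityMeasure {T : Λ → Λ} {μ : Measure Λ} [IsFiniteMeasure μ]
    {X : Set Λ} {η : ℝ≥0} (S : CMZStructure T μ X η) :
    IsProbabilityMeasure (restrictedMeasure μ X) :=
  isProbabilityMeasure_restrictedMeasure μ S.measurableSet_X S.measure_X_ne_zero

end CMZStructure

end CMZ

end

/-!
Write `φ^Y` for the return time of `T` to the base `Y` of the tower, `φ̃` for its mean (`meanCycle`),
and `t_k` for the time under `T` of the `k`-th return to `Y` (`cycleTime`). The whole argument is
carried out under the measure `μ_Y` on the base. This is harmless because distributional limits of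
normalised Birkhoff sums of an ergodic map are the same for all initial measures with a bounded
density (`tendstoInDistribution_birkhoffSum_iff`, which rests on the mean ergodic theorem through
`tendsto_integral_mul_density`): the hypothesis passes from `μ_X` to `μ_Y`, and the conclusion from
`μ_Y` to `μ`.

At the times `t_k` the Birkhoff sums of `v` satisfy the exact identity
`v_{t_k} = R_k + I (t_k - k φ̃)` (`CMZStructure.ae_birkhoffSum_cycleTime_eq`), where `R_k` is the
`k`-th Birkhoff sum under `F` of the `residual`, the function `V - I φ` summed over the levels of
the tower and centred. Four facts then give the theorem, with `k = ⌊n / φ̃⌋`.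

* `R_k = O(k^{1/r})` in `Lʳ` for some `r > α`, hence `R_k = o(n^{1/α})` in probability
  (`CMZStructure.exists_eLpNorm_birkhoffSum_residual_le`). The residual is in `L^q` for some
  `q ∈ (r, p)` (`YoungTower.memLp_lift`) and has mean zero by Kac's formula. It is contracted along
  stable leaves, so that it is well approximated by its conditional expectations on the `σ`-algebras
  of the leaves of `F^i y`, which decrease with `i`; and its conditional expectation on leaves is
  locally Lipschitz for a full branch Gibbs-Markov map, for which correlations decay exponentially
  (`IsFullBranchGibbsMarkov.exists_decay`, proved by contracting a cone of log-Lipschitz functions).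
  Therefore its Birkhoff sums are reverse martingales up to bounded errors
  (`exists_eLpNorm_birkhoffSum_le`), and the von Bahr-Esseen inequality
  (`eLpNorm_sum_le_of_condExp_eq_zero`) applies.
* `(t_k - n) / n^{1/α}` tends in distribution to `φ̄^{-1/α} G`
  (`CMZStructure.tendstoInDistribution_cycleTime`). Indeed `t_k` is the sum of the first
  `τ + τ ∘ F + ⋯ + τ ∘ F^{k-1}` return times to `X`. This number differs from `n / φ̄` by
  `o(n^{1/α})`, by the same moment bound applied to `τ`, so that the sum of the first `⌊n / φ̄⌋`
  return times is the same up to `o(n^{1/α})`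
  (`tendstoInMeasure_birkhoffSum_sub_birkhoffSum`).
* `v_n - v_{t_k} = o(n^{1/α})` in probability: by the previous point `t_k - n` is of order
  `n^{1/α}`, and the maximum of the first `N` Birkhoff sums of the bounded mean zero observable `v`
  is `o(N)` (`tendsto_measure_exists_lt_abs_birkhoffSum`, `tendstoInMeasure_birkhoffSum_randomTime`).
* `k φ̃ - n` is bounded.
-/

noncomputable section

namespace CMZ

/-! ### The mean ergodic theorem and change of the initial measure -/

section MeanErgodic

variable {Ω : Type*} [MeasurableSpace Ω] {m : Measure Ω} {T : Ω → Ω}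

theorem integral_comp_measurePreserving {α β E : Type*} [MeasurableSpace α] [MeasurableSpace β]
    [NormedAddCommGroup E] [NormedSpace ℝ E] {m₁ : Measure α} {m₂ : Measure β} {S : α → β}
    (hS : MeasurePreserving S m₁ m₂) {g : β → E} (hg : AEStronglyMeasurable g m₂) :
    ∫ x, g (S x) ∂m₁ = ∫ x, g x ∂m₂ := by
  rw [← hS.map_eq] at hg ⊢
  exact (integral_map hS.measurable.aemeasurable hg).symm

theorem integral_birkhoffAverage (hT : MeasurePreserving T m m) {g : Ω → ℝ} (hg : Integrable g m)
    {n : ℕ} (hn : n ≠ 0) : ∫ x, birkhoffAverage ℝ T g n x ∂m = ∫ x, g x ∂m := by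
  simp only [birkhoffAverage, birkhoffSum, smul_eq_mul]
  rw [integral_const_mul, integral_finsetSum]
  · have : ∀ i ∈ Finset.range n, ∫ x, g (T^[i] x) ∂m = ∫ x, g x ∂m := fun i _ =>
      integral_comp_measurePreserving (hT.iterate i) hg.aestronglyMeasurable
    rw [Finset.sum_congr rfl this]
    simp; field_simp
  · exact fun i _ => (hT.iterate i).integrable_comp_of_integrable hg

theorem integrable_comp_iterate {E : Type*} [NormedAddCommGroup E]
    (hT : MeasurePreserving T m m) {g : Ω → E} (hg : Integrable g m)
    (j : ℕ) : Integrable (fun x => g (T^[j] x)) m :=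
  (hT.iterate j).integrable_comp_of_integrable hg

theorem integrable_birkhoffSum (hT : MeasurePreserving T m m) {g : Ω → ℝ} (hg : Integrable g m)
    (n : ℕ) : Integrable (birkhoffSum T g n) m :=
  integrable_finsetSum _ fun i _ => integrable_comp_iterate hT hg i

theorem integrable_birkhoffAverage (hT : MeasurePreserving T m m) {g : Ω → ℝ}
    (hg : Integrable g m) (n : ℕ) : Integrable (birkhoffAverage ℝ T g n) m :=
  (integrable_birkhoffSum hT hg n).smul (n : ℝ)⁻¹

variable [IsProbabilityMeasure m]

/-- The mean ergodic theorem in `L¹`, for square integrable observables. -/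
theorem tendsto_integral_abs_birkhoffAverage_sub (hT : Ergodic T m) {g : Ω → ℝ}
    (hg : MemLp g 2 m) :
    Tendsto (fun n : ℕ => ∫ x, |birkhoffAverage ℝ T g n x - ∫ y, g y ∂m| ∂m) atTop (𝓝 0) := by
  have hTm := hT.toMeasurePreserving
  -- von Neumann's theorem for the Koopman operator `K`; by ergodicity its fixed vectors are constant
  let K : Lp ℝ 2 m →L[ℝ] Lp ℝ 2 m := (Lp.compMeasurePreservingₗᵢ ℝ T hTm).toContinuousLinearMap
  have hK : ‖K‖ ≤ 1 := LinearIsometry.norm_toContinuousLinearMap_le _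
  set G : Lp ℝ 2 m := hg.toLp g with hG
  have hlim := K.tendsto_birkhoffAverage_orthogonalProjection hK G
  generalize (K.eqLocus (1 : Lp ℝ 2 m →L[ℝ] Lp ℝ 2 m)).orthogonalProjectionOnto G = q' at hlim
  obtain ⟨q, hqmem⟩ := q'
  have hqK : K q = q := by simpa using hqmem
  have hqT : (q : Ω → ℝ) ∘ T =ᵐ[m] q := by
    have h1 : (K q : Ω → ℝ) =ᵐ[m] (q : Ω → ℝ) ∘ T := Lp.coeFn_compMeasurePreserving q hTm
    rw [hqK] at h1
    exact h1.symm
  obtain ⟨c, hc⟩ := hT.ae_eq_const_of_ae_eq_comp_ae (Lp.aestronglyMeasurable q) hqT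
  have hiter : ∀ i : ℕ, (K^[i] G : Lp ℝ 2 m) =ᵐ[m] fun x => g (T^[i] x) := by
    intro i
    induction i with
    | zero => simpa using hg.coeFn_toLp
    | succ i ih =>
      rw [Function.iterate_succ_apply']
      have h1 : (K (K^[i] G) : Ω → ℝ) =ᵐ[m] (K^[i] G : Lp ℝ 2 m) ∘ T :=
        Lp.coeFn_compMeasurePreserving _ hTm
      refine h1.trans ?_
      have := hTm.quasiMeasurePreserving.ae_eq_comp ih
      refine this.trans (Eventually.of_forall fun x => ?_)
      simp [Function.comp]
  have hsum : ∀ n : ℕ, (birkhoffSum K _root_.id n G : Lp ℝ 2 m) =ᵐ[m] birkhoffSum T g n := by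
    intro n
    induction n with
    | zero => simpa using Lp.coeFn_zero ℝ 2 m
    | succ n ih =>
      rw [birkhoffSum_succ]
      filter_upwards [Lp.coeFn_add (birkhoffSum K _root_.id n G) (_root_.id (K^[n] G)), ih, hiter n]
        with x h1 h2 h3
      rw [h1, birkhoffSum_succ, Pi.add_apply, h2]
      simp [h3]
  have havg : ∀ n : ℕ, (birkhoffAverage ℝ K _root_.id n G : Lp ℝ 2 m) =ᵐ[m]
      birkhoffAverage ℝ T g n := by
    intro n
    filter_upwards [Lp.coeFn_smul ((n : ℝ)⁻¹) (birkhoffSum K _root_.id n G), hsum n] with x h1 h2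
    rw [birkhoffAverage, h1, Pi.smul_apply, h2, birkhoffAverage]
  have hL1 : Tendsto (fun n : ℕ => ∫ x, |birkhoffAverage ℝ T g n x - c| ∂m) atTop (𝓝 0) := by
    have h0 : Tendsto (fun n : ℕ => ‖birkhoffAverage ℝ K _root_.id n G - q‖) atTop (𝓝 0) := by
      have := (tendsto_iff_norm_sub_tendsto_zero.1 hlim)
      exact this
    refine squeeze_zero (fun n => integral_nonneg fun x => abs_nonneg _) (fun n => ?_) h0
    have hae : ((birkhoffAverage ℝ K _root_.id n G - q : Lp ℝ 2 m) : Ω → ℝ) =ᵐ[m]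
        fun x => birkhoffAverage ℝ T g n x - c := by
      filter_upwards [Lp.coeFn_sub (birkhoffAverage ℝ K _root_.id n G) q, havg n, hc] with x h1 h2 h3
      rw [h1, Pi.sub_apply, h2, h3]; rfl
    have hmem : MemLp (fun x => birkhoffAverage ℝ T g n x - c) 2 m :=
      (memLp_congr_ae hae).1 (Lp.memLp _)
    have e1 : ∫ x, |birkhoffAverage ℝ T g n x - c| ∂m =
        (eLpNorm (fun x => birkhoffAverage ℝ T g n x - c) 1 m).toReal := by
      rw [eLpNorm_one_eq_lintegral_enorm, ← integral_norm_eq_lintegral_enorm hmem.1]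
      rfl
    rw [e1, Lp.norm_def, eLpNorm_congr_ae hae]
    exact ENNReal.toReal_mono hmem.2.ne
      (eLpNorm_le_eLpNorm_of_exponent_le (by norm_num) hmem.1)
  have hgi : Integrable g m := hg.integrable (by norm_num)
  have hint : ∀ n, Integrable (birkhoffAverage ℝ T g n) m := by
    exact fun n => integrable_birkhoffAverage hTm hgi n
  have hcg : c = ∫ y, g y ∂m := by
    have h2 : Tendsto (fun n : ℕ => |(∫ y, g y ∂m) - c|) atTop (𝓝 0) := by
      refine squeeze_zero' (Eventually.of_forall fun n => abs_nonneg _) ?_ hL1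
      filter_upwards [eventually_ne_atTop 0] with n hn
      rw [← integral_birkhoffAverage hTm hgi hn]
      have : ∫ x, birkhoffAverage ℝ T g n x ∂m - c = ∫ x, (birkhoffAverage ℝ T g n x - c) ∂m := by
        rw [integral_sub (hint n) (integrable_const c)]; simp
      rw [this]
      exact abs_integral_le_integral_abs
    have h3 := tendsto_nhds_unique h2 tendsto_const_nhds
    have := abs_eq_zero.1 h3.symm
    linarith
  rw [← hcg]; exact hL1

/-- A bounded sequence that is asymptotically invariant under an ergodic map has asymptotically
the same integrals against any bounded density: the density may be replaced by its Birkhoff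
averages, which tend to a constant. -/
theorem tendsto_integral_mul_density (hT : Ergodic T m) {h : ℕ → Ω → ℂ}
    (hmeas : ∀ n, AEStronglyMeasurable (h n) m) (hbd : ∀ n x, ‖h n x‖ ≤ 1)
    (hinv : Tendsto (fun n => ∫ x, ‖h n (T x) - h n x‖ ∂m) atTop (𝓝 0))
    {g : Ω → ℝ} (hg : Measurable g) {C : ℝ} (hgC : ∀ x, |g x| ≤ C) :
    Tendsto (fun n => ∫ x, h n x * g x ∂m - (∫ x, h n x ∂m) * (∫ x, g x ∂m : ℝ)) atTop (𝓝 0) := by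
  have hTm := hT.toMeasurePreserving
  set δ : ℕ → ℝ := fun n => ∫ x, ‖h n (T x) - h n x‖ ∂m with hδ
  have hC : 0 ≤ C := by
    obtain ⟨x⟩ : Nonempty Ω := nonempty_of_isProbabilityMeasure m
    exact (abs_nonneg _).trans (hgC x)
  have hint : ∀ n, Integrable (h n) m := fun n =>
    Integrable.of_bound (hmeas n) 1 (Eventually.of_forall (hbd n))
  have hcomp : ∀ n j, Integrable (fun x => h n (T^[j] x)) m := fun n j =>
    integrable_comp_iterate hTm (hint n) j
  have hgm : ∀ j : ℕ, AEStronglyMeasurable (fun x => ((g (T^[j] x) : ℝ) : ℂ)) m := fun j =>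
    (Complex.measurable_ofReal.comp (hg.comp (hTm.iterate j).measurable)).aestronglyMeasurable
  have hgb : ∀ j : ℕ, ∀ᵐ x ∂m, ‖((g (T^[j] x) : ℝ) : ℂ)‖ ≤ C := fun j =>
    Eventually.of_forall fun x => by simpa using hgC _
  -- the iterates of `T` change `h n` by little in `L¹`
  have hdrift : ∀ n j, ∫ x, ‖h n (T^[j] x) - h n x‖ ∂m ≤ j * δ n := by
    intro n j
    induction j with
    | zero => simp
    | succ j ih =>
      have e : ∫ x, ‖h n (T^[j + 1] x) - h n (T^[j] x)‖ ∂m = δ n := by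
        have := integral_comp_measurePreserving (hTm.iterate j)
          (g := fun x => ‖h n (T x) - h n x‖)
          (((hcomp n 1).sub (hint n)).norm.aestronglyMeasurable)
        simpa [Function.iterate_succ_apply'] using this
      calc ∫ x, ‖h n (T^[j + 1] x) - h n x‖ ∂m
          ≤ ∫ x, (‖h n (T^[j + 1] x) - h n (T^[j] x)‖ + ‖h n (T^[j] x) - h n x‖) ∂m := by
            refine integral_mono (((hcomp n _).sub (hint n)).norm)
              ((((hcomp n _).sub (hcomp n _)).norm).add (((hcomp n _).sub (hint n)).norm)) ?_
            intro x
            exact norm_sub_le_norm_sub_add_norm_sub _ _ _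
        _ = δ n + ∫ x, ‖h n (T^[j] x) - h n x‖ ∂m := by
            rw [← e]
            exact integral_add (((hcomp n _).sub (hcomp n _)).norm)
              (((hcomp n _).sub (hint n)).norm)
        _ ≤ δ n + j * δ n := by linarith
        _ = ((j + 1 : ℕ) : ℝ) * δ n := by push_cast; ring
  have hshift : ∀ n j, ‖∫ x, h n x * g x ∂m - ∫ x, h n x * g (T^[j] x) ∂m‖ ≤ C * (j * δ n) := by
    intro n j
    have e : ∫ x, h n x * g x ∂m = ∫ x, h n (T^[j] x) * g (T^[j] x) ∂m :=
      (integral_comp_measurePreserving (hTm.iterate j) (g := fun x => h n x * g x)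
        ((hmeas n).mul (by simpa using hgm 0))).symm
    rw [e, ← integral_sub ((hcomp n j).mul_bdd (hgm j) (hgb j)) ((hint n).mul_bdd (hgm j) (hgb j))]
    refine (norm_integral_le_integral_norm _).trans ?_
    calc ∫ x, ‖h n (T^[j] x) * g (T^[j] x) - h n x * g (T^[j] x)‖ ∂m
        ≤ ∫ x, C * ‖h n (T^[j] x) - h n x‖ ∂m := by
          refine integral_mono_of_nonneg (Eventually.of_forall fun x => norm_nonneg _)
            ((((hcomp n j).sub (hint n)).norm).const_mul C) (Eventually.of_forall fun x => ?_)
          show ‖_‖ ≤ _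
          rw [← sub_mul, norm_mul, mul_comm]
          refine mul_le_mul_of_nonneg_right ?_ (norm_nonneg _)
          simpa using hgC _
      _ = C * ∫ x, ‖h n (T^[j] x) - h n x‖ ∂m := integral_const_mul _ _
      _ ≤ C * (j * δ n) := mul_le_mul_of_nonneg_left (hdrift n j) hC
  have hgL2 : MemLp g 2 m := MemLp.of_bound hg.aestronglyMeasurable C
    (Eventually.of_forall hgC)
  have havint : ∀ J, Integrable (fun x => birkhoffAverage ℝ T g J x) m := by
    exact fun J => integrable_birkhoffAverage hTm (hgL2.integrable (by norm_num)) J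
  set e : ℕ → ℝ := fun J => ∫ x, |birkhoffAverage ℝ T g J x - ∫ y, g y ∂m| ∂m with he
  have hδ0 : ∀ n, 0 ≤ δ n := fun n => integral_nonneg fun x => norm_nonneg _
  -- replace `g` by its `J`-th Birkhoff average, then the average by its mean
  have hkey : ∀ n J : ℕ, J ≠ 0 →
      ‖∫ x, h n x * g x ∂m - (∫ x, h n x ∂m) * (∫ x, g x ∂m : ℝ)‖ ≤ C * (J * δ n) + e J := by
    intro n J hJ
    have hJ' : (J : ℂ) ≠ 0 := by exact_mod_cast hJ
    have hJ0 : (0 : ℝ) < J := by exact_mod_cast Nat.pos_of_ne_zero hJ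
    have e1 : ∫ x, h n x * (birkhoffAverage ℝ T g J x : ℝ) ∂m =
        (J : ℂ)⁻¹ * ∑ j ∈ Finset.range J, ∫ x, h n x * g (T^[j] x) ∂m := by
      rw [← integral_finsetSum _ fun j _ => (hint n).mul_bdd (hgm j) (hgb j), ← integral_const_mul]
      refine integral_congr_ae (Eventually.of_forall fun x => ?_)
      simp only [birkhoffAverage, birkhoffSum, smul_eq_mul]
      push_cast
      rw [Finset.mul_sum, Finset.mul_sum, Finset.mul_sum]
      exact Finset.sum_congr rfl fun i _ => by ring
    have b1 : ‖∫ x, h n x * g x ∂m - ∫ x, h n x * (birkhoffAverage ℝ T g J x : ℝ) ∂m‖ ≤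
        C * (J * δ n) := by
      have : ∫ x, h n x * g x ∂m - ∫ x, h n x * (birkhoffAverage ℝ T g J x : ℝ) ∂m =
          (J : ℂ)⁻¹ * ∑ j ∈ Finset.range J,
            (∫ x, h n x * g x ∂m - ∫ x, h n x * g (T^[j] x) ∂m) := by
        rw [e1, Finset.sum_sub_distrib]
        simp only [Finset.sum_const, Finset.card_range, nsmul_eq_mul]
        field_simp
      rw [this, norm_mul, norm_inv, Complex.norm_natCast]
      have h2 : ‖∑ j ∈ Finset.range J,
            (∫ x, h n x * g x ∂m - ∫ x, h n x * g (T^[j] x) ∂m)‖ ≤ J * (C * (J * δ n)) := by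
        refine (norm_sum_le _ _).trans ?_
        have := Finset.sum_le_card_nsmul (Finset.range J)
          (fun j => ‖∫ x, h n x * g x ∂m - ∫ x, h n x * g (T^[j] x) ∂m‖) (C * (J * δ n)) (by
            intro j hj
            refine (hshift n j).trans ?_
            have : (j : ℝ) ≤ J := by exact_mod_cast (Finset.mem_range.1 hj).le
            have := hδ0 n
            gcongr)
        simpa using this
      calc (J : ℝ)⁻¹ * _ ≤ (J : ℝ)⁻¹ * (J * (C * (J * δ n))) := by gcongr
        _ = C * (J * δ n) := by field_simp
    have hbint : Integrable (fun x => h n x * (birkhoffAverage ℝ T g J x : ℝ)) m :=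
      (havint J).ofReal.bdd_mul (hmeas n) (Eventually.of_forall (hbd n))
    have b2 : ‖∫ x, h n x * (birkhoffAverage ℝ T g J x : ℝ) ∂m -
        (∫ x, h n x ∂m) * (∫ x, g x ∂m : ℝ)‖ ≤ e J := by
      rw [← integral_mul_const, ← integral_sub hbint ((hint n).mul_const _)]
      refine (norm_integral_le_integral_norm _).trans ?_
      refine integral_mono_of_nonneg (Eventually.of_forall fun x => norm_nonneg _)
        (((havint J).sub (integrable_const _)).norm) (Eventually.of_forall fun x => ?_)
      show ‖_‖ ≤ _
      rw [← mul_sub, norm_mul, ← Complex.ofReal_sub, Complex.norm_real]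
      calc _ ≤ 1 * ‖birkhoffAverage ℝ T g J x - ∫ x, g x ∂m‖ := by gcongr; exact hbd n x
        _ = _ := one_mul _
    calc _ ≤ _ := norm_sub_le_norm_sub_add_norm_sub _
            (∫ x, h n x * (birkhoffAverage ℝ T g J x : ℝ) ∂m) _
      _ ≤ _ := add_le_add b1 b2
  have he0 := tendsto_integral_abs_birkhoffAverage_sub hT hgL2
  rw [Metric.tendsto_atTop]
  intro ε hε
  -- first fix a large `J`, then let `n` tend to infinity
  obtain ⟨J, hJe, hJ⟩ := ((he0.eventually (gt_mem_nhds (half_pos hε))).and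
    (eventually_ne_atTop 0)).exists
  have hlim : Tendsto (fun n => C * (J * δ n)) atTop (𝓝 0) := by
    simpa using (hinv.const_mul (J : ℝ)).const_mul C
  obtain ⟨N, hN⟩ := eventually_atTop.1 (hlim.eventually (gt_mem_nhds (half_pos hε)))
  refine ⟨N, fun n hn => ?_⟩
  rw [dist_zero_right]
  have := hkey n J hJ
  have h3 := hN n hn
  have h4 : e J < ε / 2 := hJe
  linarith

end MeanErgodic

/-! ### Maximal Birkhoff sums of bounded observables -/

section BoundedObservable

variable {Ω : Type*} {T : Ω → Ω}

theorem abs_birkhoffSum_le {v : Ω → ℝ} {C : ℝ} (hC : ∀ x, |v x| ≤ C) (n : ℕ) (x : Ω) :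
    |birkhoffSum T v n x| ≤ n * C := by
  refine (Finset.abs_sum_le_sum_abs _ _).trans ?_
  simpa using Finset.sum_le_card_nsmul (Finset.range n) (fun j => |v (T^[j] x)|) C
    fun j _ => hC _

/-- The maximum of the first `n` Birkhoff sums of a bounded observable of mean zero is `o(n)` in
probability: by boundedness it is enough to look at a fixed number of equally spaced times. -/
theorem tendsto_measure_exists_lt_abs_birkhoffSum [MeasurableSpace Ω] {m : Measure Ω}
    [IsProbabilityMeasure m] (hT : Ergodic T m)
    {v : Ω → ℝ} (hv : Measurable v) {C : ℝ} (hC : ∀ x, |v x| ≤ C) (hv0 : ∫ x, v x ∂m = 0)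
    {ε : ℝ} (hε : 0 < ε) :
    Tendsto (fun n : ℕ => m.real {x | ∃ j ≤ n, ε * n < |birkhoffSum T v j x|}) atTop (𝓝 0) := by
  have hTm := hT.toMeasurePreserving
  have hC0 : 0 ≤ C := by
    obtain ⟨x⟩ : Nonempty Ω := nonempty_of_isProbabilityMeasure m
    exact (abs_nonneg _).trans (hC x)
  have hL2 : MemLp v 2 m := MemLp.of_bound hv.aestronglyMeasurable C (Eventually.of_forall hC)
  have hvi : Integrable v m := hL2.integrable (by norm_num)
  have hmean := tendsto_integral_abs_birkhoffAverage_sub hT hL2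
  simp only [hv0, sub_zero] at hmean
  obtain ⟨J, hJ⟩ := exists_nat_gt (4 * C / ε)
  have hJ0 : 0 < J := by
    rcases Nat.eq_zero_or_pos J with h | h
    · rw [h] at hJ; have : 0 ≤ 4 * C / ε := by positivity
      simp at hJ; linarith
    · exact h
  have hJ0' : (0 : ℝ) < J := by exact_mod_cast hJ0
  -- the spacing of the grid
  set s : ℕ → ℕ := fun n => n / J + 1 with hs
  have hsT : Tendsto s atTop atTop :=
    (tendsto_add_atTop_nat 1).comp (Nat.tendsto_div_const_atTop hJ0.ne')
  have hsum : Tendsto (fun n : ℕ => ∑ i ∈ Finset.range J,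
      4 / ε * ∫ x, |birkhoffAverage ℝ T v (s n * i) x| ∂m) atTop (𝓝 0) := by
    rw [← Finset.sum_const_zero (s := Finset.range J)]
    refine tendsto_finsetSum _ fun i _ => ?_
    rcases Nat.eq_zero_or_pos i with h | h
    · subst h; simp
    · have : Tendsto (fun n => s n * i) atTop atTop := hsT.atTop_mul_const' h
      simpa using (hmean.comp this).const_mul (4 / ε)
  refine squeeze_zero' (Eventually.of_forall fun n => measureReal_nonneg) ?_ hsum
  have hbig : ∀ᶠ n : ℕ in atTop, C ≤ ε / 4 * n := by
    have : Tendsto (fun n : ℕ => ε / 4 * (n : ℝ)) atTop atTop :=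
      tendsto_natCast_atTop_atTop.const_mul_atTop (by positivity)
    exact this.eventually_ge_atTop C
  filter_upwards [hbig, eventually_ge_atTop J] with n hn hnJ
  have hn0 : (0 : ℝ) < n := by exact_mod_cast hJ0.trans_le hnJ
  have hsn : (s n : ℝ) ≤ n / J + 1 := by
    simp only [hs]; push_cast; gcongr; exact Nat.cast_div_le
  have hsC : s n * C ≤ ε / 2 * n := by
    have h1 : (n / J : ℝ) * C ≤ ε / 4 * n := by
      rw [div_lt_iff₀ hε] at hJ
      rw [div_mul_eq_mul_div, div_le_iff₀ hJ0']
      nlinarith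
    calc s n * C ≤ (n / J + 1) * C := by gcongr
      _ ≤ ε / 2 * n := by linarith
  -- a time `j ≤ n` is at distance less than `s n` from the grid point `s n * (j / s n)`
  have hsub : {x | ∃ j ≤ n, ε * n < |birkhoffSum T v j x|} ⊆
      ⋃ i ∈ Finset.range J, {x | ε / 2 * n ≤ |birkhoffSum T v (s n * i) x|} := by
    rintro x ⟨j, hj, hx⟩
    have hlt : j / s n < J := by
      rw [Nat.div_lt_iff_lt_mul (by simp [hs])]
      calc j ≤ n := hj
        _ < J * (n / J + 1) := Nat.lt_mul_div_succ n hJ0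
    simp only [mem_iUnion, Finset.mem_range, mem_ofPred_eq]
    refine ⟨j / s n, hlt, ?_⟩
    have hdec : birkhoffSum T v j x = birkhoffSum T v (s n * (j / s n)) x +
        birkhoffSum T v (j % s n) (T^[s n * (j / s n)] x) := by
      rw [← birkhoffSum_add, Nat.div_add_mod]
    have h2 : |birkhoffSum T v (j % s n) (T^[s n * (j / s n)] x)| ≤ s n * C := by
      refine (abs_birkhoffSum_le hC _ _).trans ?_
      have : ((j % s n : ℕ) : ℝ) ≤ s n := by
        exact_mod_cast (Nat.mod_lt _ (by simp [hs])).le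
      gcongr
    have h3 := abs_add_le (birkhoffSum T v (s n * (j / s n)) x)
      (birkhoffSum T v (j % s n) (T^[s n * (j / s n)] x))
    rw [← hdec] at h3
    linarith
  refine (measureReal_mono hsub (measure_ne_top _ _)).trans ((measureReal_biUnion_finset_le _ _).trans ?_)
  refine Finset.sum_le_sum fun i hi => ?_
  have hmk := mul_meas_ge_le_integral_of_nonneg (μ := m)
    (f := fun x => |birkhoffSum T v (s n * i) x|) (Eventually.of_forall fun x => abs_nonneg _)
    (integrable_birkhoffSum hTm hvi _).abs (ε / 2 * n)
  have hle : ((s n * i : ℕ) : ℝ) ≤ 2 * n := by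
    have h1 : s n * i ≤ s n * J := Nat.mul_le_mul_left _ (Finset.mem_range.1 hi).le
    have h2 : s n * J ≤ 2 * n := by
      simp only [hs]; have := Nat.div_mul_le_self n J; rw [add_mul]; omega
    exact_mod_cast h1.trans h2
  have e1 : ∫ x, |birkhoffSum T v (s n * i) x| ∂m =
      ((s n * i : ℕ) : ℝ) * ∫ x, |birkhoffAverage ℝ T v (s n * i) x| ∂m := by
    rw [← integral_const_mul]
    refine integral_congr_ae (Eventually.of_forall fun x => ?_)
    simp only [birkhoffAverage, smul_eq_mul, abs_mul, abs_inv, Nat.abs_cast]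
    rcases Nat.eq_zero_or_pos (s n * i) with h | h
    · rw [h]; simp
    · have : ((s n * i : ℕ) : ℝ) ≠ 0 := by exact_mod_cast h.ne'
      field_simp
  have hnn : 0 ≤ ∫ x, |birkhoffAverage ℝ T v (s n * i) x| ∂m :=
    integral_nonneg fun x => abs_nonneg _
  have h5 : ε / 2 * n * m.real {x | ε / 2 * n ≤ |birkhoffSum T v (s n * i) x|} ≤
      2 * n * ∫ x, |birkhoffAverage ℝ T v (s n * i) x| ∂m := by
    refine hmk.trans ?_
    rw [e1]; gcongr
  refine le_of_mul_le_mul_left (h5.trans (le_of_eq ?_)) (show 0 < ε / 2 * n by positivity)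
  field_simp
  ring

end BoundedObservable

/-! ### Kac's formula -/

section Kac

variable {Λ : Type*} {T : Λ → Λ} {X : Set Λ}

/-- The points of `X` that do not return to `X` up to time `l`. -/
def lateReturn (T : Λ → Λ) (X : Set Λ) (l : ℕ) : Set Λ :=
  {x | x ∈ X ∧ ∀ i, 1 ≤ i → i ≤ l → T^[i] x ∉ X}

/-- The points that avoid `X` up to time `n`. -/
def avoiding (T : Λ → Λ) (X : Set Λ) (n : ℕ) : Set Λ := {x | ∀ i ≤ n, T^[i] x ∉ X}

/-- A point whose image avoids `X` up to time `n` lies in `X` or not; this is the induction step behind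
Kac's formula. -/
theorem preimage_avoiding (n : ℕ) :
    T ⁻¹' avoiding T X n = lateReturn T X (n + 1) ∪ avoiding T X (n + 1) := by
  ext x
  simp only [avoiding, lateReturn, mem_preimage, mem_ofPred_eq, mem_union,
    ← Function.iterate_succ_apply]
  constructor
  · intro h
    by_cases hx : x ∈ X
    · left
      refine ⟨hx, fun i h1 hi => ?_⟩
      obtain ⟨k, rfl⟩ : ∃ k, i = k + 1 := ⟨i - 1, by omega⟩
      exact h k (by omega)
    · right
      intro i hi
      rcases Nat.eq_zero_or_pos i with h0 | h0
      · subst h0; exact hx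
      · obtain ⟨k, rfl⟩ : ∃ k, i = k + 1 := ⟨i - 1, by omega⟩
        exact h k (by omega)
  · rintro (h | h) i hi
    · exact h.2 (i + 1) (by omega) (by omega)
    · exact h (i + 1) (by omega)

variable [MeasurableSpace Λ] {μ : Measure Λ}

theorem measurableSet_avoiding (hT : Measurable T) (hX : MeasurableSet X) (n : ℕ) :
    MeasurableSet (avoiding T X n) := by
  have : avoiding T X n = ⋂ i, ⋂ (_ : i ≤ n), (T^[i] ⁻¹' X)ᶜ := by ext; simp [avoiding]
  rw [this]
  exact MeasurableSet.iInter fun i => MeasurableSet.iInter fun _ => (hT.iterate i hX).compl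

theorem measurableSet_lateReturn (hT : Measurable T) (hX : MeasurableSet X) (l : ℕ) :
    MeasurableSet (lateReturn T X l) := by
  have : lateReturn T X l = X ∩ ⋂ i, ⋂ (_ : 1 ≤ i), ⋂ (_ : i ≤ l), (T^[i] ⁻¹' X)ᶜ := by
    ext; simp [lateReturn]
  rw [this]
  exact hX.inter (MeasurableSet.iInter fun i => MeasurableSet.iInter fun _ =>
    MeasurableSet.iInter fun _ => (hT.iterate i hX).compl)

/-- Decomposition of a space average according to the last visit to `X` before time `n`. -/
theorem lintegral_eq_sum_lateReturn (hT : MeasurePreserving T μ μ) (hX : MeasurableSet X)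
    {w : Λ → ℝ≥0∞} (hw : Measurable w) (n : ℕ) :
    ∫⁻ x, w x ∂μ = ∑ l ∈ Finset.range (n + 1), ∫⁻ x in lateReturn T X l, w (T^[l] x) ∂μ +
      ∫⁻ x in avoiding T X n, w (T^[n] x) ∂μ := by
  induction n with
  | zero =>
    have h0 : lateReturn T X 0 = X := by
      ext x; simp only [lateReturn, mem_ofPred_eq, and_iff_left_iff_imp]; intros; omega
    have h1 : avoiding T X 0 = Xᶜ := by ext x; simp [avoiding]
    simp only [zero_add, Finset.range_one, Finset.sum_singleton, h0, h1, Function.iterate_zero, id]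
    exact (lintegral_add_compl w hX).symm
  | succ n ih =>
    rw [ih, Finset.sum_range_succ _ (n + 1), add_assoc]
    congr 1
    have e : ∫⁻ x in avoiding T X n, w (T^[n] x) ∂μ =
        ∫⁻ x in T ⁻¹' avoiding T X n, w (T^[n + 1] x) ∂μ := by
      have := hT.setLIntegral_comp_preimage (measurableSet_avoiding hT.measurable hX n)
        (hw.comp (hT.measurable.iterate n))
      simpa [Function.iterate_succ_apply] using this.symm
    rw [e, preimage_avoiding, lintegral_union (measurableSet_avoiding hT.measurable hX _)]
    rw [Set.disjoint_left]
    intro x hx hx'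
    exact hx' 0 (Nat.zero_le _) hx.1

theorem tendsto_measure_avoiding [IsProbabilityMeasure μ] (hT : Ergodic T μ)
    (hX : MeasurableSet X) (hX0 : μ X ≠ 0) :
    Tendsto (fun n => μ (avoiding T X n)) atTop (𝓝 0) := by
  have hTm := hT.toMeasurePreserving.measurable
  have hE : MeasurableSet (⋃ i, T^[i] ⁻¹' X) := MeasurableSet.iUnion fun i => hTm.iterate i hX
  have hsub : T ⁻¹' (⋃ i, T^[i] ⁻¹' X) ⊆ ⋃ i, T^[i] ⁻¹' X := by
    intro x hx
    simp only [mem_preimage, mem_iUnion, ← Function.iterate_succ_apply] at hx ⊢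
    obtain ⟨i, hi⟩ := hx
    exact ⟨i + 1, hi⟩
  have hXsub : X ⊆ ⋃ i, T^[i] ⁻¹' X := subset_iUnion (fun i => T^[i] ⁻¹' X) 0
  have hfull : (⋃ i, T^[i] ⁻¹' X : Set Λ) =ᵐ[μ] univ := by
    rcases hT.ae_empty_or_univ_of_preimage_ae_le hE.nullMeasurableSet hsub.eventuallyLE with h | h
    · exact absurd (measure_mono_null hXsub (by rw [measure_congr h, measure_empty])) hX0
    · exact h
  have hanti : Antitone (avoiding T X) := fun a b hab x hx i hi => hx i (hi.trans hab)
  have := tendsto_measure_iInter_atTop (μ := μ)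
    (fun n => (measurableSet_avoiding hTm hX n).nullMeasurableSet) hanti ⟨0, measure_ne_top _ _⟩
  have h0 : μ (⋂ n, avoiding T X n) = 0 := by
    have : (⋂ n, avoiding T X n) ⊆ (⋃ i, T^[i] ⁻¹' X)ᶜ := by
      intro x hx
      simp only [mem_compl_iff, mem_iUnion, mem_preimage, not_exists]
      intro i
      exact mem_iInter.1 hx i i le_rfl
    refine measure_mono_null this ?_
    rw [measure_congr hfull.compl]; simp
  rwa [h0] at this

/-- Decomposition of a space average according to the last visit to `X`: almost every point visits
`X`, and the boundary term of the finite decomposition vanishes for a bounded function. -/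
theorem lintegral_eq_tsum_lateReturn [IsProbabilityMeasure μ] (hT : Ergodic T μ)
    (hX : MeasurableSet X) (hX0 : μ X ≠ 0) {w : Λ → ℝ≥0∞} (hw : Measurable w) {M : ℝ≥0∞}
    (hM : M ≠ ∞) (hwM : ∀ x, w x ≤ M) :
    ∫⁻ x, w x ∂μ = ∑' l, ∫⁻ x in lateReturn T X l, w (T^[l] x) ∂μ := by
  have h1 : Tendsto (fun n => ∫⁻ x in avoiding T X n, w (T^[n] x) ∂μ) atTop (𝓝 0) := by
    have h0 : Tendsto (fun n => M * μ (avoiding T X n)) atTop (𝓝 0) := by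
      simpa using ENNReal.Tendsto.const_mul (tendsto_measure_avoiding hT hX hX0) (Or.inr hM)
    refine tendsto_of_tendsto_of_tendsto_of_le_of_le tendsto_const_nhds h0
      (fun n => zero_le) (fun n => ?_)
    calc ∫⁻ x in avoiding T X n, w (T^[n] x) ∂μ ≤ ∫⁻ x in avoiding T X n, M ∂μ :=
          lintegral_mono fun x => hwM _
      _ = _ := by simp
  have h2 := (ENNReal.tendsto_nat_tsum fun l => ∫⁻ x in lateReturn T X l, w (T^[l] x) ∂μ).comp
    (tendsto_add_atTop_nat 1)
  have h3 := h2.add h1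
  rw [add_zero] at h3
  refine tendsto_nhds_unique ?_ h3
  refine tendsto_const_nhds.congr fun n => ?_
  exact lintegral_eq_sum_lateReturn hT.toMeasurePreserving hX hw n

end Kac

/-! ### The first return map -/

section FirstReturn

theorem measurable_apply_natValued {α β : Type*} [MeasurableSpace α] [MeasurableSpace β]
    {N : α → ℕ} (hN : Measurable N) {F : ℕ → α → β} (hF : ∀ n, Measurable (F n)) :
    Measurable fun x => F (N x) x :=
  (measurable_from_prod_countable_right (f := fun p : ℕ × α => F p.1 p.2) hF).comp
    (hN.prodMk measurable_id)

theorem measurable_birkhoffSum {α M : Type*} [MeasurableSpace α] [MeasurableSpace M]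
    [AddCommMonoid M] [MeasurableAdd₂ M] {T : α → α} (hT : Measurable T) {g : α → M}
    (hg : Measurable g) (n : ℕ) : Measurable (birkhoffSum T g n) :=
  Finset.measurable_sum _ fun i _ => hg.comp (hT.iterate i)

variable {Λ : Type*} {T : Λ → Λ} {X : Set Λ}

theorem lt_returnTime_iff {x : X} (hx : ∃ n, 1 ≤ n ∧ T^[n] (x : Λ) ∈ X) (l : ℕ) :
    l < returnTime T X x ↔ (x : Λ) ∈ lateReturn T X l := by
  have hmem : 1 ≤ returnTime T X x ∧ T^[returnTime T X x] (x : Λ) ∈ X := Nat.sInf_mem hx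
  constructor
  · intro hl
    refine ⟨x.2, fun i h1 hi hiX => ?_⟩
    have : returnTime T X x ≤ i := Nat.sInf_le ⟨h1, hiX⟩
    omega
  · intro hl
    by_contra hcon
    exact hl.2 _ hmem.1 (not_lt.1 hcon) hmem.2

/-- The `n`-th return to `X` takes place at the time `∑_{j < n} φ ∘ f^j`. -/
theorem iterate_birkhoffSum_returnTime (n : ℕ) (x : X) :
    T^[birkhoffSum (returnMap T X) (returnTime T X) n x] (x : Λ) = ((returnMap T X)^[n] x : X) := by
  induction n with
  | zero => simp
  | succ n ih =>
    rw [birkhoffSum_succ, add_comm, Function.iterate_add_apply, ih, Function.iterate_succ_apply']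
    rfl

/-- The sum of `v` up to the `n`-th return to `X` is the `n`-th sum of the induced observable. -/
theorem birkhoffSum_birkhoffSum_returnTime {M : Type*} [AddCommMonoid M] (v : Λ → M) (n : ℕ)
    (x : X) :
    birkhoffSum T v (birkhoffSum (returnMap T X) (returnTime T X) n x) (x : Λ) =
      birkhoffSum (returnMap T X) (fun z => birkhoffSum T v (returnTime T X z) (z : Λ)) n x := by
  induction n with
  | zero => simp
  | succ n ih =>
    rw [birkhoffSum_succ, birkhoffSum_succ, ← ih, birkhoffSum_add, iterate_birkhoffSum_returnTime]

theorem natCast_birkhoffSum {α : Type*} (f : α → α) (g : α → ℕ) (n : ℕ) (x : α) :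
    ((birkhoffSum f g n x : ℕ) : ℝ) = birkhoffSum f (fun z => (g z : ℝ)) n x := by
  simp [birkhoffSum]

theorem abs_induced_le {v : Λ → ℝ} {C : ℝ} (hC : ∀ x, |v x| ≤ C) (x : X) :
    |induced T X v x| ≤ returnTime T X x * C := abs_birkhoffSum_le hC _ _

variable [MeasurableSpace Λ] {μ : Measure Λ}

theorem measurable_returnTime (hT : Measurable T) (hX : MeasurableSet X) :
    Measurable (returnTime T X) := by
  refine measurable_of_Ioi fun l => ?_
  have : returnTime T X ⁻¹' Ioi l =
      Subtype.val ⁻¹' (lateReturn T X l ∩ ⋃ n, ⋃ (_ : 1 ≤ n), T^[n] ⁻¹' X) := by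
    ext x
    simp only [mem_preimage, mem_Ioi, mem_inter_iff, mem_iUnion, exists_prop]
    by_cases hx : ∃ n, 1 ≤ n ∧ T^[n] (x : Λ) ∈ X
    · rw [lt_returnTime_iff hx]; exact ⟨fun h => ⟨h, hx⟩, fun h => h.1⟩
    · -- `returnTime` is the infimum of the empty set, which is `0`
      have : returnTime T X x = 0 := by
        rw [returnTime, Nat.sInf_eq_zero]
        right
        ext n
        simp only [mem_ofPred_eq, mem_empty_iff_false, iff_false]
        exact fun h => hx ⟨n, h⟩
      rw [this]
      exact ⟨fun h => absurd h (Nat.not_lt_zero _), fun h => absurd h.2 hx⟩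
  rw [this]
  exact measurable_subtype_coe ((measurableSet_lateReturn hT hX l).inter
    (MeasurableSet.iUnion fun n => MeasurableSet.iUnion fun _ => hT.iterate n hX))

theorem measurable_returnMap (hT : Measurable T) (hX : MeasurableSet X) :
    Measurable (returnMap T X) :=
  (measurable_apply_natValued (measurable_returnTime hT hX)
    (F := fun n (x : X) => T^[n] (x : Λ))
    fun n => (hT.iterate n).comp measurable_subtype_coe).subtype_mk

theorem measurable_birkhoffSum_returnTime {M : Type*} [MeasurableSpace M]
    [AddCommMonoid M] [MeasurableAdd₂ M] (hT : Measurable T) (hX : MeasurableSet X) {v : Λ → M}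
    (hv : Measurable v) : Measurable fun x : X => birkhoffSum T v (returnTime T X x) (x : Λ) :=
  measurable_apply_natValued (measurable_returnTime hT hX)
    (F := fun n (x : X) => birkhoffSum T v n (x : Λ))
    fun n => (measurable_birkhoffSum hT hv n).comp measurable_subtype_coe

variable [IsProbabilityMeasure μ]

theorem ae_exists_return (hT : Ergodic T μ) (hX : MeasurableSet X) (hX0 : μ X ≠ 0) :
    ∀ᵐ x ∂μ.restrict X, ∃ n, 1 ≤ n ∧ T^[n] x ∈ X := by
  rw [ae_restrict_iff' hX]
  have hle : ∀ n, μ {x | ¬ (x ∈ X → ∃ n, 1 ≤ n ∧ T^[n] x ∈ X)} ≤ μ (avoiding T X n) := by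
    intro n
    rw [← hT.toMeasurePreserving.measure_preimage
      (measurableSet_avoiding hT.measurable hX n).nullMeasurableSet]
    refine measure_mono fun x hx => ?_
    simp only [mem_ofPred_eq, Classical.not_imp, not_exists, not_and] at hx
    intro i hi
    rw [← Function.iterate_succ_apply]
    exact hx.2 (i + 1) (by omega)
  exact le_antisymm (ge_of_tendsto' (tendsto_measure_avoiding hT hX hX0) hle) zero_le

/-- Kac's formula for a bounded nonnegative observable. -/
theorem lintegral_birkhoffSum_returnTime (hT : Ergodic T μ) (hX : MeasurableSet X) (hX0 : μ X ≠ 0)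
    {w : Λ → ℝ≥0∞} (hw : Measurable w) {M : ℝ≥0∞} (hM : M ≠ ∞) (hwM : ∀ x, w x ≤ M) :
    ∫⁻ x : X, birkhoffSum T w (returnTime T X x) (x : Λ) ∂(restrictedMeasure μ X) =
      (μ X)⁻¹ * ∫⁻ x, w x ∂μ := by
  have hTm := hT.toMeasurePreserving.measurable
  rw [restrictedMeasure, lintegral_smul_measure, smul_eq_mul]
  congr 1
  have hae : ∀ᵐ x : X ∂μ.comap (Subtype.val : X → Λ),
      birkhoffSum T w (returnTime T X x) (x : Λ) =
        ∑' l, (lateReturn T X l).indicator (fun y => w (T^[l] y)) (x : Λ) := by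
    have h := ae_exists_return hT hX hX0
    rw [← map_comap_subtype_coe hX, (MeasurableEmbedding.subtype_coe hX).ae_map_iff] at h
    filter_upwards [h] with x hx
    rw [tsum_eq_sum (s := Finset.range (returnTime T X x))]
    · refine Finset.sum_congr rfl fun l hl => ?_
      rw [indicator_of_mem ((lt_returnTime_iff hx l).1 (Finset.mem_range.1 hl))]
    · intro l hl
      rw [indicator_of_notMem]
      exact fun h => hl (Finset.mem_range.2 ((lt_returnTime_iff hx l).2 h))
  have hmeas : ∀ l, Measurable ((lateReturn T X l).indicator fun y => w (T^[l] y)) := fun l =>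
    (hw.comp (hTm.iterate l)).indicator (measurableSet_lateReturn hTm hX l)
  rw [lintegral_congr_ae hae, lintegral_subtype_comap hX
    (fun x => ∑' l, (lateReturn T X l).indicator (fun y => w (T^[l] y)) x),
    lintegral_tsum fun l => (hmeas l).aemeasurable,
    lintegral_eq_tsum_lateReturn hT hX hX0 hw hM hwM]
  refine tsum_congr fun l => ?_
  rw [lintegral_indicator (measurableSet_lateReturn hTm hX l),
    Measure.restrict_restrict (measurableSet_lateReturn hTm hX l)]
  congr 2
  exact inter_eq_left.2 fun x hx => hx.1

/-- Kac's formula for the mean return time. -/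
theorem lintegral_returnTime (hT : Ergodic T μ) (hX : MeasurableSet X) (hX0 : μ X ≠ 0) :
    ∫⁻ x : X, (returnTime T X x : ℝ≥0∞) ∂(restrictedMeasure μ X) = (μ X)⁻¹ := by
  have := lintegral_birkhoffSum_returnTime hT hX hX0 (w := fun _ => 1) measurable_const
    ENNReal.one_ne_top (fun _ => le_rfl)
  simpa [birkhoffSum] using this

theorem integrable_returnTime (hT : Ergodic T μ) (hX : MeasurableSet X) (hX0 : μ X ≠ 0) :
    Integrable (fun x : X => (returnTime T X x : ℝ)) (restrictedMeasure μ X) := by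
  refine ⟨(measurable_from_top.comp
    (measurable_returnTime hT.measurable hX)).aestronglyMeasurable, ?_⟩
  rw [hasFiniteIntegral_iff_enorm]
  have : ∀ x : X, ‖(returnTime T X x : ℝ)‖ₑ = (returnTime T X x : ℝ≥0∞) := fun x => by
    simp [Real.enorm_natCast]
  simp only [this, lintegral_returnTime hT hX hX0]
  exact ENNReal.inv_lt_top.2 (pos_iff_ne_zero.2 hX0)

theorem meanReturnTime_pos (hT : Ergodic T μ) (hX : MeasurableSet X) (hX0 : μ X ≠ 0) :
    0 < meanReturnTime T μ X := by
  have h := lintegral_returnTime hT hX hX0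
  have e : meanReturnTime T μ X = ((μ X)⁻¹).toReal := by
    rw [← h, meanReturnTime, integral_eq_lintegral_of_nonneg_ae
      (Eventually.of_forall fun x => Nat.cast_nonneg _)
      (integrable_returnTime hT hX hX0).aestronglyMeasurable]
    simp
  rw [e]
  exact ENNReal.toReal_pos (ENNReal.inv_ne_zero.2 (measure_ne_top _ _)) (ENNReal.inv_ne_top.2 hX0)

theorem measurable_induced {v : Λ → ℝ} (hT : Measurable T) (hX : MeasurableSet X)
    (hv : Measurable v) : Measurable (induced T X v) :=
  measurable_birkhoffSum_returnTime hT hX hv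

theorem integrable_induced (hT : Ergodic T μ) (hX : MeasurableSet X) (hX0 : μ X ≠ 0)
    {v : Λ → ℝ} (hv : Measurable v) {C : ℝ} (hC : ∀ x, |v x| ≤ C) :
    Integrable (induced T X v) (restrictedMeasure μ X) :=
  ((integrable_returnTime hT hX hX0).mul_const C).mono'
    (measurable_induced hT.measurable hX hv).aestronglyMeasurable
    (Eventually.of_forall fun x => abs_induced_le hC x)

/-- Kac's formula for a bounded observable of mean zero. -/
theorem integral_induced_eq_zero (hT : Ergodic T μ) (hX : MeasurableSet X) (hX0 : μ X ≠ 0)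
    {v : Λ → ℝ} (hv : Measurable v) {C : ℝ} (hC : ∀ x, |v x| ≤ C) (hv0 : ∫ x, v x ∂μ = 0) :
    ∫ x, induced T X v x ∂(restrictedMeasure μ X) = 0 := by
  have hnn : ∀ x, 0 ≤ v x + C := fun x => by linarith [neg_le_of_abs_le (hC x)]
  have hC0 : 0 ≤ C := by
    obtain ⟨x⟩ : Nonempty Λ := nonempty_of_isProbabilityMeasure μ
    exact (abs_nonneg _).trans (hC x)
  have hi := integrable_induced hT hX hX0 hv hC
  have hφ := (integrable_returnTime hT hX hX0).mul_const C
  have hvi : Integrable v μ := Integrable.of_bound hv.aestronglyMeasurable C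
    (Eventually.of_forall hC)
  -- Kac's formula for `0 ≤ u ≤ 2 C`, to be applied to `v + C` and to the constant `C`
  have key : ∀ u : Λ → ℝ, Measurable u → (∀ x, 0 ≤ u x) → (∀ x, u x ≤ 2 * C) →
      ∫ x, induced T X u x ∂(restrictedMeasure μ X) = ((μ X)⁻¹).toReal * ∫ x, u x ∂μ := by
    intro u hu hu0 huC
    have h := lintegral_birkhoffSum_returnTime hT hX hX0 (w := fun x => ENNReal.ofReal (u x))
      hu.ennreal_ofReal (M := ENNReal.ofReal (2 * C)) ENNReal.ofReal_ne_top
      (fun x => ENNReal.ofReal_le_ofReal (huC x))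
    have e : ∀ x : X, ENNReal.ofReal (induced T X u x) =
        birkhoffSum T (fun x => ENNReal.ofReal (u x)) (returnTime T X x) (x : Λ) := fun x => by
      rw [induced, birkhoffSum, ENNReal.ofReal_sum_of_nonneg fun i _ => hu0 _]; rfl
    have hnn' : ∀ x, 0 ≤ induced T X u x := fun x => by
      unfold induced birkhoffSum
      exact Finset.sum_nonneg fun i _ => hu0 _
    rw [integral_eq_lintegral_of_nonneg_ae (Eventually.of_forall hnn')
      (measurable_induced hT.measurable hX hu).aestronglyMeasurable,
      integral_eq_lintegral_of_nonneg_ae (Eventually.of_forall hu0) hu.aestronglyMeasurable]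
    simp only [e, h, ENNReal.toReal_mul]
  have h1 := key (fun x => v x + C) (hv.add_const C) hnn
    (fun x => by linarith [le_of_abs_le (hC x)])
  have h2 := key (fun _ => C) measurable_const (fun _ => hC0) (fun _ => by linarith)
  have e1 : ∀ x, induced T X (fun x => v x + C) x =
      induced T X v x + induced T X (fun _ => C) x := fun x => by
    simp only [induced, birkhoffSum, Finset.sum_add_distrib]
  have hi2 : Integrable (induced T X (fun _ => C)) (restrictedMeasure μ X) :=
    integrable_induced hT hX hX0 measurable_const (C := C) fun _ => by rw [abs_of_nonneg hC0]
  simp only [e1] at h1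
  rw [integral_add hi hi2, h2, integral_add hvi (integrable_const C), hv0, zero_add] at h1
  linarith

end FirstReturn

/-! ### The von Bahr-Esseen inequality -/

section VonBahrEsseen

theorem rpow_one_add_le {r t : ℝ} (hr : 1 ≤ r) (hr2 : r ≤ 2) (ht : |t| ≤ 1) :
    (1 + t) ^ r ≤ 1 + r * t + |t| ^ r := by
  have ht' := abs_le.1 ht
  rcases eq_or_lt_of_le ht'.1 with h | h
  · rw [← h]; norm_num [Real.zero_rpow (by linarith : r ≠ 0)]; linarith
  have h0 : 0 < 1 + t := by linarith
  have h1 : (1 + t) ^ (r - 1) ≤ 1 + (r - 1) * t :=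
    rpow_one_add_le_one_add_mul_self ht'.1 (by linarith) (by linarith)
  have h2 : t ^ 2 ≤ |t| ^ r := by
    rw [← sq_abs, ← Real.rpow_two]
    rcases eq_or_lt_of_le (abs_nonneg t) with h | h
    · rw [← h, Real.zero_rpow (by linarith : r ≠ 0), Real.zero_rpow (by norm_num)]
    · exact Real.rpow_le_rpow_of_exponent_ge h ht hr2
  have h3 : (1 + t) ^ r = (1 + t) * (1 + t) ^ (r - 1) := by
    rw [Real.rpow_sub_one h0.ne']; field_simp
  rw [h3]
  nlinarith [mul_le_mul_of_nonneg_left h1 h0.le, sq_nonneg t]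

/-- A first order expansion of `|x|^r`, with a remainder of order `|y|^r`. -/
theorem abs_add_rpow_le {r : ℝ} (hr : 1 ≤ r) (hr2 : r ≤ 2) (x y : ℝ) :
    |x + y| ^ r ≤ |x| ^ r + r * (SignType.sign x * |x| ^ (r - 1)) * y + 6 * |y| ^ r := by
  rcases le_or_gt |y| |x| with h | h
  · rcases eq_or_ne x 0 with hx | hx
    · subst hx
      have : y = 0 := by simpa using h
      subst this
      simp [Real.zero_rpow (by linarith : r ≠ 0)]
    have hx0 : 0 < |x| := abs_pos.2 hx
    have hsx : (SignType.sign x : ℝ) * |x| = x := sign_mul_abs x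
    have e1 : |x + y| = |x| * (1 + y / x) := by
      have ht : |y / x| ≤ 1 := by rw [abs_div]; exact (div_le_one hx0).2 h
      have : x + y = x * (1 + y / x) := by field_simp
      rw [this, abs_mul, abs_of_nonneg (show 0 ≤ 1 + y / x by linarith [neg_le_of_abs_le ht])]
    have ht : |y / x| ≤ 1 := by rw [abs_div]; exact (div_le_one hx0).2 h
    have h1 := rpow_one_add_le hr hr2 ht
    rw [e1, Real.mul_rpow hx0.le (by linarith [neg_le_of_abs_le ht])]
    have e2 : |x| ^ r * |y / x| ^ r = |y| ^ r := by
      rw [← Real.mul_rpow hx0.le (abs_nonneg _), abs_div]; congr 1; field_simp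
    have e3 : |x| ^ r * (y / x) = (SignType.sign x * |x| ^ (r - 1)) * y := by
      rw [Real.rpow_sub_one hx0.ne']
      have : (SignType.sign x : ℝ) * (|x| ^ r / |x|) * x = |x| ^ r := by
        calc _ = ((SignType.sign x : ℝ) * x) * (|x| ^ r / |x|) := by ring
          _ = |x| * (|x| ^ r / |x|) := by rw [sign_mul_self]
          _ = |x| ^ r := by field_simp
      calc |x| ^ r * (y / x) = ((SignType.sign x : ℝ) * (|x| ^ r / |x|) * x) * (y / x) := by
            rw [this]
        _ = _ := by field_simp
    calc |x| ^ r * (1 + y / x) ^ r ≤ |x| ^ r * (1 + r * (y / x) + |y / x| ^ r) := by gcongr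
      _ = |x| ^ r + r * (|x| ^ r * (y / x)) + |x| ^ r * |y / x| ^ r := by ring
      _ = |x| ^ r + r * (SignType.sign x * |x| ^ (r - 1)) * y + |y| ^ r := by rw [e2, e3]; ring
      _ ≤ _ := by linarith [Real.rpow_nonneg (abs_nonneg y) r]
  · have hy0 : 0 < |y| := (abs_nonneg x).trans_lt h
    have h1 : |x + y| ^ r ≤ 4 * |y| ^ r := by
      calc |x + y| ^ r ≤ (2 * |y|) ^ r := by
            refine Real.rpow_le_rpow (abs_nonneg _) ?_ (by linarith)
            linarith [abs_add_le x y]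
        _ = 2 ^ r * |y| ^ r := Real.mul_rpow (by norm_num) hy0.le
        _ ≤ 2 ^ (2 : ℝ) * |y| ^ r := by
            gcongr; norm_num
        _ = 4 * |y| ^ r := by norm_num
    have h2 : |r * (SignType.sign x * |x| ^ (r - 1)) * y| ≤ 2 * |y| ^ r := by
      have hs : |(SignType.sign x : ℝ)| ≤ 1 := by
        rcases lt_trichotomy x 0 with hx | hx | hx <;> simp [hx]
      have h3 : |x| ^ (r - 1) ≤ |y| ^ (r - 1) :=
        Real.rpow_le_rpow (abs_nonneg _) h.le (by linarith)
      have h4 : 0 ≤ |x| ^ (r - 1) := Real.rpow_nonneg (abs_nonneg _) _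
      rw [abs_mul, abs_mul, abs_mul, abs_of_nonneg h4, abs_of_nonneg (by linarith : 0 ≤ r)]
      calc r * (|(SignType.sign x : ℝ)| * |x| ^ (r - 1)) * |y| ≤ 2 * (1 * |y| ^ (r - 1)) * |y| := by
            gcongr
        _ = 2 * |y| ^ r := by rw [Real.rpow_sub_one hy0.ne']; field_simp
    have h5 := neg_le_of_abs_le h2
    have h6 := Real.rpow_nonneg (abs_nonneg x) r
    linarith

variable {Ω : Type*} {m0 : MeasurableSpace Ω} {μ : Measure Ω}

/-- One step of the von Bahr-Esseen inequality: the first order term of the expansion has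
mean zero. -/
theorem integral_abs_add_rpow_le [IsFiniteMeasure μ] {𝓜 : MeasurableSpace Ω} (h𝓜 : 𝓜 ≤ m0)
    {r : ℝ≥0} (hr : 1 ≤ r) (hr2 : r ≤ 2) {f g : Ω → ℝ} (hf : MemLp f r μ)
    (hf𝓜 : StronglyMeasurable[𝓜] f) (hg : MemLp g r μ) (hg0 : μ[g | 𝓜] =ᵐ[μ] 0) :
    ∫ x, |f x + g x| ^ (r : ℝ) ∂μ ≤ ∫ x, |f x| ^ (r : ℝ) ∂μ + 6 * ∫ x, |g x| ^ (r : ℝ) ∂μ := by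
  have hr' : (1 : ℝ) ≤ r := by exact_mod_cast hr
  have hr2' : (r : ℝ) ≤ 2 := by exact_mod_cast hr2
  have hr0 : (r : ℝ≥0∞) ≠ 0 := by
    have : r ≠ 0 := (zero_lt_one.trans_le hr).ne'
    exact_mod_cast this
  have hfi : Integrable (fun x => |f x| ^ (r : ℝ)) μ := by
    simpa using hf.integrable_norm_rpow hr0 ENNReal.coe_ne_top
  have hgi : Integrable (fun x => |g x| ^ (r : ℝ)) μ := by
    simpa using hg.integrable_norm_rpow hr0 ENNReal.coe_ne_top
  have hg1 : Integrable g μ := hg.integrable (by exact_mod_cast hr)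
  -- `r w` is the derivative of `|·|^r` at `f`; it is `𝓜`-measurable, hence orthogonal to `g`
  set w : Ω → ℝ := fun x => SignType.sign (f x) * |f x| ^ ((r : ℝ) - 1) with hw
  have hsign : Measurable fun t : ℝ => (SignType.sign t : ℝ) := by
    have : (fun t : ℝ => (SignType.sign t : ℝ)) =
        fun t => if 0 < t then 1 else if t < 0 then -1 else 0 := by
      ext t
      rcases lt_trichotomy t 0 with h | h | h
      · simp [h, h.not_gt]
      · simp [h]
      · simp [h]
    rw [this]
    exact Measurable.ite measurableSet_Ioi measurable_const
      (Measurable.ite measurableSet_Iio measurable_const measurable_const)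
  have hw𝓜 : StronglyMeasurable[𝓜] w := by
    have hpow : Measurable fun t : ℝ => (SignType.sign t : ℝ) * |t| ^ ((r : ℝ) - 1) :=
      hsign.mul ((measurable_norm (α := ℝ)).pow_const _)
    exact (hpow.comp hf𝓜.measurable).stronglyMeasurable
  have hwle : ∀ x, |w x| ≤ |f x| ^ ((r : ℝ) - 1) := by
    intro x
    rw [hw, abs_mul, abs_of_nonneg (Real.rpow_nonneg (abs_nonneg (f x)) _)]
    have hs : |(SignType.sign (f x) : ℝ)| ≤ 1 := by
      rcases lt_trichotomy (f x) 0 with hx | hx | hx <;> simp [hx]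
    exact mul_le_of_le_one_left (Real.rpow_nonneg (abs_nonneg (f x)) _) hs
  have hwg : Integrable (fun x => w x * g x) μ := by
    refine (hfi.add hgi).mono' ((hw𝓜.mono h𝓜).aestronglyMeasurable.mul hg.1)
      (Eventually.of_forall fun x => ?_)
    have hmx : 0 ≤ max |f x| |g x| := (abs_nonneg _).trans (le_max_left _ _)
    calc ‖w x * g x‖ = |w x| * |g x| := abs_mul _ _
      _ ≤ |f x| ^ ((r : ℝ) - 1) * |g x| := by gcongr; exact hwle x
      _ ≤ max |f x| |g x| ^ ((r : ℝ) - 1) * max |f x| |g x| := by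
          gcongr
          · exact le_max_left _ _
          · exact le_max_right _ _
      _ = max |f x| |g x| ^ (r : ℝ) := by
          nth_rewrite 2 [← Real.rpow_one (max |f x| |g x|)]
          rw [← Real.rpow_add_of_nonneg hmx (by linarith) zero_le_one]; congr 1; ring
      _ ≤ |f x| ^ (r : ℝ) + |g x| ^ (r : ℝ) := by
          have h1 := Real.rpow_nonneg (abs_nonneg (f x)) r
          have h2 := Real.rpow_nonneg (abs_nonneg (g x)) r
          rcases max_choice |f x| |g x| with h | h <;> rw [h] <;> linarith
  have hzero : ∫ x, w x * g x ∂μ = 0 := by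
    have h1 := condExp_mul_of_stronglyMeasurable_left (μ := μ) hw𝓜 hwg hg1
    rw [← integral_condExp h𝓜 (f := fun x => w x * g x)]
    have h2 : μ[fun x => w x * g x | 𝓜] =ᵐ[μ] fun _ => 0 := by
      refine EventuallyEq.trans h1 ?_
      filter_upwards [hg0] with x hx
      simp [hx]
    rw [integral_congr_ae h2, integral_zero]
  have hbound : Integrable (fun x => |f x| ^ (r : ℝ) + r * (w x * g x) + 6 * |g x| ^ (r : ℝ)) μ :=
    (hfi.add (hwg.const_mul _)).add (hgi.const_mul 6)
  calc ∫ x, |f x + g x| ^ (r : ℝ) ∂μ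
      ≤ ∫ x, (|f x| ^ (r : ℝ) + r * (w x * g x) + 6 * |g x| ^ (r : ℝ)) ∂μ := by
        refine integral_mono_of_nonneg (Eventually.of_forall fun x =>
          Real.rpow_nonneg (abs_nonneg _) _) hbound (Eventually.of_forall fun x => ?_)
        have := abs_add_rpow_le hr' hr2' (f x) (g x)
        simpa only [hw, mul_assoc] using this
    _ = _ := by
        rw [integral_add (f := fun x => |f x| ^ (r : ℝ) + r * (w x * g x))
          (hfi.add (hwg.const_mul _)) (hgi.const_mul 6), integral_add hfi (hwg.const_mul _),
          integral_const_mul, integral_const_mul, hzero]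
        ring

/-- The **von Bahr-Esseen inequality** for differences of a reverse martingale. -/
theorem integral_abs_sum_rpow_le [IsFiniteMeasure μ] {r : ℝ≥0} (hr : 1 ≤ r) (hr2 : r ≤ 2) {A : ℝ}
    (n : ℕ) : ∀ (𝓑 : ℕ → MeasurableSpace Ω) (M : ℕ → Ω → ℝ), (∀ i, 𝓑 i ≤ m0) → Antitone 𝓑 →
      (∀ i, StronglyMeasurable[𝓑 i] (M i)) → (∀ i, MemLp (M i) r μ) →
      (∀ i, μ[M i | 𝓑 (i + 1)] =ᵐ[μ] 0) → (∀ i, ∫ x, |M i x| ^ (r : ℝ) ∂μ ≤ A) →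
      ∫ x, |∑ i ∈ Finset.range n, M i x| ^ (r : ℝ) ∂μ ≤ 6 * (n * A) := by
  induction n with
  | zero =>
    intros
    have : (r : ℝ) ≠ 0 := by exact_mod_cast (zero_lt_one.trans_le hr).ne'
    simp [Real.zero_rpow this]
  | succ n ih =>
    intro 𝓑 M h𝓑 hanti hM hMr hM0 hMA
    -- the index is shifted, since `M 0` has mean zero given the later terms
    have h1 := ih (fun i => 𝓑 (i + 1)) (fun i => M (i + 1)) (fun i => h𝓑 _)
      (fun a b hab => hanti (by omega)) (fun i => hM _) (fun i => hMr _) (fun i => hM0 _)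
      (fun i => hMA _)
    have hmeas : StronglyMeasurable[𝓑 1] fun x => ∑ i ∈ Finset.range n, M (i + 1) x :=
      Finset.stronglyMeasurable_fun_sum _ fun i _ => (hM (i + 1)).mono (hanti (by omega))
    have h2 := integral_abs_add_rpow_le (h𝓑 1) hr hr2
      (f := fun x => ∑ i ∈ Finset.range n, M (i + 1) x) (g := M 0)
      (memLp_finsetSum _ fun i _ => hMr (i + 1)) hmeas (hMr 0) (hM0 0)
    simp only [Finset.sum_range_succ' _ n]
    refine h2.trans ?_
    have := hMA 0
    push_cast
    linarith

theorem rpow_eLpNorm_eq_ofReal {r : ℝ≥0} (hr : r ≠ 0) {f : Ω → ℝ} (hf : MemLp f r μ) :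
    eLpNorm f r μ ^ (r : ℝ) = ENNReal.ofReal (∫ x, |f x| ^ (r : ℝ) ∂μ) := by
  rw [eLpNorm_nnreal_pow_eq_lintegral hr, ofReal_integral_eq_lintegral_ofReal]
  · refine lintegral_congr fun x => ?_
    rw [Real.enorm_eq_ofReal_abs, ENNReal.ofReal_rpow_of_nonneg (abs_nonneg _) r.coe_nonneg]
  · simpa using hf.integrable_norm_rpow (by exact_mod_cast hr) ENNReal.coe_ne_top
  · exact Eventually.of_forall fun x => Real.rpow_nonneg (abs_nonneg _) _

/-- The von Bahr-Esseen inequality in terms of `Lʳ` norms. -/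
theorem eLpNorm_sum_le_of_condExp_eq_zero [IsFiniteMeasure μ] {r : ℝ≥0} (hr : 1 ≤ r) (hr2 : r ≤ 2)
    {𝓑 : ℕ → MeasurableSpace Ω} {M : ℕ → Ω → ℝ} (h𝓑 : ∀ i, 𝓑 i ≤ m0) (hanti : Antitone 𝓑)
    (hM : ∀ i, StronglyMeasurable[𝓑 i] (M i))
    (hM0 : ∀ i, μ[M i | 𝓑 (i + 1)] =ᵐ[μ] 0) {A : ℝ≥0} (hA : ∀ i, eLpNorm (M i) r μ ≤ A) (n : ℕ) :
    eLpNorm (fun x => ∑ i ∈ Finset.range n, M i x) r μ ≤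
      (6 * n : ℝ≥0∞) ^ (1 / (r : ℝ)) * A := by
  have hr0 : r ≠ 0 := (zero_lt_one.trans_le hr).ne'
  have hr0' : (0 : ℝ) < r := by exact_mod_cast pos_iff_ne_zero.2 hr0
  have hMr : ∀ i, MemLp (M i) r μ := fun i =>
    ⟨((hM i).mono (h𝓑 i)).aestronglyMeasurable, (hA i).trans_lt ENNReal.coe_lt_top⟩
  have hA' : ∀ i, ∫ x, |M i x| ^ (r : ℝ) ∂μ ≤ (A : ℝ) ^ (r : ℝ) := by
    intro i
    have := ENNReal.rpow_le_rpow (hA i) hr0'.le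
    rw [rpow_eLpNorm_eq_ofReal hr0 (hMr i), ← ENNReal.ofReal_coe_nnreal,
      ENNReal.ofReal_rpow_of_nonneg A.coe_nonneg hr0'.le] at this
    exact (ENNReal.ofReal_le_ofReal_iff (Real.rpow_nonneg A.coe_nonneg _)).1 this
  have h := integral_abs_sum_rpow_le hr hr2 n 𝓑 M h𝓑 hanti hM hMr hM0 hA'
  have h1 : eLpNorm (fun x => ∑ i ∈ Finset.range n, M i x) r μ ^ (r : ℝ) ≤
      (6 * n : ℝ≥0∞) * (A : ℝ≥0∞) ^ (r : ℝ) := by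
    rw [rpow_eLpNorm_eq_ofReal hr0 (memLp_finsetSum _ fun i _ => hMr i)]
    refine (ENNReal.ofReal_le_ofReal h).trans (le_of_eq ?_)
    rw [← mul_assoc, ENNReal.ofReal_mul (by positivity),
      ← ENNReal.ofReal_rpow_of_nonneg A.coe_nonneg hr0'.le, ENNReal.ofReal_coe_nnreal]
    congr 1
    rw [ENNReal.ofReal_mul (by norm_num)]; simp
  have h2 := ENNReal.rpow_le_rpow h1 (one_div_nonneg.2 hr0'.le)
  rw [← ENNReal.rpow_mul, mul_one_div_cancel hr0'.ne', ENNReal.rpow_one,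
    ENNReal.mul_rpow_of_nonneg _ _ (one_div_nonneg.2 hr0'.le), ← ENNReal.rpow_mul,
    mul_one_div_cancel hr0'.ne', ENNReal.rpow_one] at h2
  exact h2

end VonBahrEsseen

/-! ### Moments of Birkhoff sums by martingale approximation -/

section Moments

theorem sum_pow_dist_le (κ : ℝ≥0∞) (i n : ℕ) :
    ∑ j ∈ Finset.range n, κ ^ ((j - (i + 1)) + (i - j)) ≤ 2 * (1 - κ)⁻¹ := by
  calc ∑ j ∈ Finset.range n, κ ^ ((j - (i + 1)) + (i - j))
      ≤ ∑' j, κ ^ ((j - (i + 1)) + (i - j)) := ENNReal.sum_le_tsum _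
    _ = ∑ j ∈ Finset.range (i + 1), κ ^ ((j - (i + 1)) + (i - j)) +
          ∑' j, κ ^ ((j + (i + 1) - (i + 1)) + (i - (j + (i + 1)))) :=
        (ENNReal.summable.sum_add_tsum_nat_add' (k := i + 1)).symm
    _ ≤ (1 - κ)⁻¹ + (1 - κ)⁻¹ := by
        gcongr
        · rw [← Finset.sum_range_reflect, ← ENNReal.tsum_geometric]
          refine (Finset.sum_le_sum fun j hj => le_of_eq ?_).trans (ENNReal.sum_le_tsum
            (Finset.range (i + 1)))
          rw [Finset.mem_range] at hj
          congr 1; omega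
        · rw [← ENNReal.tsum_geometric]
          refine ENNReal.tsum_le_tsum fun j => le_of_eq ?_
          congr 1; omega
    _ = _ := (two_mul _).symm

variable {Ω : Type*} {m0 : MeasurableSpace Ω} {μ : Measure Ω}

/-- Interpolation between `L¹` and `L^q`. -/
theorem eLpNorm_le_rpow_mul_rpow {r q : ℝ≥0} (hr : 1 < r) (hrq : r < q) {f : Ω → ℝ}
    (hf : AEStronglyMeasurable f μ) :
    eLpNorm f r μ ≤ eLpNorm f 1 μ ^ (((q : ℝ) - r) / (q - 1) / r) *
      eLpNorm f q μ ^ ((q : ℝ) * ((r - 1) / (q - 1)) / r) := by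
  have hr1 : (1 : ℝ) < r := by exact_mod_cast hr
  have hrq' : (r : ℝ) < q := by exact_mod_cast hrq
  have hr0 : (0 : ℝ) < r := by linarith
  have hq1 : (0 : ℝ) < q - 1 := by linarith
  have ht : 0 ≤ ((q : ℝ) - r) / (q - 1) := div_nonneg (by linarith) hq1.le
  have hs : 0 ≤ ((r : ℝ) - 1) / (q - 1) := div_nonneg (by linarith) hq1.le
  have h1 : eLpNorm f r μ ^ (r : ℝ) ≤ eLpNorm f 1 μ ^ (((q : ℝ) - r) / (q - 1)) *
      eLpNorm f q μ ^ ((q : ℝ) * ((r - 1) / (q - 1))) := by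
    rw [eLpNorm_nnreal_pow_eq_lintegral (zero_lt_one.trans hr).ne', ENNReal.rpow_mul,
      eLpNorm_nnreal_pow_eq_lintegral (zero_lt_one.trans (hr.trans hrq)).ne',
      eLpNorm_one_eq_lintegral_enorm]
    refine le_trans (le_of_eq ?_) (ENNReal.lintegral_mul_norm_pow_le hf.enorm
      (hf.enorm.pow_const (q : ℝ)) ht hs (by field_simp; ring))
    refine lintegral_congr fun x => ?_
    rw [← ENNReal.rpow_mul, ← ENNReal.rpow_add_of_nonneg _ _ ht (by positivity)]
    congr 1
    field_simp
    ring
  have h2 := ENNReal.rpow_le_rpow h1 (one_div_nonneg.2 hr0.le)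
  rw [← ENNReal.rpow_mul, mul_one_div_cancel hr0.ne', ENNReal.rpow_one,
    ENNReal.mul_rpow_of_nonneg _ _ (one_div_nonneg.2 hr0.le), ← ENNReal.rpow_mul,
    ← ENNReal.rpow_mul, mul_one_div, mul_one_div] at h2
  exact h2

/-- If the observables `U ∘ F^j` are exponentially well approximated, in `L¹`, by their
conditional expectations on the decreasing family `𝓑`, then the Birkhoff sums of `U` satisfy the
moment bound of independent variables. The differences `𝔼(S_n | 𝓑 i) - 𝔼(S_n | 𝓑 (i + 1))` are
those of a reverse martingale, and are bounded in `Lʳ` by interpolation. -/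
theorem exists_eLpNorm_birkhoffSum_le [IsProbabilityMeasure μ] {F : Ω → Ω}
    (hF : MeasurePreserving F μ μ) {𝓑 : ℕ → MeasurableSpace Ω} (h𝓑 : ∀ i, 𝓑 i ≤ m0)
    (hanti : Antitone 𝓑) {r q : ℝ≥0} (hr : 1 < r) (hr2 : r ≤ 2) (hrq : r < q) {U : Ω → ℝ}
    (hU : MemLp U q μ) {C ρ : ℝ≥0} (hρ : ρ < 1)
    (hpast : ∀ i j, i ≤ j → eLpNorm (fun x => U (F^[j] x) - (μ[fun y => U (F^[j] y) | 𝓑 i]) x) 1 μ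
      ≤ C * (ρ : ℝ≥0∞) ^ (j - i))
    (hfut : ∀ i j, j ≤ i → eLpNorm (μ[fun y => U (F^[j] y) | 𝓑 i]) 1 μ
      ≤ C * (ρ : ℝ≥0∞) ^ (i - j)) :
    ∃ K : ℝ≥0, ∀ n : ℕ, eLpNorm (birkhoffSum F U n) r μ ≤ K * (n : ℝ≥0∞) ^ (1 / (r : ℝ)) := by
  have hr1 : (1 : ℝ) < r := by exact_mod_cast hr
  have hrq' : (r : ℝ) < q := by exact_mod_cast hrq
  have hr0 : (0 : ℝ) < r := by linarith
  have hq1 : (0 : ℝ) < q - 1 := by linarith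
  have hqone : (1 : ℝ≥0∞) ≤ q := by exact_mod_cast (hr.trans hrq).le
  have hrone : (1 : ℝ≥0∞) ≤ r := by exact_mod_cast hr.le
  set s : ℝ := ((q : ℝ) - r) / (q - 1) / r with hs
  have hs0 : 0 < s := div_pos (div_pos (by linarith) hq1) hr0
  set s' : ℝ := (q : ℝ) * ((r - 1) / (q - 1)) / r with hs'
  have hs'0 : 0 ≤ s' := div_nonneg (mul_nonneg q.coe_nonneg (div_nonneg (by linarith) hq1.le)) hr0.le
  set Q : ℝ≥0∞ := 2 * eLpNorm U q μ with hQ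
  have hQtop : Q ≠ ∞ := ENNReal.mul_ne_top (by norm_num) hU.2.ne
  set κ : ℝ≥0∞ := (ρ : ℝ≥0∞) ^ s with hκ
  have hκ1 : κ < 1 := by
    rw [hκ]
    exact ENNReal.rpow_lt_one (by exact_mod_cast hρ) hs0
  set L : ℝ≥0∞ := (2 * C : ℝ≥0∞) ^ s * Q ^ s' with hL
  have hLtop : L ≠ ∞ := ENNReal.mul_ne_top
    (ENNReal.rpow_ne_top_of_nonneg hs0.le (ENNReal.mul_ne_top (by norm_num) ENNReal.coe_ne_top))
    (ENNReal.rpow_ne_top_of_nonneg hs'0 hQtop)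
  set G : ℝ≥0∞ := L * (2 * (1 - κ)⁻¹) with hG
  have hGtop : G ≠ ∞ := ENNReal.mul_ne_top hLtop (ENNReal.mul_ne_top (by norm_num)
    (ENNReal.inv_ne_top.2 (tsub_pos_of_lt hκ1).ne'))
  -- the basic interpolated estimate
  have hinterp : ∀ (f : Ω → ℝ) (d : ℕ), AEStronglyMeasurable f μ → eLpNorm f q μ ≤ Q →
      eLpNorm f 1 μ ≤ 2 * C * (ρ : ℝ≥0∞) ^ d → eLpNorm f r μ ≤ L * κ ^ d := by
    intro f d hf hfq hf1
    refine (eLpNorm_le_rpow_mul_rpow hr hrq hf).trans ?_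
    calc eLpNorm f 1 μ ^ s * eLpNorm f q μ ^ s' ≤ (2 * C * (ρ : ℝ≥0∞) ^ d) ^ s * Q ^ s' := by
          gcongr
      _ = L * κ ^ d := by
          rw [ENNReal.mul_rpow_of_nonneg _ _ hs0.le, hL, hκ, ← ENNReal.rpow_natCast,
            ← ENNReal.rpow_natCast, ← ENNReal.rpow_mul, ← ENNReal.rpow_mul, mul_comm s]
          ring
  have hUj : ∀ j, MemLp (fun x => U (F^[j] x)) q μ := fun j =>
    hU.comp_measurePreserving (hF.iterate j)
  have hUjq : ∀ j, eLpNorm (fun x => U (F^[j] x)) q μ = eLpNorm U q μ := fun j =>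
    eLpNorm_comp_measurePreserving hU.1 (hF.iterate j)
  have hUji : ∀ j, Integrable (fun x => U (F^[j] x)) μ := fun j => (hUj j).integrable hqone
  have hcq : ∀ i j, eLpNorm (μ[fun y => U (F^[j] y) | 𝓑 i]) q μ ≤ eLpNorm U q μ := fun i j =>
    (eLpNorm_condExp_le_eLpNorm _ hqone).trans (hUjq j).le
  have hcm : ∀ i j, AEStronglyMeasurable (μ[fun y => U (F^[j] y) | 𝓑 i]) μ := fun i j =>
    integrable_condExp.aestronglyMeasurable
  have hpow : ∀ a b : ℕ, b ≤ a → (ρ : ℝ≥0∞) ^ a ≤ (ρ : ℝ≥0∞) ^ b := fun a b hab =>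
    pow_le_pow_right_of_le_one' (by exact_mod_cast hρ.le) hab
  -- an `L¹` estimate for each of the three kinds of terms; in `hD` both conditional expectations
  -- are close to `U ∘ F^j` if `i < j`, and both are small if `j ≤ i`
  have hD : ∀ i j, eLpNorm (fun x => (μ[fun y => U (F^[j] y) | 𝓑 i]) x -
      (μ[fun y => U (F^[j] y) | 𝓑 (i + 1)]) x) r μ ≤ L * κ ^ ((j - (i + 1)) + (i - j)) := by
    intro i j
    refine hinterp _ _ ((hcm i j).sub (hcm (i + 1) j)) ?_ ?_
    · refine (eLpNorm_sub_le (hcm i j) (hcm (i + 1) j) hqone).trans ?_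
      rw [hQ, two_mul]
      exact add_le_add (hcq _ _) (hcq _ _)
    · rcases Nat.lt_or_ge i j with h | h
      · have e : (fun x => (μ[fun y => U (F^[j] y) | 𝓑 i]) x -
            (μ[fun y => U (F^[j] y) | 𝓑 (i + 1)]) x) =
            (fun x => U (F^[j] x) - (μ[fun y => U (F^[j] y) | 𝓑 (i + 1)]) x) -
            (fun x => U (F^[j] x) - (μ[fun y => U (F^[j] y) | 𝓑 i]) x) := by
          ext x; simp
        rw [e]
        refine (eLpNorm_sub_le ((hUj j).1.sub (hcm _ j)) ((hUj j).1.sub (hcm _ j)) le_rfl).trans ?_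
        rw [mul_assoc, two_mul]
        refine add_le_add ((hpast (i + 1) j h).trans ?_) ((hpast i j h.le).trans ?_)
        · exact mul_le_mul_right (hpow _ _ (by omega)) _
        · exact mul_le_mul_right (hpow _ _ (by omega)) _
      · refine (eLpNorm_sub_le (hcm i j) (hcm (i + 1) j) le_rfl).trans ?_
        rw [mul_assoc, two_mul]
        refine add_le_add ((hfut i j h).trans ?_) ((hfut (i + 1) j (by omega)).trans ?_)
        · exact mul_le_mul_right (hpow _ _ (by omega)) _
        · exact mul_le_mul_right (hpow _ _ (by omega)) _
  have hP0 : ∀ j, eLpNorm (fun x => U (F^[j] x) - (μ[fun y => U (F^[j] y) | 𝓑 0]) x) r μ ≤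
      L * κ ^ ((j - (0 + 1)) + (0 - j)) := by
    intro j
    refine hinterp _ _ ((hUj j).1.sub (hcm 0 j)) ?_ ?_
    · refine (eLpNorm_sub_le (hUj j).1 (hcm 0 j) hqone).trans ?_
      rw [hQ, two_mul]
      exact add_le_add (hUjq _).le (hcq _ _)
    · refine (hpast 0 j (Nat.zero_le _)).trans ?_
      exact mul_le_mul' (le_mul_of_one_le_left zero_le (by norm_num)) (hpow _ _ (by omega))
  have hP2 : ∀ n j, j < n → eLpNorm (μ[fun y => U (F^[j] y) | 𝓑 n]) r μ ≤
      L * κ ^ ((j - (n + 1)) + (n - j)) := by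
    intro n j hj
    refine hinterp _ _ (hcm n j) ?_ ?_
    · exact (hcq n j).trans (le_mul_of_one_le_left zero_le (by norm_num))
    · refine (hfut n j hj.le).trans ?_
      exact mul_le_mul' (le_mul_of_one_le_left zero_le (by norm_num)) (hpow _ _ (by omega))
  have hSi : ∀ n, Integrable (birkhoffSum F U n) μ := fun n =>
    integrable_birkhoffSum hF (hU.integrable hqone) n
  have hcS : ∀ n i, μ[birkhoffSum F U n | 𝓑 i] =ᵐ[μ]
      fun x => ∑ j ∈ Finset.range n, (μ[fun y => U (F^[j] y) | 𝓑 i]) x := by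
    intro n i
    have h := condExp_finsetSum (μ := μ) (s := Finset.range n) (f := fun j y => U (F^[j] y))
      (fun j _ => hUji j) (𝓑 i)
    have e : (∑ j ∈ Finset.range n, fun y => U (F^[j] y)) = birkhoffSum F U n := by
      ext x; simp [birkhoffSum]
    rw [e] at h
    filter_upwards [h] with x hx
    rw [hx, Finset.sum_apply]
  have hsumG : ∀ i n, ∑ j ∈ Finset.range n, L * κ ^ ((j - (i + 1)) + (i - j)) ≤ G := by
    intro i n
    rw [← Finset.mul_sum]
    exact mul_le_mul_right (sum_pow_dist_le κ i n) L
  -- the reverse martingale differences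
  set M : ℕ → ℕ → Ω → ℝ := fun n i => μ[birkhoffSum F U n | 𝓑 i] - μ[birkhoffSum F U n | 𝓑 (i + 1)]
    with hMdef
  have hMG : ∀ n i, eLpNorm (M n i) r μ ≤ G.toNNReal := by
    intro n i
    rw [ENNReal.coe_toNNReal hGtop]
    have e : M n i =ᵐ[μ] fun x => ∑ j ∈ Finset.range n, ((μ[fun y => U (F^[j] y) | 𝓑 i]) x -
        (μ[fun y => U (F^[j] y) | 𝓑 (i + 1)]) x) := by
      filter_upwards [hcS n i, hcS n (i + 1)] with x h1 h2
      simp only [hMdef, Pi.sub_apply, h1, h2, Finset.sum_sub_distrib]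
    rw [eLpNorm_congr_ae e]
    refine le_trans ?_ (hsumG i n)
    refine le_trans (le_of_eq ?_) ((eLpNorm_sum_le (fun j _ => (hcm i j).sub (hcm (i + 1) j))
      hrone).trans (Finset.sum_le_sum fun j _ => hD i j))
    congr 1
    ext x
    simp
  have hMsm : ∀ n i, StronglyMeasurable[𝓑 i] (M n i) := fun n i =>
    stronglyMeasurable_condExp.sub (stronglyMeasurable_condExp.mono (hanti (Nat.le_succ i)))
  have hM0 : ∀ n i, μ[M n i | 𝓑 (i + 1)] =ᵐ[μ] 0 := by
    intro n i
    have h1 := condExp_sub (μ := μ) (f := μ[birkhoffSum F U n | 𝓑 i])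
      (g := μ[birkhoffSum F U n | 𝓑 (i + 1)]) integrable_condExp integrable_condExp (𝓑 (i + 1))
    have h2 := condExp_condExp_of_le (μ := μ) (f := birkhoffSum F U n) (hanti (Nat.le_succ i)) (h𝓑 i)
    have h3 := condExp_condExp_of_le (μ := μ) (f := birkhoffSum F U n) (le_refl (𝓑 (i + 1)))
      (h𝓑 (i + 1))
    filter_upwards [h1, h2, h3] with x e1 e2 e3
    simp only [hMdef, e1, Pi.sub_apply, e2, e3, sub_self, Pi.zero_apply]
  have hmain : ∀ n, eLpNorm (birkhoffSum F U n) r μ ≤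
      G + (6 * n : ℝ≥0∞) ^ (1 / (r : ℝ)) * G + G := by
    intro n
    -- the error at the start, the martingale part, and the error at the end
    have hdec : birkhoffSum F U n = (fun x => birkhoffSum F U n x - (μ[birkhoffSum F U n | 𝓑 0]) x) +
        (fun x => ∑ i ∈ Finset.range n, M n i x) + μ[birkhoffSum F U n | 𝓑 n] := by
      ext x
      simp only [hMdef, Pi.add_apply, Pi.sub_apply]
      rw [Finset.sum_range_sub' (fun i => (μ[birkhoffSum F U n | 𝓑 i]) x)]
      ring
    have m1 : AEStronglyMeasurable
        (fun x => birkhoffSum F U n x - (μ[birkhoffSum F U n | 𝓑 0]) x) μ :=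
      (hSi n).1.sub integrable_condExp.1
    have m2 : AEStronglyMeasurable (fun x => ∑ i ∈ Finset.range n, M n i x) μ :=
      Finset.aestronglyMeasurable_fun_sum _ fun i _ => ((hMsm n i).mono (h𝓑 i)).aestronglyMeasurable
    have b1 : eLpNorm (fun x => birkhoffSum F U n x - (μ[birkhoffSum F U n | 𝓑 0]) x) r μ ≤ G := by
      have e : (fun x => birkhoffSum F U n x - (μ[birkhoffSum F U n | 𝓑 0]) x) =ᵐ[μ]
          ∑ j ∈ Finset.range n, fun x => (U (F^[j] x) - (μ[fun y => U (F^[j] y) | 𝓑 0]) x) := by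
        filter_upwards [hcS n 0] with x h1
        simp only [h1, birkhoffSum, Finset.sum_apply, Finset.sum_sub_distrib]
      rw [eLpNorm_congr_ae e]
      exact (eLpNorm_sum_le (fun j _ => (hUj j).1.sub (hcm 0 j)) hrone).trans
        ((Finset.sum_le_sum fun j _ => hP0 j).trans (hsumG 0 n))
    have b2 := eLpNorm_sum_le_of_condExp_eq_zero hr.le hr2 h𝓑 hanti (hMsm n) (hM0 n) (hMG n) n
    rw [ENNReal.coe_toNNReal hGtop] at b2
    have b3 : eLpNorm (μ[birkhoffSum F U n | 𝓑 n]) r μ ≤ G := by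
      have e : μ[birkhoffSum F U n | 𝓑 n] =ᵐ[μ]
          ∑ j ∈ Finset.range n, μ[fun y => U (F^[j] y) | 𝓑 n] := by
        filter_upwards [hcS n n] with x h1
        rw [h1, Finset.sum_apply]
      rw [eLpNorm_congr_ae e]
      exact (eLpNorm_sum_le (fun j _ => hcm n j) hrone).trans
        ((Finset.sum_le_sum fun j hj => hP2 n j (Finset.mem_range.1 hj)).trans (hsumG n n))
    rw [hdec]
    refine (eLpNorm_add_le (m1.add m2) integrable_condExp.1 hrone).trans ?_
    exact add_le_add ((eLpNorm_add_le m1 m2 hrone).trans (add_le_add b1 b2)) b3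
  refine ⟨(G + (6 : ℝ≥0∞) ^ (1 / (r : ℝ)) * G + G).toNNReal, fun n => ?_⟩
  have h6 : (6 : ℝ≥0∞) ^ (1 / (r : ℝ)) ≠ ∞ :=
    ENNReal.rpow_ne_top_of_nonneg (by positivity) (by norm_num)
  rw [ENNReal.coe_toNNReal (ENNReal.add_ne_top.2 ⟨ENNReal.add_ne_top.2
    ⟨hGtop, ENNReal.mul_ne_top h6 hGtop⟩, hGtop⟩)]
  rcases Nat.eq_zero_or_pos n with rfl | hn
  · simp
  have hn1 : (1 : ℝ≥0∞) ≤ (n : ℝ≥0∞) ^ (1 / (r : ℝ)) :=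
    ENNReal.one_le_rpow (by exact_mod_cast hn) (by positivity)
  refine (hmain n).trans ?_
  rw [ENNReal.mul_rpow_of_nonneg _ _ (by positivity), add_mul, add_mul]
  have hGle : G ≤ G * (n : ℝ≥0∞) ^ (1 / (r : ℝ)) := le_mul_of_one_le_right zero_le hn1
  exact add_le_add (add_le_add hGle (le_of_eq (by ring))) hGle

end Moments

/-! ### Full branch Gibbs-Markov maps: separation and inverse branches -/

section Separation

variable {Z : Type*} {F : Z → Z} {𝒜 : Set (Set Z)}

theorem powSep_nonneg {θ : ℝ} (hθ : 0 ≤ θ) (s : ℕ∞) : 0 ≤ powSep θ s := by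
  unfold powSep; split_ifs
  · exact le_rfl
  · positivity

theorem powSep_le_pow {θ : ℝ} (hθ : 0 ≤ θ) (hθ1 : θ ≤ 1) {s : ℕ∞} {n : ℕ} (h : (n : ℕ∞) ≤ s) :
    powSep θ s ≤ θ ^ n := by
  unfold powSep; split_ifs with hs
  · positivity
  · lift s to ℕ using hs
    exact pow_le_pow_of_le_one hθ hθ1 (by exact_mod_cast h)

theorem powSep_le_one {θ : ℝ} (hθ : 0 ≤ θ) (hθ1 : θ ≤ 1) (s : ℕ∞) : powSep θ s ≤ 1 := by
  simpa using powSep_le_pow hθ hθ1 (n := 0) (s := s) (by simp)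

theorem powSep_mono {θ γ : ℝ} (hθ : 0 ≤ θ) (h : θ ≤ γ) (s : ℕ∞) : powSep θ s ≤ powSep γ s := by
  unfold powSep; split_ifs
  · exact le_rfl
  · gcongr

theorem powSep_le_mul {θ : ℝ} (hθ : 0 ≤ θ) (hθ1 : θ ≤ 1) {s t : ℕ∞} (h : t + 1 ≤ s) :
    powSep θ s ≤ θ * powSep θ t := by
  rcases eq_or_ne t ⊤ with ht | ht
  · subst ht
    have : s = ⊤ := by simpa using h
    simp [powSep, this]
  · lift t to ℕ using ht
    have e : powSep θ (t : ℕ∞) = θ ^ t := by simp [powSep]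
    rw [e, ← pow_succ']
    exact powSep_le_pow hθ hθ1 (by exact_mod_cast h)

theorem natCast_le_separationTime {z z' : Z} {n : ℕ}
    (h : ∀ k < n, ∃ a ∈ 𝒜, F^[k] z ∈ a ∧ F^[k] z' ∈ a) : (n : ℕ∞) ≤ separationTime F 𝒜 z z' := by
  refine le_iInf₂ fun k hk => ?_
  by_contra hcon
  exact hk (h k (by exact_mod_cast not_le.1 hcon))

theorem separationTime_apply_add_one_le {a : Set Z} (ha : a ∈ 𝒜) {z z' : Z} (hz : z ∈ a)
    (hz' : z' ∈ a) : separationTime F 𝒜 (F z) (F z') + 1 ≤ separationTime F 𝒜 z z' := by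
  refine le_iInf₂ fun n hn => ?_
  cases n with
  | zero => exact absurd ⟨a, ha, hz, hz'⟩ hn
  | succ k =>
    have : separationTime F 𝒜 (F z) (F z') ≤ k := iInf₂_le k hn
    push_cast
    gcongr

variable [MeasurableSpace Z] {μ : Measure Z}

namespace IsFullBranchGibbsMarkov

theorem exists_mem (h : IsFullBranchGibbsMarkov μ F 𝒜) (z : Z) : ∃ a ∈ 𝒜, z ∈ a := by
  obtain ⟨a, ⟨ha, hz⟩, -⟩ := h.isPartition.2 z
  exact ⟨a, ha, hz⟩

theorem eq_of_mem (h : IsFullBranchGibbsMarkov μ F 𝒜) {a b : Set Z} (ha : a ∈ 𝒜) (hb : b ∈ 𝒜)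
    {z : Z} (hza : z ∈ a) (hzb : z ∈ b) : a = b :=
  (h.isPartition.2 z).unique ⟨ha, hza⟩ ⟨hb, hzb⟩

/-- The partition element that contains a given point. -/
def code (h : IsFullBranchGibbsMarkov μ F 𝒜) (z : Z) : 𝒜 :=
  ⟨(h.exists_mem z).choose, (h.exists_mem z).choose_spec.1⟩

theorem mem_code (h : IsFullBranchGibbsMarkov μ F 𝒜) (z : Z) : z ∈ (h.code z : Set Z) :=
  (h.exists_mem z).choose_spec.2

theorem code_eq (h : IsFullBranchGibbsMarkov μ F 𝒜) {z : Z} {a : 𝒜} (hz : z ∈ (a : Set Z)) :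
    h.code z = a :=
  Subtype.ext (h.eq_of_mem (h.code z).2 a.2 (h.mem_code z) hz)

/-- A point of the partition element `a`. -/
def rep (h : IsFullBranchGibbsMarkov μ F 𝒜) (a : 𝒜) : Z :=
  (nonempty_iff_ne_empty.2 fun he => h.isPartition.1 (he ▸ a.2) : (a : Set Z).Nonempty).some

theorem rep_mem (h : IsFullBranchGibbsMarkov μ F 𝒜) (a : 𝒜) : h.rep a ∈ (a : Set Z) :=
  Nonempty.some_mem _

/-- A function of the first `n` symbols of the itinerary is measurable, as there are only countably
many values. -/
theorem measurable_comp_code (h : IsFullBranchGibbsMarkov μ F 𝒜) {β : Type*} [MeasurableSpace β]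
    {n : ℕ} (G : (Fin n → 𝒜) → β) : Measurable fun z => G fun i => h.code (F^[i] z) := by
  have : Countable 𝒜 := h.countable.to_subtype
  let _ : MeasurableSpace 𝒜 := ⊤
  have hcode : Measurable h.code := by
    refine measurable_to_countable' fun a => ?_
    have : h.code ⁻¹' {a} = (a : Set Z) := by
      ext z
      refine ⟨fun hz => ?_, fun hz => h.code_eq hz⟩
      have hz' : h.code z = a := hz
      rw [← hz']; exact h.mem_code z
    rw [this]; exact h.measurableSet a a.2
  exact (measurable_of_countable G).comp (measurable_pi_lambda _ fun i =>
    hcode.comp (h.ergodic.measurable.iterate i))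

/-- A function that is constant on the partition elements is measurable. -/
theorem measurable_of_const (h : IsFullBranchGibbsMarkov μ F 𝒜) {β : Type*} [MeasurableSpace β]
    {G : Z → β} (hG : ∀ a ∈ 𝒜, ∀ z ∈ a, ∀ z' ∈ a, G z = G z') : Measurable G := by
  have e : G = fun z => (fun t : Fin 1 → 𝒜 => G (h.rep (t 0))) fun i => h.code (F^[i] z) := by
    ext1 z
    exact hG _ (h.code z).2 z (h.mem_code z) _ (h.rep_mem _)
  rw [e]
  exact h.measurable_comp_code fun t : Fin 1 → 𝒜 => G (h.rep (t 0))

/-- A function whose oscillation on `n`-cylinders tends to zero pointwise is measurable. -/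
theorem measurable_of_abs_sub_le (h : IsFullBranchGibbsMarkov μ F 𝒜) {ψ Φ : Z → ℝ} {γ : ℝ}
    (hγ : γ ∈ Ioo (0 : ℝ) 1) (hΦ : ∀ z, 0 ≤ Φ z)
    (hψ : ∀ a ∈ 𝒜, ∀ z ∈ a, ∀ z' ∈ a,
      |ψ z - ψ z'| ≤ Φ z * powSep γ (separationTime F 𝒜 z z')) : Measurable ψ := by
  classical
  -- approximate `ψ` by its value at a chosen point of the `(n + 1)`-cylinder
  let c : (n : ℕ) → Z → Fin n → 𝒜 := fun n z i => h.code (F^[i] z)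
  let G : (n : ℕ) → (Fin n → 𝒜) → ℝ := fun n t =>
    if ht : ∃ z0, c n z0 = t then ψ ht.choose else 0
  let ψn : ℕ → Z → ℝ := fun n z => G (n + 1) (c (n + 1) z)
  refine measurable_of_tendsto_metrizable (f := ψn)
    (fun n => h.measurable_comp_code (G (n + 1))) ?_
  rw [tendsto_pi_nhds]
  intro z
  have hlim : Tendsto (fun n => Φ z * γ ^ (n + 1)) atTop (𝓝 0) := by
    simpa using ((tendsto_pow_atTop_nhds_zero_of_lt_one hγ.1.le hγ.2).comp
      (tendsto_add_atTop_nat 1)).const_mul (Φ z)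
  rw [tendsto_iff_dist_tendsto_zero]
  refine squeeze_zero (fun n => dist_nonneg) (fun n => ?_) hlim
  have hex : ∃ z0, c (n + 1) z0 = c (n + 1) z := ⟨z, rfl⟩
  have e1 : ψn n z = ψ hex.choose := dif_pos hex
  have hch : ∀ k < n + 1, h.code (F^[k] hex.choose) = h.code (F^[k] z) := fun k hk =>
    congrFun hex.choose_spec ⟨k, hk⟩
  have hsep : ((n + 1 : ℕ) : ℕ∞) ≤ separationTime F 𝒜 z hex.choose :=
    natCast_le_separationTime fun k hk =>
      ⟨h.code (F^[k] z), (h.code _).2, h.mem_code _, by rw [← hch k hk]; exact h.mem_code _⟩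
  have hmem : hex.choose ∈ (h.code z : Set Z) := by
    have := hch 0 (Nat.succ_pos n)
    simp only [Function.iterate_zero, id] at this
    rw [← this]; exact h.mem_code _
  rw [e1, dist_comm, Real.dist_eq]
  refine (hψ _ (h.code z).2 z (h.mem_code z) _ hmem).trans ?_
  exact mul_le_mul_of_nonneg_left (powSep_le_pow hγ.1.le hγ.2.le hsep) (hΦ z)

/-- The cylinders are countably many measurable sets that separate the points. -/
theorem exists_countable_separating (h : IsFullBranchGibbsMarkov μ F 𝒜) :
    ∃ S : Set (Set Z), S.Countable ∧ (∀ s ∈ S, MeasurableSet s) ∧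
      ∀ z z', (∀ s ∈ S, z ∈ s ↔ z' ∈ s) → z = z' := by
  have : Countable 𝒜 := h.countable.to_subtype
  refine ⟨range fun p : ℕ × 𝒜 => F^[p.1] ⁻¹' p.2, countable_range _, ?_, fun z z' hzz' => ?_⟩
  · rintro _ ⟨p, rfl⟩
    exact h.ergodic.measurable.iterate _ (h.measurableSet p.2 p.2.2)
  · rw [← h.separates, ENat.eq_top_iff_forall_ge]
    intro n
    refine natCast_le_separationTime fun k _ => ⟨h.code (F^[k] z), (h.code _).2, h.mem_code _, ?_⟩
    exact (hzz' _ ⟨(k, h.code (F^[k] z)), rfl⟩).1 (h.mem_code _)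

/-- The inverse of the branch of `F` on the partition element `a`. -/
def branch (h : IsFullBranchGibbsMarkov μ F 𝒜) (a : 𝒜) (z : Z) : Z :=
  ((h.bijOn a a.2).surjOn (mem_univ z)).choose

theorem branch_mem (h : IsFullBranchGibbsMarkov μ F 𝒜) (a : 𝒜) (z : Z) :
    h.branch a z ∈ (a : Set Z) := ((h.bijOn a a.2).surjOn (mem_univ z)).choose_spec.1

theorem apply_branch (h : IsFullBranchGibbsMarkov μ F 𝒜) (a : 𝒜) (z : Z) :
    F (h.branch a z) = z := ((h.bijOn a a.2).surjOn (mem_univ z)).choose_spec.2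

theorem branch_apply (h : IsFullBranchGibbsMarkov μ F 𝒜) (a : 𝒜) {z : Z} (hz : z ∈ (a : Set Z)) :
    h.branch a (F z) = z :=
  (h.bijOn a a.2).injOn (h.branch_mem a _) hz (h.apply_branch a _)

theorem measurable_branch (h : IsFullBranchGibbsMarkov μ F 𝒜) (a : 𝒜) :
    Measurable (h.branch a) := by
  intro s hs
  have : h.branch a ⁻¹' s = (fun z : ↥a.1 => F z) '' (Subtype.val ⁻¹' s) := by
    ext z
    constructor
    · exact fun hz => ⟨⟨h.branch a z, h.branch_mem a z⟩, hz, h.apply_branch a z⟩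
    · rintro ⟨y, hy, rfl⟩
      simpa [h.branch_apply a y.2] using hy
  rw [this]
  exact (h.bimeasurable a a.2).measurableSet_image' (measurable_subtype_coe hs)

/-- Change of variables along an inverse branch. -/
theorem setLIntegral_eq (h : IsFullBranchGibbsMarkov μ F 𝒜) (a : 𝒜) {g : Z → ℝ}
    (hg : Measurable g) (hga : μ.comap (Subtype.val : ↥a.1 → Z) =
      (Measure.comap (fun z : ↥a.1 => F z) μ).withDensity
        (fun z => ENNReal.ofReal (g z))) {u : Z → ℝ≥0∞} (hu : Measurable u) :
    ∫⁻ z in (a : Set Z), u z ∂μ =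
      ∫⁻ z, ENNReal.ofReal (g (h.branch a z)) * u (h.branch a z) ∂μ := by
  have he := h.bimeasurable a a.2
  have hrange : range (fun z : ↥a.1 => F z) = univ :=
    eq_univ_of_forall fun z => ⟨⟨h.branch a z, h.branch_mem a z⟩, h.apply_branch a z⟩
  have hmap : (Measure.comap (fun z : ↥a.1 => F z) μ).map (fun z : ↥a.1 => F z) = μ := by
    rw [he.map_comap, hrange, Measure.restrict_univ]
  have m1 : Measurable fun z : ↥a.1 => ENNReal.ofReal (g z) :=
    (hg.comp measurable_subtype_coe).ennreal_ofReal
  have m2 : Measurable fun z : ↥a.1 => u z := hu.comp measurable_subtype_coe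
  rw [← lintegral_subtype_comap (h.measurableSet a a.2), hga,
    lintegral_withDensity_eq_lintegral_mul _ m1 m2]
  have hpush : ∀ k : Z → ℝ≥0∞, ∫⁻ z, k z ∂μ =
      ∫⁻ z : ↥a.1, k (F z) ∂(Measure.comap (fun z : ↥a.1 => F z) μ) := fun k => by
    conv_lhs => rw [← hmap]
    exact he.lintegral_map _
  rw [hpush]
  refine lintegral_congr fun z => ?_
  simp only [Pi.mul_apply, h.branch_apply a z.2]

theorem lintegral_eq_tsum_setLIntegral (h : IsFullBranchGibbsMarkov μ F 𝒜) (u : Z → ℝ≥0∞) :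
    ∫⁻ z, u z ∂μ = ∑' a : 𝒜, ∫⁻ z in (a : Set Z), u z ∂μ := by
  have : Countable 𝒜 := h.countable.to_subtype
  have hU : (⋃ a : 𝒜, (a : Set Z)) = univ :=
    eq_univ_of_forall fun z => mem_iUnion.2 ⟨h.code z, h.mem_code z⟩
  rw [← lintegral_iUnion (fun a : 𝒜 => h.measurableSet a a.2), hU, Measure.restrict_univ]
  intro a b hab
  exact Set.disjoint_left.2 fun z hza hzb => hab (Subtype.ext (h.eq_of_mem a.2 b.2 hza hzb))

end IsFullBranchGibbsMarkov

end Separation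

/-! ### Decay of correlations for full branch Gibbs-Markov maps -/

section Decay

variable {Z : Type*} [MeasurableSpace Z] {μ : Measure Z} {F : Z → Z} {𝒜 : Set (Set Z)}

/-- The cone of functions `u ≥ 0` such that `log u` is, on each partition element, Lipschitz with
constant `K` for the symbolic metric `γ ^ s(z, z')`. -/
def InCone (F : Z → Z) (𝒜 : Set (Set Z)) (γ K : ℝ) (u : Z → ℝ≥0∞) : Prop :=
  ∀ a ∈ 𝒜, ∀ z ∈ a, ∀ z' ∈ a,
    u z ≤ ENNReal.ofReal (Real.exp (K * powSep γ (separationTime F 𝒜 z z'))) * u z'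

/-- The elementary inequality by which a constant can be subtracted from a log-Lipschitz function
at the price of a larger Lipschitz constant. -/
theorem sub_le_exp_mul_sub {K K' m p x y : ℝ} (hK' : K' ≤ K - 1) (hK : 1 ≤ K)
    (hm : 0 ≤ m) (hp : 0 ≤ p) (hp1 : p ≤ 1) (hy : m ≤ y) (hxy : x ≤ Real.exp (K' * p) * y) :
    x - Real.exp (-K) / K * m ≤ Real.exp (K * p) * (y - Real.exp (-K) / K * m) := by
  have hK0 : 0 < K := by linarith
  -- `exp (K p) - 1 ≤ K p exp K`, while `exp (K p) - exp (K' p) ≥ p`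
  have h1 : Real.exp (K * p) - 1 ≤ K * p * Real.exp K := by
    have h2 : Real.exp (-(K * p)) ≥ 1 - K * p := by
      have := Real.add_one_le_exp (-(K * p)); linarith
    have h3 : Real.exp (K * p) * Real.exp (-(K * p)) = 1 := by
      rw [← Real.exp_add]; simp
    have h4 : Real.exp (K * p) ≤ Real.exp K := Real.exp_le_exp.2 (by nlinarith)
    have h5 := Real.exp_pos (K * p)
    nlinarith [mul_nonneg hK0.le hp]
  have h6 : p ≤ Real.exp (K * p) - Real.exp (K' * p) := by
    have h7 : Real.exp (K' * p) ≤ Real.exp ((K - 1) * p) :=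
      Real.exp_le_exp.2 (mul_le_mul_of_nonneg_right hK' hp)
    have h8 : Real.exp (K * p) = Real.exp ((K - 1) * p) * Real.exp p := by
      rw [← Real.exp_add]; congr 1; ring
    have h9 : 1 ≤ Real.exp ((K - 1) * p) :=
      Real.one_le_exp (mul_nonneg (by linarith) hp)
    have h10 := Real.add_one_le_exp p
    nlinarith
  have h11 : Real.exp (-K) / K * (Real.exp (K * p) - 1) ≤ p := by
    have h12 : Real.exp (-K) * Real.exp K = 1 := by rw [← Real.exp_add]; simp
    calc Real.exp (-K) / K * (Real.exp (K * p) - 1) ≤ Real.exp (-K) / K * (K * p * Real.exp K) := by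
          gcongr
      _ = (Real.exp (-K) * Real.exp K) * p := by field_simp
      _ = p := by rw [h12, one_mul]
  have h13 : m * (Real.exp (-K) / K * (Real.exp (K * p) - 1)) ≤
      y * (Real.exp (K * p) - Real.exp (K' * p)) :=
    (mul_le_mul_of_nonneg_left (h11.trans h6) hm).trans
      (mul_le_mul_of_nonneg_right hy (hp.trans h6))
  linarith

/-- One step of the transfer operator maps a function of the cone to the sum of a constant and of
a function of the cone whose integral is smaller by a fixed factor. -/
theorem IsFullBranchGibbsMarkov.exists_cone_step [IsProbabilityMeasure μ]
    (h : IsFullBranchGibbsMarkov μ F 𝒜) {γ₀ : ℝ} (hγ₀ : γ₀ < 1) :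
    ∃ γ K : ℝ, ∃ κ : ℝ≥0∞, γ₀ ≤ γ ∧ γ ∈ Ioo (0 : ℝ) 1 ∧ 1 ≤ K ∧ κ < 1 ∧
      ∀ u : Z → ℝ≥0∞, Measurable u → InCone F 𝒜 γ K u → ∫⁻ z, u z ∂μ ≠ ∞ →
        ∃ (u' : Z → ℝ≥0∞) (c : ℝ≥0∞), Measurable u' ∧ InCone F 𝒜 γ K u' ∧
          ∫⁻ z, u' z ∂μ = κ * ∫⁻ z, u z ∂μ ∧ ∀ w : Z → ℝ≥0∞, Measurable w →
            ∫⁻ z, u z * w (F z) ∂μ = ∫⁻ z, u' z * w z ∂μ + c * ∫⁻ z, w z ∂μ := by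
  have : Countable 𝒜 := h.countable.to_subtype
  obtain ⟨g, hg, hg0, hga, C, θ, hC, hθ, hlog⟩ := h.distortion
  set γ := max γ₀ θ with hγdef
  have hγ : γ ∈ Ioo (0 : ℝ) 1 := ⟨hθ.1.trans_le (le_max_right _ _), max_lt hγ₀ hθ.2⟩
  have hγ1 : 0 < 1 - γ := by linarith [hγ.2]
  -- the transfer operator turns the constant `K` into `(C + K) γ`, and `K (1 - γ) = C + 1` leaves
  -- room for subtracting a constant
  set K := (C + 1) / (1 - γ) with hK
  have hK1 : 1 ≤ K := by
    rw [hK, le_div_iff₀ hγ1]; linarith [hγ.1]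
  have hK' : (C + K) * γ ≤ K - 1 := by
    have : K * (1 - γ) = C + 1 := by rw [hK]; field_simp
    nlinarith [hγ.2]
  have hK0 : 0 < K := by linarith
  set ε := Real.exp (-K) / K with hε
  have hε0 : 0 < ε := div_pos (Real.exp_pos _) hK0
  have hε1 : ε ≤ 1 := by
    rw [hε, div_le_one hK0]
    exact (Real.exp_le_one_iff.2 (by linarith)).trans hK1
  set δ := ε * Real.exp (-K) with hδ
  have hδ0 : 0 < δ := mul_pos hε0 (Real.exp_pos _)
  refine ⟨γ, K, 1 - ENNReal.ofReal δ, le_max_left _ _, hγ, hK1,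
    ENNReal.sub_lt_self ENNReal.one_ne_top one_ne_zero (ENNReal.ofReal_pos.2 hδ0).ne', ?_⟩
  intro u hu hcone hfin
  set p : Z → Z → ℝ := fun z z' => powSep γ (separationTime F 𝒜 z z') with hp
  have hp0 : ∀ z z', 0 ≤ p z z' := fun z z' => powSep_nonneg hγ.1.le _
  have hp1 : ∀ z z', p z z' ≤ 1 := fun z z' => powSep_le_one hγ.1.le hγ.2.le _
  set W : 𝒜 → Z → ℝ≥0∞ := fun a z => ENNReal.ofReal (g (h.branch a z)) * u (h.branch a z) with hW
  have hWm : ∀ a, Measurable (W a) := fun a =>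
    (hg.comp (h.measurable_branch a)).ennreal_ofReal.mul (hu.comp (h.measurable_branch a))
  -- the image of `u` under the transfer operator
  set v : Z → ℝ≥0∞ := fun z => ∑' a, W a z with hv
  have hvm : Measurable v := Measurable.tsum hWm
  -- the transfer identity
  have htransfer : ∀ w : Z → ℝ≥0∞, Measurable w →
      ∫⁻ z, u z * w (F z) ∂μ = ∫⁻ z, v z * w z ∂μ := by
    intro w hw
    rw [h.lintegral_eq_tsum_setLIntegral]
    have e : ∀ z, v z * w z = ∑' a, W a z * w z := fun z => ENNReal.tsum_mul_right.symm
    have hWw : ∀ a, AEMeasurable (fun z => W a z * w z) μ := fun a =>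
      ((hWm a).mul hw).aemeasurable
    simp only [e]
    rw [lintegral_tsum hWw]
    refine tsum_congr fun a => ?_
    have huw : Measurable fun z => u z * w (F z) := hu.mul (hw.comp h.ergodic.measurable)
    rw [h.setLIntegral_eq a hg (hga a a.2) huw]
    refine lintegral_congr fun z => ?_
    rw [h.apply_branch, ← mul_assoc]
  have hmass : ∫⁻ z, v z ∂μ = ∫⁻ z, u z ∂μ := by
    have := htransfer (fun _ => 1) measurable_const
    simpa using this.symm
  -- distortion of the transferred function
  have hvcone : ∀ z z', v z ≤ ENNReal.ofReal (Real.exp ((C + K) * γ * p z z')) * v z' := by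
    intro z z'
    rw [hv, ← ENNReal.tsum_mul_left]
    refine ENNReal.tsum_le_tsum fun a => ?_
    have hb := h.branch_mem a z
    have hb' := h.branch_mem a z'
    have hsep : powSep γ (separationTime F 𝒜 (h.branch a z) (h.branch a z')) ≤ γ * p z z' := by
      refine powSep_le_mul hγ.1.le hγ.2.le ?_
      have := separationTime_apply_add_one_le (F := F) a.2 hb hb'
      rwa [h.apply_branch, h.apply_branch] at this
    have hgle : ENNReal.ofReal (g (h.branch a z)) ≤
        ENNReal.ofReal (Real.exp (C * (γ * p z z'))) * ENNReal.ofReal (g (h.branch a z')) := by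
      rw [← ENNReal.ofReal_mul (Real.exp_pos _).le]
      refine ENNReal.ofReal_le_ofReal ?_
      have h1 := le_of_abs_le (hlog a a.2 _ hb _ hb')
      have h2 : Real.log (g (h.branch a z)) ≤ C * (γ * p z z') + Real.log (g (h.branch a z')) := by
        have h3 : C * powSep θ (separationTime F 𝒜 (h.branch a z) (h.branch a z')) ≤
            C * (γ * p z z') :=
          mul_le_mul_of_nonneg_left ((powSep_mono hθ.1.le (le_max_right _ _) _).trans hsep) hC.le
        linarith
      have h4 := Real.exp_le_exp.2 h2
      rwa [Real.exp_add, Real.exp_log (hg0 _), Real.exp_log (hg0 _)] at h4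
    have hule : u (h.branch a z) ≤
        ENNReal.ofReal (Real.exp (K * (γ * p z z'))) * u (h.branch a z') := by
      refine (hcone a a.2 _ hb _ hb').trans ?_
      gcongr
    calc W a z ≤ (ENNReal.ofReal (Real.exp (C * (γ * p z z'))) *
          ENNReal.ofReal (g (h.branch a z'))) *
          (ENNReal.ofReal (Real.exp (K * (γ * p z z'))) * u (h.branch a z')) :=
          mul_le_mul' hgle hule
      _ = (ENNReal.ofReal (Real.exp (C * (γ * p z z'))) *
          ENNReal.ofReal (Real.exp (K * (γ * p z z')))) * W a z' := by simp only [hW]; ring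
      _ = _ := by
          rw [← ENNReal.ofReal_mul (Real.exp_pos _).le, ← Real.exp_add]
          congr 3; ring
  have hvK : ∀ z z', v z ≤ ENNReal.ofReal (Real.exp K) * v z' := by
    intro z z'
    refine (hvcone z z').trans ?_
    have : (C + K) * γ * p z z' ≤ K := by
      calc (C + K) * γ * p z z' ≤ (C + K) * γ * 1 :=
            mul_le_mul_of_nonneg_left (hp1 _ _) (mul_nonneg (by linarith) hγ.1.le)
        _ ≤ K := by linarith
    gcongr
  set J := ∫⁻ z, u z ∂μ with hJ
  have hvJ : ∀ z, v z ≤ ENNReal.ofReal (Real.exp K) * J := by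
    intro z
    rw [← hmass, ← lintegral_const_mul _ hvm]
    calc v z = ∫⁻ _, v z ∂μ := by simp
      _ ≤ _ := lintegral_mono fun z' => hvK z z'
  -- `v` is at least `exp (-K)` times its mean `J`, so that `δ J = ε exp (-K) J` may be subtracted
  have hJv : ∀ z', J ≤ ENNReal.ofReal (Real.exp K) * v z' := by
    intro z'
    rw [← hmass]
    calc ∫⁻ z, v z ∂μ ≤ ∫⁻ _, ENNReal.ofReal (Real.exp K) * v z' ∂μ :=
          lintegral_mono fun z => hvK z z'
      _ = _ := by simp
  have hvtop : ∀ z, v z ≠ ∞ := fun z =>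
    ((hvJ z).trans_lt (ENNReal.mul_lt_top ENNReal.ofReal_lt_top hfin.lt_top)).ne
  have hm : ∀ z, Real.exp (-K) * J.toReal ≤ (v z).toReal := by
    intro z
    have := ENNReal.toReal_mono (ENNReal.mul_ne_top ENNReal.ofReal_ne_top (hvtop z)) (hJv z)
    rw [ENNReal.toReal_mul, ENNReal.toReal_ofReal (Real.exp_pos _).le] at this
    calc Real.exp (-K) * J.toReal ≤ Real.exp (-K) * (Real.exp K * (v z).toReal) := by gcongr
      _ = (v z).toReal := by rw [← mul_assoc, ← Real.exp_add]; simp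
  set c := ENNReal.ofReal δ * J with hc
  have hctop : c ≠ ∞ := ENNReal.mul_ne_top ENNReal.ofReal_ne_top hfin
  have hcreal : c.toReal = ε * (Real.exp (-K) * J.toReal) := by
    rw [hc, ENNReal.toReal_mul, ENNReal.toReal_ofReal hδ0.le, hδ, mul_assoc]
  have hm0 : 0 ≤ Real.exp (-K) * J.toReal := by positivity
  have hcv : ∀ z, c ≤ v z := by
    intro z
    rw [← ENNReal.toReal_le_toReal hctop (hvtop z), hcreal]
    exact (mul_le_of_le_one_left hm0 hε1).trans (hm z)
  have hsplit : ∀ z, (v z - c) + c = v z := fun z => tsub_add_cancel_of_le (hcv z)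
  have hid : ∀ w : Z → ℝ≥0∞, Measurable w →
      ∫⁻ z, u z * w (F z) ∂μ = ∫⁻ z, (v z - c) * w z ∂μ + c * ∫⁻ z, w z ∂μ := by
    intro w hw
    have hvw : Measurable fun z => (v z - c) * w z := (hvm.sub_const c).mul hw
    rw [htransfer w hw, ← lintegral_const_mul _ hw, ← lintegral_add_left hvw]
    refine lintegral_congr fun z => ?_
    rw [← add_mul, hsplit]
  refine ⟨fun z => v z - c, c, hvm.sub_const c, ?_, ?_, hid⟩
  · intro a _ z _ z' _
    rw [← ENNReal.toReal_le_toReal (ENNReal.sub_ne_top (hvtop z))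
      (ENNReal.mul_ne_top ENNReal.ofReal_ne_top (ENNReal.sub_ne_top (hvtop z'))),
      ENNReal.toReal_mul, ENNReal.toReal_ofReal (Real.exp_pos _).le,
      ENNReal.toReal_sub_of_le (hcv z) (hvtop z), ENNReal.toReal_sub_of_le (hcv z') (hvtop z'),
      hcreal]
    refine sub_le_exp_mul_sub hK' hK1 hm0 (hp0 z z') (hp1 z z') (hm z') ?_
    have := ENNReal.toReal_mono (ENNReal.mul_ne_top ENNReal.ofReal_ne_top (hvtop z')) (hvcone z z')
    rwa [ENNReal.toReal_mul, ENNReal.toReal_ofReal (Real.exp_pos _).le] at this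
  · have h1 := hid (fun _ => 1) measurable_const
    simp only [mul_one, lintegral_const, measure_univ] at h1
    rw [ENNReal.sub_mul fun _ _ => hfin, one_mul]
    exact ENNReal.eq_sub_of_add_eq hctop h1.symm

/-- Exponential decay of correlations for functions in the cone. -/
theorem IsFullBranchGibbsMarkov.exists_cone_decay [IsProbabilityMeasure μ]
    (h : IsFullBranchGibbsMarkov μ F 𝒜) {γ₀ : ℝ} (hγ₀ : γ₀ < 1) :
    ∃ γ K : ℝ, ∃ κ : ℝ≥0∞, γ₀ ≤ γ ∧ γ ∈ Ioo (0 : ℝ) 1 ∧ 1 ≤ K ∧ κ < 1 ∧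
      ∀ (k : ℕ) (u : Z → ℝ≥0∞), Measurable u → InCone F 𝒜 γ K u → ∫⁻ z, u z ∂μ ≠ ∞ →
        ∀ w : Z → ℝ≥0∞, Measurable w → (∀ z, w z ≤ 1) →
          ∫⁻ z, u z * w (F^[k] z) ∂μ ≤
              κ ^ k * ∫⁻ z, u z ∂μ + (∫⁻ z, u z ∂μ) * ∫⁻ z, w z ∂μ ∧
          (∫⁻ z, u z ∂μ) * ∫⁻ z, w z ∂μ ≤
              κ ^ k * ∫⁻ z, u z ∂μ + ∫⁻ z, u z * w (F^[k] z) ∂μ := by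
  obtain ⟨γ, K, κ, hγ, hγ', hK, hκ, hstep⟩ := h.exists_cone_step hγ₀
  have hiter : ∀ (k : ℕ) (u : Z → ℝ≥0∞), Measurable u → InCone F 𝒜 γ K u → ∫⁻ z, u z ∂μ ≠ ∞ →
      ∃ (u' : Z → ℝ≥0∞) (c : ℝ≥0∞), ∫⁻ z, u' z ∂μ = κ ^ k * ∫⁻ z, u z ∂μ ∧
        ∀ w : Z → ℝ≥0∞, Measurable w →
          ∫⁻ z, u z * w (F^[k] z) ∂μ = ∫⁻ z, u' z * w z ∂μ + c * ∫⁻ z, w z ∂μ := by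
    intro k
    induction k with
    | zero => exact fun u _ _ _ => ⟨u, 0, by simp, by simp⟩
    | succ k ih =>
      intro u hu hcone hfin
      obtain ⟨u₁, c₁, hu₁, hcone₁, hint₁, hw₁⟩ := hstep u hu hcone hfin
      have hfin₁ : ∫⁻ z, u₁ z ∂μ ≠ ∞ := by
        rw [hint₁]; exact ENNReal.mul_ne_top hκ.ne_top hfin
      obtain ⟨u₂, c₂, hint₂, hw₂⟩ := ih u₁ hu₁ hcone₁ hfin₁
      refine ⟨u₂, c₂ + c₁, by rw [hint₂, hint₁, pow_succ, mul_assoc], fun w hw => ?_⟩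
      have hFk := h.ergodic.toMeasurePreserving.iterate k
      have h1 := hw₁ (fun z => w (F^[k] z)) (hw.comp hFk.measurable)
      simp only [Function.iterate_succ_apply]
      rw [h1, hw₂ w hw, hFk.lintegral_comp hw, add_mul, add_assoc]
  refine ⟨γ, K, κ, hγ, hγ', hK, hκ, fun k u hu hcone hfin w hw hw1 => ?_⟩
  obtain ⟨u', c, hint, hid⟩ := hiter k u hu hcone hfin
  have hmass := hid (fun _ => 1) measurable_const
  simp only [mul_one, lintegral_const, measure_univ, hint] at hmass
  have hu'w : ∫⁻ z, u' z * w z ∂μ ≤ κ ^ k * ∫⁻ z, u z ∂μ := by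
    rw [← hint]
    exact lintegral_mono fun z => mul_le_of_le_one_right zero_le (hw1 z)
  have hwint : ∫⁻ z, w z ∂μ ≤ 1 := by
    calc ∫⁻ z, w z ∂μ ≤ ∫⁻ _, 1 ∂μ := lintegral_mono hw1
      _ = 1 := by simp
  rw [hid w hw]
  constructor
  · refine add_le_add hu'w (mul_le_mul_left ?_ _)
    rw [hmass]; exact le_add_self
  · calc (∫⁻ z, u z ∂μ) * ∫⁻ z, w z ∂μ
        = κ ^ k * (∫⁻ z, u z ∂μ) * ∫⁻ z, w z ∂μ + c * ∫⁻ z, w z ∂μ := by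
          conv_lhs => rw [hmass]
          rw [add_mul]
      _ ≤ κ ^ k * (∫⁻ z, u z ∂μ) + c * ∫⁻ z, w z ∂μ :=
          add_le_add (mul_le_of_le_one_right zero_le hwint) le_rfl
      _ ≤ _ := add_le_add le_rfl le_add_self

/-- The two inequalities for lower integrals that `exists_cone_decay` provides, as one inequality for
Bochner integrals. -/
theorem abs_integral_mul_sub_le [IsProbabilityMeasure μ] {k : ℕ} {κ : ℝ≥0∞} (hκ : κ < 1)
    (hF : MeasurePreserving F μ μ) {u w : Z → ℝ} (hu : Integrable u μ)
    (hu0 : ∀ z, 0 ≤ u z) (hw : Measurable w) (hw0 : ∀ z, 0 ≤ w z) (hw1 : ∀ z, w z ≤ 1)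
    (hle : ∫⁻ z, ENNReal.ofReal (u z) * ENNReal.ofReal (w (F^[k] z)) ∂μ ≤
        κ ^ k * ∫⁻ z, ENNReal.ofReal (u z) ∂μ +
          (∫⁻ z, ENNReal.ofReal (u z) ∂μ) * ∫⁻ z, ENNReal.ofReal (w z) ∂μ)
    (hge : (∫⁻ z, ENNReal.ofReal (u z) ∂μ) * ∫⁻ z, ENNReal.ofReal (w z) ∂μ ≤
        κ ^ k * ∫⁻ z, ENNReal.ofReal (u z) ∂μ +
          ∫⁻ z, ENNReal.ofReal (u z) * ENNReal.ofReal (w (F^[k] z)) ∂μ) :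
    |∫ z, u z * w (F^[k] z) ∂μ - (∫ z, u z ∂μ) * ∫ z, w z ∂μ| ≤ κ.toReal ^ k * ∫ z, u z ∂μ := by
  have hFk := hF.iterate k
  have hwi : Integrable w μ := Integrable.of_bound hw.aestronglyMeasurable 1
    (Eventually.of_forall fun z => by rw [Real.norm_eq_abs, abs_of_nonneg (hw0 z)]; exact hw1 z)
  have huw : Integrable (fun z => u z * w (F^[k] z)) μ :=
    hu.mul_bdd (c := 1) (hw.comp hFk.measurable).aestronglyMeasurable
      (Eventually.of_forall fun z => by
        rw [Real.norm_eq_abs, abs_of_nonneg (hw0 _)]; exact hw1 _)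
  have e1 : ∫⁻ z, ENNReal.ofReal (u z) ∂μ = ENNReal.ofReal (∫ z, u z ∂μ) :=
    (ofReal_integral_eq_lintegral_ofReal hu (Eventually.of_forall hu0)).symm
  have e2 : ∫⁻ z, ENNReal.ofReal (w z) ∂μ = ENNReal.ofReal (∫ z, w z ∂μ) :=
    (ofReal_integral_eq_lintegral_ofReal hwi (Eventually.of_forall hw0)).symm
  have e3 : ∫⁻ z, ENNReal.ofReal (u z) * ENNReal.ofReal (w (F^[k] z)) ∂μ =
      ENNReal.ofReal (∫ z, u z * w (F^[k] z) ∂μ) := by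
    rw [ofReal_integral_eq_lintegral_ofReal huw
      (Eventually.of_forall fun z => mul_nonneg (hu0 _) (hw0 _))]
    exact lintegral_congr fun z => (ENNReal.ofReal_mul (hu0 z)).symm
  have i1 : 0 ≤ ∫ z, u z ∂μ := integral_nonneg hu0
  have i2 : 0 ≤ ∫ z, w z ∂μ := integral_nonneg hw0
  have i3 : 0 ≤ ∫ z, u z * w (F^[k] z) ∂μ := integral_nonneg fun z => mul_nonneg (hu0 _) (hw0 _)
  have e4 : κ ^ k = ENNReal.ofReal (κ.toReal ^ k) := by
    rw [ENNReal.ofReal_pow ENNReal.toReal_nonneg, ENNReal.ofReal_toReal hκ.ne_top]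
  have i4 : 0 ≤ κ.toReal ^ k := by positivity
  rw [e1, e2, e3, e4, ← ENNReal.ofReal_mul i4, ← ENNReal.ofReal_mul i1,
    ← ENNReal.ofReal_add (by positivity) (by positivity),
    ENNReal.ofReal_le_ofReal_iff (by positivity)] at hle
  rw [e1, e2, e3, e4, ← ENNReal.ofReal_mul i4, ← ENNReal.ofReal_mul i1,
    ← ENNReal.ofReal_add (by positivity) (by positivity),
    ENNReal.ofReal_le_ofReal_iff (by positivity)] at hge
  rw [abs_le]
  constructor <;> linarith

/-- Exponential decay of correlations, against bounded functions, for an integrable observable `ψ`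
of mean zero that is locally Lipschitz in the symbolic metric with constant `Φ`. Such a `ψ` is the
difference of two functions in the cone. -/
theorem IsFullBranchGibbsMarkov.exists_decay [IsProbabilityMeasure μ]
    (h : IsFullBranchGibbsMarkov μ F 𝒜) {γ₀ : ℝ} (hγ₀ : γ₀ ∈ Ioo (0 : ℝ) 1) {ψ Φ : Z → ℝ}
    (hΦ0 : ∀ z, 0 ≤ Φ z) (hΦc : ∀ a ∈ 𝒜, ∀ z ∈ a, ∀ z' ∈ a, Φ z = Φ z')
    (hψ : ∀ a ∈ 𝒜, ∀ z ∈ a, ∀ z' ∈ a,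
      |ψ z - ψ z'| ≤ Φ z * powSep γ₀ (separationTime F 𝒜 z z'))
    (hψi : Integrable ψ μ) (hΦi : Integrable Φ μ) (hψ0 : ∫ z, ψ z ∂μ = 0) :
    ∃ C ρ : ℝ≥0, ρ < 1 ∧ ∀ (k : ℕ) (w : Z → ℝ), Measurable w → (∀ z, |w z| ≤ 1) →
      |∫ z, ψ z * w (F^[k] z) ∂μ| ≤ C * ρ ^ k := by
  obtain ⟨γ, K, κ, hγ, hγ', hK, hκ, hdecay⟩ := h.exists_cone_decay hγ₀.2
  have hψm : Measurable ψ := h.measurable_of_abs_sub_le hγ₀ hΦ0 hψ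
  set p : Z → Z → ℝ := fun z z' => powSep γ₀ (separationTime F 𝒜 z z') with hp
  have hp0 : ∀ z z', 0 ≤ p z z' := fun z z' => powSep_nonneg hγ₀.1.le _
  have hp1 : ∀ z z', p z z' ≤ 1 := fun z z' => powSep_le_one hγ₀.1.le hγ₀.2.le _
  -- a bound of `|ψ|` that is constant on the partition elements
  set b : Z → ℝ := fun z => |ψ (h.rep (h.code z))| + Φ z with hb
  have hcode : ∀ a ∈ 𝒜, ∀ z ∈ a, ∀ z' ∈ a, h.code z = h.code z' := fun a ha z hz z' hz' => by
    rw [h.code_eq (a := ⟨a, ha⟩) hz, h.code_eq (a := ⟨a, ha⟩) hz']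
  have hbc : ∀ a ∈ 𝒜, ∀ z ∈ a, ∀ z' ∈ a, b z = b z' := fun a ha z hz z' hz' => by
    simp only [hb, hcode a ha z hz z' hz', hΦc a ha z hz z' hz']
  have hbm : Measurable b := h.measurable_of_const hbc
  have hrep : ∀ z, |ψ z - ψ (h.rep (h.code z))| ≤ Φ z := fun z => by
    refine (hψ _ (h.code z).2 z (h.mem_code z) _ (h.rep_mem _)).trans ?_
    exact mul_le_of_le_one_right (hΦ0 z) (hp1 _ _)
  have hb0 : ∀ z, 0 ≤ b z := fun z => add_nonneg (abs_nonneg _) (hΦ0 z)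
  have hψb : ∀ z, |ψ z| ≤ b z := fun z => by
    have h1 := abs_sub_abs_le_abs_sub (ψ z) (ψ (h.rep (h.code z)))
    have h2 := hrep z
    simp only [hb]; linarith
  have hbi : Integrable b μ := by
    refine (hψi.abs.add (hΦi.const_mul 2)).mono' hbm.aestronglyMeasurable
      (Eventually.of_forall fun z => ?_)
    rw [Real.norm_eq_abs, abs_of_nonneg (hb0 z)]
    have h1 := abs_sub_abs_le_abs_sub (ψ (h.rep (h.code z))) (ψ z)
    rw [abs_sub_comm] at h1
    have h2 := hrep z
    simp only [hb, Pi.add_apply]; linarith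
  -- `ψ = u₁ - u₂`; the multiple `2 b` makes `u₁ ≥ b ≥ Φ`, and so the oscillation of `u₁` is at most
  -- `u₁ γ₀ ^ s`
  set u₁ : Z → ℝ := fun z => ψ z + 2 * b z with hu₁
  set u₂ : Z → ℝ := fun z => 2 * b z with hu₂
  have hu₁b : ∀ z, b z ≤ u₁ z := fun z => by
    have := neg_le_of_abs_le (hψb z)
    simp only [hu₁]; linarith
  have hu₁0 : ∀ z, 0 ≤ u₁ z := fun z => (hb0 z).trans (hu₁b z)
  have hu₂0 : ∀ z, 0 ≤ u₂ z := fun z => mul_nonneg zero_le_two (hb0 z)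
  have hu₁i : Integrable u₁ μ := hψi.add (hbi.const_mul 2)
  have hu₂i : Integrable u₂ μ := hbi.const_mul 2
  have hu₁m : Measurable u₁ := hψm.add (hbm.const_mul 2)
  have hu₂m : Measurable u₂ := hbm.const_mul 2
  have hexp : ∀ z z', 1 + p z z' ≤ Real.exp (K * powSep γ (separationTime F 𝒜 z z')) := by
    intro z z'
    have h1 := Real.add_one_le_exp (p z z')
    have h2 : p z z' ≤ K * powSep γ (separationTime F 𝒜 z z') :=
      (powSep_mono hγ₀.1.le hγ _).trans (le_mul_of_one_le_left (powSep_nonneg hγ'.1.le _) hK)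
    linarith [Real.exp_le_exp.2 h2]
  have hcone₁ : InCone F 𝒜 γ K fun z => ENNReal.ofReal (u₁ z) := by
    intro a ha z hz z' hz'
    rw [← ENNReal.ofReal_mul (Real.exp_pos _).le]
    refine ENNReal.ofReal_le_ofReal ?_
    have h1 := le_of_abs_le (hψ a ha z hz z' hz')
    have h2 := hbc a ha z hz z' hz'
    have h3 : Φ z ≤ u₁ z' := by
      have : Φ z ≤ b z := le_add_of_nonneg_left (abs_nonneg _)
      linarith [hu₁b z']
    calc u₁ z ≤ u₁ z' + Φ z * p z z' := by simp only [hu₁, h2]; linarith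
      _ ≤ u₁ z' + u₁ z' * p z z' := by gcongr; exact hp0 _ _
      _ = (1 + p z z') * u₁ z' := by ring
      _ ≤ _ := mul_le_mul_of_nonneg_right (hexp z z') (hu₁0 z')
  have hcone₂ : InCone F 𝒜 γ K fun z => ENNReal.ofReal (u₂ z) := by
    intro a ha z hz z' hz'
    rw [← ENNReal.ofReal_mul (Real.exp_pos _).le]
    refine ENNReal.ofReal_le_ofReal ?_
    have h2 : u₂ z = u₂ z' := by simp only [hu₂, hbc a ha z hz z' hz']
    rw [h2]
    exact le_mul_of_one_le_left (hu₂0 z') ((le_add_of_nonneg_right (hp0 z z')).trans (hexp z z'))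
  have hF := h.ergodic.toMeasurePreserving
  have hpos : ∀ (k : ℕ) (w : Z → ℝ), Measurable w → (∀ z, 0 ≤ w z) → (∀ z, w z ≤ 1) →
      |∫ z, ψ z * w (F^[k] z) ∂μ| ≤ κ.toReal ^ k * (∫ z, u₁ z ∂μ + ∫ z, u₂ z ∂μ) := by
    intro k w hw hw0 hw1
    have hw1' : ∀ z, ENNReal.ofReal (w z) ≤ 1 := fun z => by
      simpa using ENNReal.ofReal_le_ofReal (hw1 z)
    have d₁ := hdecay k _ hu₁m.ennreal_ofReal hcone₁ hu₁i.lintegral_lt_top.ne _ hw.ennreal_ofReal hw1'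
    have d₂ := hdecay k _ hu₂m.ennreal_ofReal hcone₂ hu₂i.lintegral_lt_top.ne _ hw.ennreal_ofReal hw1'
    have r₁ := abs_integral_mul_sub_le hκ hF hu₁i hu₁0 hw hw0 hw1 d₁.1 d₁.2
    have r₂ := abs_integral_mul_sub_le hκ hF hu₂i hu₂0 hw hw0 hw1 d₂.1 d₂.2
    have hbd : ∀ᵐ z ∂μ, ‖w (F^[k] z)‖ ≤ 1 := Eventually.of_forall fun z => by
      rw [Real.norm_eq_abs, abs_of_nonneg (hw0 _)]; exact hw1 _
    have hwk : AEStronglyMeasurable (fun z => w (F^[k] z)) μ :=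
      (hw.comp (hF.iterate k).measurable).aestronglyMeasurable
    have e1 : ∫ z, u₁ z ∂μ = ∫ z, u₂ z ∂μ := by
      simp only [hu₁]
      rw [integral_add hψi (hbi.const_mul 2), hψ0, zero_add]
    have e2 : ∫ z, ψ z * w (F^[k] z) ∂μ =
        ∫ z, u₁ z * w (F^[k] z) ∂μ - ∫ z, u₂ z * w (F^[k] z) ∂μ := by
      rw [← integral_sub (hu₁i.mul_bdd hwk hbd) (hu₂i.mul_bdd hwk hbd)]
      refine integral_congr_ae (Eventually.of_forall fun z => ?_)
      simp only [hu₁, hu₂]; ring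
    rw [e2, e1]
    rw [e1] at r₁
    rw [abs_le] at r₁ r₂ ⊢
    constructor <;> linarith
  refine ⟨(2 * (∫ z, u₁ z ∂μ + ∫ z, u₂ z ∂μ)).toNNReal, κ.toNNReal, ?_, fun k w hw hw1 => ?_⟩
  · rw [← ENNReal.coe_lt_coe, ENNReal.coe_toNNReal hκ.ne_top]; exact_mod_cast hκ
  · have hnn : 0 ≤ ∫ z, u₁ z ∂μ + ∫ z, u₂ z ∂μ :=
      add_nonneg (integral_nonneg hu₁0) (integral_nonneg hu₂0)
    rw [Real.coe_toNNReal _ (by linarith), ENNReal.coe_toNNReal_eq_toReal]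
    -- write `w` as an affine function of a function with values in `[0, 1]`
    have h1 := hpos k (fun z => (w z + 1) / 2) ((hw.add_const 1).div_const 2)
      (fun z => by linarith [neg_le_of_abs_le (hw1 z)]) (fun z => by linarith [le_of_abs_le (hw1 z)])
    have hwk : AEStronglyMeasurable (fun z => w (F^[k] z)) μ :=
      (hw.comp (hF.iterate k).measurable).aestronglyMeasurable
    have hbd : ∀ᵐ z ∂μ, ‖w (F^[k] z)‖ ≤ 1 := Eventually.of_forall fun z => hw1 _
    have e : ∫ z, ψ z * ((w (F^[k] z) + 1) / 2) ∂μ = (∫ z, ψ z * w (F^[k] z) ∂μ) / 2 := by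
      have : ∀ z, ψ z * ((w (F^[k] z) + 1) / 2) = (ψ z * w (F^[k] z)) / 2 + ψ z / 2 :=
        fun z => by ring
      simp only [this]
      rw [integral_add ((hψi.mul_bdd hwk hbd).div_const 2) (hψi.div_const 2), integral_div,
        integral_div, hψ0]
      simp
    rw [e, abs_div, abs_two] at h1
    linarith

end Decay

/-! ### Conditional expectation along a measurable map -/

section FiberCondExp

/-- The conditional expectation of `U` given `q` differs from `U` by at most the oscillation of `U`
on the fibres of `q`: the regular conditional measures are carried by the fibres, since countably
many measurable sets separate the values of `q`. -/
theorem ae_abs_sub_condExp_comap_le {Ω Z : Type*} [m0 : MeasurableSpace Ω] [StandardBorelSpace Ω]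
    [mZ : MeasurableSpace Z] {μ : Measure Ω} [IsProbabilityMeasure μ] {q : Ω → Z}
    (hq : Measurable q) {S : Set (Set Z)} (hS : S.Countable) (hSm : ∀ s ∈ S, MeasurableSet s)
    (hsep : ∀ z z', (∀ s ∈ S, z ∈ s ↔ z' ∈ s) → z = z') {U ε : Ω → ℝ} (hU : Integrable U μ)
    (hosc : ∀ y y', q y = q y' → |U y - U y'| ≤ ε y) :
    ∀ᵐ y ∂μ, |U y - (μ[U | mZ.comap q]) y| ≤ ε y := by
  have h𝓜 : mZ.comap q ≤ m0 := hq.comap_le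
  have hker : ∀ᵐ y ∂μ, ∀ s ∈ S,
      (condExpKernel μ (mZ.comap q) y).real (q ⁻¹' s) = (q ⁻¹' s).indicator 1 y := by
    rw [ae_ball_iff hS]
    intro s hs
    have hms : MeasurableSet[mZ.comap q] (q ⁻¹' s) := ⟨s, hSm s hs, rfl⟩
    have h1 := condExpKernel_ae_eq_condExp (μ := μ) h𝓜 (h𝓜 _ hms)
    have h2 : μ[(q ⁻¹' s).indicator (fun _ => (1 : ℝ)) | mZ.comap q] =
        (q ⁻¹' s).indicator fun _ => (1 : ℝ) :=
      condExp_of_stronglyMeasurable h𝓜 (stronglyMeasurable_const.indicator hms)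
        ((integrable_const 1).indicator (h𝓜 _ hms))
    rw [h2] at h1
    exact h1
  filter_upwards [hker, condExp_ae_eq_integral_condExpKernel h𝓜 hU, hU.condExpKernel_ae]
    with y hy hcond hint
  set κ := condExpKernel μ (mZ.comap q) y with hκ
  have hfib : ∀ᵐ y' ∂κ, q y = q y' := by
    have : ∀ᵐ y' ∂κ, ∀ s ∈ S, q y ∈ s ↔ q y' ∈ s := by
      rw [ae_ball_iff hS]
      intro s hs
      have hms : MeasurableSet (q ⁻¹' s) := hq (hSm s hs)
      by_cases hys : q y ∈ s
      · have h1 : κ.real (q ⁻¹' s) = 1 := by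
          rw [hy s hs, indicator_of_mem (show y ∈ q ⁻¹' s from hys)]; rfl
        have h2 : κ (q ⁻¹' s) = 1 := by
          rw [measureReal_def, ENNReal.toReal_eq_one_iff] at h1; exact h1
        have h3 : ∀ᵐ y' ∂κ, y' ∈ q ⁻¹' s := (prob_compl_eq_zero_iff hms).2 h2
        filter_upwards [h3] with y' hy'
        exact ⟨fun _ => hy', fun _ => hys⟩
      · have h1 : κ.real (q ⁻¹' s) = 0 := by
          rw [hy s hs, indicator_of_notMem (show y ∉ q ⁻¹' s from hys)]
        have h2 : κ (q ⁻¹' s) = 0 := (measureReal_eq_zero_iff).1 h1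
        filter_upwards [measure_eq_zero_iff_ae_notMem.1 h2] with y' hy'
        exact ⟨fun h => absurd h hys, fun h => absurd h hy'⟩
    filter_upwards [this] with y' hy'
    exact hsep _ _ hy'
  have e : U y - ∫ y', U y' ∂κ = ∫ y', (U y - U y') ∂κ := by
    rw [integral_sub (integrable_const _) hint]; simp
  rw [hcond, e]
  refine abs_integral_le_integral_abs.trans ?_
  calc ∫ y', |U y - U y'| ∂κ ≤ ∫ _, ε y ∂κ := by
        refine integral_mono_of_nonneg (Eventually.of_forall fun _ => abs_nonneg _)
          (integrable_const _) ?_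
        filter_upwards [hfib] with y' hy'
        exact hosc y y' hy'
    _ = ε y := by simp

end FiberCondExp

/-! ### Birkhoff sums on the base of a Young tower -/

namespace YoungTower

variable {𝒳 : Type*} [MetricSpace 𝒳] [MeasurableSpace 𝒳] {f : 𝒳 → 𝒳} {m : Measure 𝒳}

theorem measurable_proj (S : YoungTower f m) : Measurable S.proj := fun _ hs => hs

theorem proj_F (S : YoungTower f m) (y : S.Y) : S.proj (S.F y) = S.Fbar (S.proj y) := rfl

theorem proj_iterate (S : YoungTower f m) (n : ℕ) (y : S.Y) :
    S.proj (S.F^[n] y) = S.Fbar^[n] (S.proj y) := by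
  induction n with
  | zero => rfl
  | succ n ih => rw [Function.iterate_succ_apply', Function.iterate_succ_apply', proj_F, ih]

theorem leaf_iff (S : YoungTower f m) (y y' : S.Y) : S.leaf y y' ↔ S.proj y = S.proj y' :=
  Quotient.eq.symm

theorem leaf_iterate (S : YoungTower f m) {y y' : S.Y} (h : S.leaf y y') (n : ℕ) :
    S.leaf (S.F^[n] y) (S.F^[n] y') := by
  rw [leaf_iff] at h ⊢
  rw [proj_iterate, proj_iterate, h]

theorem isFullBranchGibbsMarkov (S : YoungTower f m) :
    IsFullBranchGibbsMarkov (S.μY.map S.proj) S.Fbar S.parts := S.gibbsMarkov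

/-- The Birkhoff sums of an observable of mean zero in `L^q` on the base of a Young tower satisfy a
moment bound of order `r < q`, provided that the observable is exponentially contracted along
stable leaves and that its conditional expectation on leaves is locally Lipschitz, with constants
controlled by an integrable function `Φ`. -/
theorem exists_eLpNorm_birkhoffSum_le [StandardBorelSpace 𝒳] (S : YoungTower f m)
    {r q : ℝ≥0} (hr : 1 < r) (hr2 : r ≤ 2) (hrq : r < q) {U Φ : S.Y → ℝ} (hU : MemLp U q S.μY)
    (hU0 : ∫ y, U y ∂S.μY = 0) (hΦ : Integrable Φ S.μY) (hΦ0 : ∀ y, 0 ≤ Φ y)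
    (hΦc : ∀ a ∈ S.parts, ∀ y y', S.proj y ∈ a → S.proj y' ∈ a → Φ y = Φ y')
    {γ : ℝ} (hγ : γ ∈ Ioo (0 : ℝ) 1)
    (hleaf : ∀ y y', S.leaf y y' → ∀ n : ℕ, |U (S.F^[n] y) - U (S.F^[n] y')| ≤
      Φ (S.F^[n] y) * γ ^ n)
    {ζ : S.Ybar → ℝ} (hζ : Integrable ζ (S.μY.map S.proj))
    (hζU : S.μY[U | S.leafAlgebra] =ᵐ[S.μY] ζ ∘ S.proj)
    (hζL : ∀ a ∈ S.parts, ∀ y y', S.proj y ∈ a → S.proj y' ∈ a →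
      |ζ (S.proj y) - ζ (S.proj y')| ≤
        Φ y * powSep γ (separationTime S.Fbar S.parts (S.proj y) (S.proj y'))) :
    ∃ K : ℝ≥0, ∀ n : ℕ, eLpNorm (birkhoffSum S.F U n) r S.μY ≤ K * (n : ℝ≥0∞) ^ (1 / (r : ℝ)) := by
  have := S.isProbabilityMeasure
  have := S.measurableSet_Y.standardBorel
  have hF := S.ergodic_base.toMeasurePreserving
  have hp := S.measurable_proj
  have hGM := S.isFullBranchGibbsMarkov
  have hFbar : Measurable S.Fbar := hGM.ergodic.measurable
  have : IsProbabilityMeasure (S.μY.map S.proj) := Measure.isProbabilityMeasure_map hp.aemeasurable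
  have hUi : Integrable U S.μY := hU.integrable (by exact_mod_cast (hr.trans hrq).le)
  obtain ⟨sep, hsepc, hsepm, hsep⟩ := hGM.exists_countable_separating
  -- `Φ` as a function on the space of leaves
  set Φ' : S.Ybar → ℝ := fun z => Φ (Quotient.out z) with hΦ'
  have hout : ∀ z : S.Ybar, S.proj (Quotient.out z) = z := fun z => Quotient.out_eq z
  have hΦ'c : ∀ a ∈ S.parts, ∀ z ∈ a, ∀ z' ∈ a, Φ' z = Φ' z' := fun a ha z hz z' hz' =>
    hΦc a ha _ _ (by rwa [hout]) (by rwa [hout])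
  have hΦproj : ∀ y, Φ' (S.proj y) = Φ y := fun y => by
    obtain ⟨a, ha, hya⟩ := hGM.exists_mem (S.proj y)
    exact hΦc a ha _ _ (by rwa [hout]) hya
  have hΦ'i : Integrable Φ' (S.μY.map S.proj) := by
    rw [integrable_map_measure (hGM.measurable_of_const hΦ'c).aestronglyMeasurable hp.aemeasurable]
    exact hΦ.congr (Eventually.of_forall fun y => (hΦproj y).symm)
  have hζ0 : ∫ z, ζ z ∂(S.μY.map S.proj) = 0 := by
    rw [integral_map hp.aemeasurable hζ.aestronglyMeasurable]
    have := integral_condExp (μ := S.μY) (f := U) hp.comap_le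
    rw [hU0, integral_congr_ae hζU] at this
    exact this
  obtain ⟨C, ρ, hρ, hdecay⟩ := hGM.exists_decay hγ (fun z => hΦ0 _) hΦ'c
    (fun a ha z hz z' hz' => by
      have := hζL a ha (Quotient.out z) (Quotient.out z') (by rwa [hout]) (by rwa [hout])
      rwa [hout, hout] at this) hζ hΦ'i hζ0
  -- the decreasing family of `σ`-algebras
  set 𝓑 : ℕ → MeasurableSpace S.Y := fun i =>
    MeasurableSpace.comap (fun y => S.proj (S.F^[i] y)) inferInstance with h𝓑
  have hq : ∀ i, Measurable fun y => S.proj (S.F^[i] y) := fun i =>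
    hp.comp (hF.iterate i).measurable
  have hanti : Antitone 𝓑 := by
    intro i j hij
    rintro _ ⟨s, hs, rfl⟩
    refine ⟨S.Fbar^[j - i] ⁻¹' s, hFbar.iterate _ hs, ?_⟩
    ext y
    simp only [mem_preimage]
    rw [← proj_iterate, ← Function.iterate_add_apply, Nat.sub_add_cancel hij]
  have hcomp : ∀ j, Integrable (fun y => U (S.F^[j] y)) S.μY := integrable_comp_iterate hF hUi
  have hnorm : ∀ g : S.Y → ℝ, Integrable g S.μY →
      eLpNorm g 1 S.μY = ENNReal.ofReal (∫ y, |g y| ∂S.μY) := fun g hg => by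
    rw [eLpNorm_one_eq_lintegral_enorm, ← ofReal_integral_norm_eq_lintegral_enorm hg]; rfl
  have hΦint : 0 ≤ ∫ y, Φ y ∂S.μY := integral_nonneg hΦ0
  have hγ' : γ.toNNReal < 1 := by rw [Real.toNNReal_lt_one]; exact hγ.2
  -- the bounds on conditional expectations, with common constants
  have hbound : ∀ (x : ℝ) (A c : ℝ≥0) (d : ℕ), x ≤ A * c ^ d →
      A ≤ max C (∫ y, Φ y ∂S.μY).toNNReal → c ≤ max ρ γ.toNNReal →
      ENNReal.ofReal x ≤ (max C (∫ y, Φ y ∂S.μY).toNNReal : ℝ≥0) *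
        ((max ρ γ.toNNReal : ℝ≥0) : ℝ≥0∞) ^ d := by
    intro x A c d hx hA hc
    calc ENNReal.ofReal x ≤ ENNReal.ofReal ((A * c ^ d : ℝ≥0) : ℝ) :=
          ENNReal.ofReal_le_ofReal (by exact_mod_cast hx)
      _ = (A : ℝ≥0∞) * (c : ℝ≥0∞) ^ d := by rw [ENNReal.ofReal_coe_nnreal]; push_cast; rfl
      _ ≤ _ := by gcongr
  refine CMZ.exists_eLpNorm_birkhoffSum_le hF (fun i => (hq i).comap_le) hanti hr hr2 hrq hU
    (C := max C (∫ y, Φ y ∂S.μY).toNNReal) (ρ := max ρ γ.toNNReal) (max_lt hρ hγ') ?_ ?_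
  · intro i j hij
    have hae := ae_abs_sub_condExp_comap_le (hq i) hsepc hsepm hsep (hcomp j)
      (ε := fun y => Φ (S.F^[j] y) * γ ^ (j - i)) (fun y y' hyy' => by
        have := hleaf _ _ ((S.leaf_iff _ _).2 hyy') (j - i)
        rwa [← Function.iterate_add_apply, ← Function.iterate_add_apply,
          Nat.sub_add_cancel hij] at this)
    have hint : Integrable (fun y => U (S.F^[j] y) - (S.μY[fun y => U (S.F^[j] y) | 𝓑 i]) y) S.μY :=
      (hcomp j).sub integrable_condExp
    refine (hnorm _ hint).trans_le ?_
    refine hbound _ (∫ y, Φ y ∂S.μY).toNNReal γ.toNNReal _ ?_ (le_max_right _ _) (le_max_right _ _)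
    rw [Real.coe_toNNReal _ hΦint, Real.coe_toNNReal _ hγ.1.le,
      ← integral_comp_measurePreserving (hF.iterate j) hΦ.aestronglyMeasurable, ← integral_mul_const]
    exact integral_mono_of_nonneg (Eventually.of_forall fun _ => abs_nonneg _)
      ((integrable_comp_iterate hF hΦ j).mul_const _) hae
  · intro i j hji
    rw [hnorm _ integrable_condExp]
    refine hbound _ C ρ _ ?_ (le_max_left _ _) (le_max_left _ _)
    -- the sign of the conditional expectation, as a function on the space of leaves
    obtain ⟨s, hs, hsE⟩ : MeasurableSet[𝓑 i]
        {y | 0 ≤ (S.μY[fun y => U (S.F^[j] y) | 𝓑 i]) y} :=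
      (stronglyMeasurable_condExp.measurable : Measurable[𝓑 i] _) measurableSet_Ici
    set w : S.Ybar → ℝ := s.indicator (fun _ => 2) - 1 with hw
    have hwm : Measurable w := (measurable_const.indicator hs).sub measurable_const
    have hws : ∀ z ∈ s, w z = 1 := fun z hz => by
      simp only [hw, Pi.sub_apply, indicator_of_mem hz, Pi.one_apply]; norm_num
    have hws' : ∀ z ∉ s, w z = -1 := fun z hz => by
      simp only [hw, Pi.sub_apply, indicator_of_notMem hz, Pi.one_apply]; norm_num
    have hw1 : ∀ z, |w z| ≤ 1 := fun z => by
      by_cases hz : z ∈ s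
      · rw [hws z hz]; simp
      · rw [hws' z hz]; simp
    have hwq : StronglyMeasurable[𝓑 i] fun y => w (S.proj (S.F^[i] y)) :=
      (hwm.comp (comap_measurable _)).stronglyMeasurable
    have hwq1 : ∀ᵐ y ∂S.μY, ‖w (S.proj (S.F^[i] y))‖ ≤ 1 := Eventually.of_forall fun y => hw1 _
    have habs : ∀ y, |(S.μY[fun y => U (S.F^[j] y) | 𝓑 i]) y| =
        w (S.proj (S.F^[i] y)) * (S.μY[fun y => U (S.F^[j] y) | 𝓑 i]) y := by
      intro y
      by_cases hy : 0 ≤ (S.μY[fun y => U (S.F^[j] y) | 𝓑 i]) y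
      · have hys : S.proj (S.F^[i] y) ∈ s := by
          have : y ∈ (fun y => S.proj (S.F^[i] y)) ⁻¹' s := by rw [hsE]; exact hy
          exact this
        rw [hws _ hys, abs_of_nonneg hy, one_mul]
      · have hys : S.proj (S.F^[i] y) ∉ s := fun h => hy (by
          have : y ∈ (fun y => S.proj (S.F^[i] y)) ⁻¹' s := h
          rw [hsE] at this; exact this)
        rw [hws' _ hys, abs_of_neg (not_le.1 hy), neg_one_mul]
    have hwk : ∀ k, Measurable fun z => w (S.Fbar^[k] z) := fun k => hwm.comp (hFbar.iterate k)
    have hpull : ∀ (k l : ℕ), StronglyMeasurable[𝓑 l] (fun y => w (S.proj (S.F^[k] y))) →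
        ∀ (V : S.Y → ℝ), Integrable V S.μY →
        ∫ y, w (S.proj (S.F^[k] y)) * (S.μY[V | 𝓑 l]) y ∂S.μY =
          ∫ y, w (S.proj (S.F^[k] y)) * V y ∂S.μY := by
      intro k l hkl V hV
      have h1 := condExp_mul_of_stronglyMeasurable_left (μ := S.μY) hkl
        (hV.bdd_mul (c := 1) (hkl.mono (hq l).comap_le).aestronglyMeasurable
          (Eventually.of_forall fun y => hw1 _)) hV
      rw [← integral_condExp (hq l).comap_le (f := fun y => w (S.proj (S.F^[k] y)) * V y)]
      exact (integral_congr_ae h1).symm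
    have hpull0 : ∀ k, StronglyMeasurable[𝓑 0] (fun y => w (S.proj (S.F^[k] y))) := by
      intro k
      have : (fun y => w (S.proj (S.F^[k] y))) =
          (fun z => w (S.Fbar^[k] z)) ∘ fun y => S.proj (S.F^[0] y) := by
        ext y; simp [proj_iterate]
      rw [this]
      exact ((hwk k).comp (comap_measurable _)).stronglyMeasurable
    calc ∫ y, |(S.μY[fun y => U (S.F^[j] y) | 𝓑 i]) y| ∂S.μY
        = ∫ y, w (S.proj (S.F^[i] y)) * U (S.F^[j] y) ∂S.μY := by
          simp only [habs]
          exact hpull i i hwq _ (hcomp j)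
      _ = ∫ y, w (S.proj (S.F^[i - j] y)) * U y ∂S.μY := by
          rw [← integral_comp_measurePreserving (hF.iterate j)
            (g := fun y => w (S.proj (S.F^[i - j] y)) * U y)
            ((hwm.comp (hq (i - j))).aestronglyMeasurable.mul hUi.aestronglyMeasurable)]
          simp only [← Function.iterate_add_apply, Nat.sub_add_cancel hji]
      _ = ∫ y, w (S.proj (S.F^[i - j] y)) * (S.μY[U | 𝓑 0]) y ∂S.μY :=
          (hpull (i - j) 0 (hpull0 _) U hUi).symm
      _ = ∫ y, ζ (S.proj y) * w (S.Fbar^[i - j] (S.proj y)) ∂S.μY := by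
          refine integral_congr_ae ?_
          filter_upwards [hζU] with y hy
          have : (S.μY[U | 𝓑 0]) y = ζ (S.proj y) := hy
          rw [this, mul_comm, proj_iterate]
      _ = ∫ z, ζ z * w (S.Fbar^[i - j] z) ∂(S.μY.map S.proj) :=
          (integral_map hp.aemeasurable (hζ.aestronglyMeasurable.mul
            (hwk _).aestronglyMeasurable)).symm
      _ ≤ C * ρ ^ (i - j) := (le_abs_self _).trans (hdecay _ w hwm hw1)

end YoungTower

/-! ### Integration along a Young tower -/

section BoundedDensity

variable {Ω : Type*} [MeasurableSpace Ω]

/-- A measure dominated by a multiple of another one has a bounded density. -/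
theorem exists_bounded_density {ν m : Measure Ω} [IsFiniteMeasure ν] [IsFiniteMeasure m] {c : ℝ≥0}
    (hc : ν ≤ c • m) : ∃ g : Ω → ℝ, Measurable g ∧ (∀ x, |g x| ≤ c) ∧
      ∀ h : Ω → ℂ, ∫ x, h x ∂ν = ∫ x, h x * g x ∂m := by
  have hle := Measure.rnDeriv_le_one_of_le hc
  have hmin : ∀ x, 0 ≤ min 1 (ν.rnDeriv (c • m) x).toReal := fun x =>
    le_min zero_le_one ENNReal.toReal_nonneg
  refine ⟨fun x => c * min 1 (ν.rnDeriv (c • m) x).toReal,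
    (measurable_const.min (Measure.measurable_rnDeriv _ _).ennreal_toReal).const_mul _,
    fun x => ?_, fun h => ?_⟩
  · rw [abs_mul, abs_of_nonneg (hmin x), NNReal.abs_eq]
    exact mul_le_of_le_one_right c.coe_nonneg (min_le_left _ _)
  · rw [← integral_rnDeriv_smul (Measure.absolutelyContinuous_of_le hc)]
    have e : ∫ x, (ν.rnDeriv (c • m) x).toReal • h x ∂(c • m) =
        ∫ x, h x * (min 1 (ν.rnDeriv (c • m) x).toReal : ℝ) ∂(c • m) := by
      refine integral_congr_ae ?_
      filter_upwards [hle] with x hx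
      rw [min_eq_right (ENNReal.toReal_le_of_le_ofReal zero_le_one (by simpa using hx)), mul_comm]
      rfl
    rw [e, integral_smul_nnreal_measure, NNReal.smul_def, Complex.real_smul,
      ← integral_const_mul]
    congr 1 with x
    push_cast
    ring

end BoundedDensity

namespace YoungTower

variable {𝒳 : Type*} [MetricSpace 𝒳] [MeasurableSpace 𝒳] {f : 𝒳 → 𝒳} {m : Measure 𝒳}

/-- The sum of an observable over the levels of the tower. -/
def lift {M : Type*} [AddCommMonoid M] (S : YoungTower f m) (W : 𝒳 → M) (y : S.Y) : M :=
  birkhoffSum f W (S.τ y) y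

/-- The mean of the return time `τ`. -/
def meanTau (S : YoungTower f m) : ℝ := ∫ y, (S.τ y : ℝ) ∂S.μY

theorem one_le_meanTau (S : YoungTower f m) : 1 ≤ S.meanTau := by
  have := S.isProbabilityMeasure
  calc (1 : ℝ) = ∫ _, (1 : ℝ) ∂S.μY := by simp
    _ ≤ _ := integral_mono (integrable_const _) S.integrable_τ
        fun y => Nat.one_le_cast.2 (S.one_le_τ y)

theorem measurableSet_tower (S : YoungTower f m) :
    MeasurableSet {p : S.Y × ℕ | p.2 < S.τ p.1} :=
  measurableSet_lt measurable_snd (S.measurable_τ.comp measurable_fst)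

theorem measurable_tower_proj (S : YoungTower f m) (hf : Measurable f) :
    Measurable fun p : S.Y × ℕ => f^[p.2] (p.1 : 𝒳) :=
  measurable_from_prod_countable_left fun n => (hf.iterate n).comp measurable_subtype_coe

theorem measurable_lift {M : Type*} [AddCommMonoid M] [MeasurableSpace M] [MeasurableAdd₂ M]
    (S : YoungTower f m) (hf : Measurable f) {W : 𝒳 → M} (hW : Measurable W) :
    Measurable (S.lift W) :=
  measurable_apply_natValued S.measurable_τ (F := fun n (y : S.Y) => birkhoffSum f W n (y : 𝒳))
    fun n => (measurable_birkhoffSum hf hW n).comp measurable_subtype_coe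

theorem ofReal_meanTau_ne_zero (S : YoungTower f m) : ENNReal.ofReal S.meanTau ≠ 0 :=
  (ENNReal.ofReal_pos.2 (zero_lt_one.trans_le S.one_le_meanTau)).ne'

/-- The measure `m` as the projection of the tower measure: integrals over `m` are normalised
integrals, over the base, of the sums along the levels. -/
theorem lintegral_eq (S : YoungTower f m) (hf : Measurable f) {h : 𝒳 → ℝ≥0∞}
    (hh : Measurable h) :
    ∫⁻ x, h x ∂m = (ENNReal.ofReal S.meanTau)⁻¹ * ∫⁻ y, S.lift h y ∂S.μY := by
  have := S.isProbabilityMeasure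
  have hπ := S.measurable_tower_proj hf
  have hcomap : ∫⁻ p : Tower S.τ, h (f^[p.1.2] (p.1.1 : 𝒳))
      ∂(S.μY.prod (Measure.count : Measure ℕ)).comap Subtype.val =
      ∫⁻ p in {p : S.Y × ℕ | p.2 < S.τ p.1}, h (f^[p.2] (p.1 : 𝒳)) ∂S.μY.prod Measure.count :=
    lintegral_subtype_comap S.measurableSet_tower fun p : S.Y × ℕ => h (f^[p.2] (p.1 : 𝒳))
  have hm : Measurable fun p : S.Y × ℕ => h (f^[p.2] (p.1 : 𝒳)) := hh.comp hπ
  conv_lhs => rw [S.map_proj]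
  rw [lintegral_map (g := fun p : Tower S.τ => f^[p.1.2] (p.1.1 : 𝒳)) hh
    (hπ.comp measurable_subtype_coe), towerMeasure, lintegral_smul_measure,
    smul_eq_mul, hcomap,
    ← lintegral_indicator S.measurableSet_tower,
    lintegral_prod _ (hm.indicator S.measurableSet_tower).aemeasurable]
  congr 1
  refine lintegral_congr fun y => ?_
  rw [lintegral_count, tsum_eq_sum (s := Finset.range (S.τ y))]
  · refine Finset.sum_congr rfl fun l hl => ?_
    exact indicator_of_mem (s := {p : S.Y × ℕ | p.2 < S.τ p.1}) (a := (y, l))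
      (Finset.mem_range.1 hl) _
  · intro l hl
    exact indicator_of_notMem (s := {p : S.Y × ℕ | p.2 < S.τ p.1}) (a := (y, l))
      (fun h => hl (Finset.mem_range.2 h)) _

theorem lintegral_lift (S : YoungTower f m) (hf : Measurable f) {h : 𝒳 → ℝ≥0∞}
    (hh : Measurable h) :
    ∫⁻ y, S.lift h y ∂S.μY = ENNReal.ofReal S.meanTau * ∫⁻ x, h x ∂m := by
  rw [S.lintegral_eq hf hh, ← mul_assoc, ENNReal.mul_inv_cancel S.ofReal_meanTau_ne_zero
    ENNReal.ofReal_ne_top, one_mul]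

/-- The base is the bottom level of the tower, hence `μ_Y` is at most `τ̄` times `m`. -/
theorem map_val_le (S : YoungTower f m) (hf : Measurable f) :
    S.μY.map (Subtype.val : S.Y → 𝒳) ≤ S.meanTau.toNNReal • m := by
  refine Measure.le_iff.2 fun s hs => ?_
  rw [Measure.map_apply measurable_subtype_coe hs, Measure.smul_apply]
  have h := S.lintegral_lift hf (h := s.indicator 1) (measurable_one.indicator hs)
  rw [lintegral_indicator_one hs] at h
  refine le_trans ?_ h.le
  rw [← lintegral_indicator_one (measurable_subtype_coe hs)]
  refine lintegral_mono fun y => ?_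
  have : S.lift (s.indicator (1 : 𝒳 → ℝ≥0∞)) y =
      ∑ l ∈ Finset.range (S.τ y), s.indicator 1 (f^[l] (y : 𝒳)) := rfl
  rw [this]
  exact Finset.single_le_sum (f := fun l => s.indicator (1 : 𝒳 → ℝ≥0∞) (f^[l] (y : 𝒳)))
    (fun _ _ => zero_le) (Finset.mem_range.2 (S.one_le_τ y))

/-- The projection of the tower semiconjugates the tower map to `f`. At the top level this is
`F y = f^{τ y} y`, which is only known almost everywhere. -/
theorem ae_semiconj (S : YoungTower f m) :
    ∀ᵐ p ∂towerMeasure S.μY S.τ, f (f^[p.1.2] (p.1.1 : 𝒳)) =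
      f^[(towerMap S.F S.τ S.one_le_τ p).1.2] ((towerMap S.F S.τ S.one_le_τ p).1.1 : 𝒳) := by
  have := S.isProbabilityMeasure
  have h1 : ∀ᵐ p ∂(S.μY.prod (Measure.count : Measure ℕ)),
      ((S.F p.1 : S.Y) : 𝒳) = f^[S.τ p.1] (p.1 : 𝒳) :=
    Measure.quasiMeasurePreserving_fst.ae S.F_eq
  have h2 := ae_restrict_of_ae (s := {p : S.Y × ℕ | p.2 < S.τ p.1}) h1
  rw [← map_comap_subtype_coe S.measurableSet_tower,
    (MeasurableEmbedding.subtype_coe S.measurableSet_tower).ae_map_iff] at h2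
  refine Measure.ae_smul_measure ?_ _
  filter_upwards [h2] with p hp
  rw [← Function.iterate_succ_apply' f]
  by_cases h : p.1.2 + 1 < S.τ p.1.1
  · simp [towerMap, h]
  · have : p.1.2 + 1 = S.τ p.1.1 := le_antisymm p.2 (not_lt.1 h)
    simp only [towerMap, h, dite_false, Function.iterate_zero, id, Nat.succ_eq_add_one]
    rw [this]; exact hp.symm

/-- The map modelled by a tower is a factor of the tower map, hence ergodic. -/
theorem ergodic (S : YoungTower f m) (hf : Measurable f) : Ergodic f m := by
  set π : Tower S.τ → 𝒳 := fun p => f^[p.1.2] (p.1.1 : 𝒳) with hπ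
  have hπm : Measurable π := (S.measurable_tower_proj hf).comp measurable_subtype_coe
  have hmap : m = (towerMeasure S.μY S.τ).map π := S.map_proj
  have hT := S.ergodic_tower
  have hsc : f ∘ π =ᵐ[towerMeasure S.μY S.τ] π ∘ towerMap S.F S.τ S.one_le_τ := S.ae_semiconj
  have hpres : m.map f = m := by
    conv_lhs => rw [hmap, Measure.map_map hf hπm, Measure.map_congr hsc,
      ← Measure.map_map hπm hT.measurable, hT.toMeasurePreserving.map_eq, ← hmap]
  refine ⟨⟨hf, hpres⟩, ⟨fun s hs hfs => ?_⟩⟩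
  have h1 : towerMap S.F S.τ S.one_le_τ ⁻¹' (π ⁻¹' s) =ᵐ[towerMeasure S.μY S.τ] π ⁻¹' s := by
    filter_upwards [hsc] with p hp
    have hp' : f (π p) = π (towerMap S.F S.τ S.one_le_τ p) := hp
    apply propext
    change π (towerMap S.F S.τ S.one_le_τ p) ∈ s ↔ π p ∈ s
    rw [← hp', ← mem_preimage, hfs]
  have h2 := hT.quasiErgodic.aeconst_set₀ (hπm hs).nullMeasurableSet h1
  rw [hmap]
  rw [eventuallyConst_set] at h2 ⊢
  exact h2.imp (ae_map_iff hπm.aemeasurable hs).2 (ae_map_iff hπm.aemeasurable hs.compl).2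

theorem integrable_lift (S : YoungTower f m) (hf : Measurable f) {W : 𝒳 → ℝ} (hW : Measurable W)
    (hWi : Integrable W m) : Integrable (S.lift W) S.μY := by
  refine ⟨(S.measurable_lift hf hW).aestronglyMeasurable, ?_⟩
  rw [hasFiniteIntegral_iff_enorm]
  calc ∫⁻ y, ‖S.lift W y‖ₑ ∂S.μY ≤ ∫⁻ y, S.lift (fun x => ‖W x‖ₑ) y ∂S.μY :=
        lintegral_mono fun y => enorm_sum_le (Finset.range (S.τ y)) fun l => W (f^[l] (y : 𝒳))
    _ = _ := S.lintegral_lift hf hW.enorm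
    _ < ∞ := ENNReal.mul_lt_top ENNReal.ofReal_lt_top hWi.2

theorem integral_lift (S : YoungTower f m) (hf : Measurable f) {W : 𝒳 → ℝ} (hW : Measurable W)
    (hWi : Integrable W m) : ∫ y, S.lift W y ∂S.μY = S.meanTau * ∫ x, W x ∂m := by
  have key : ∀ u : 𝒳 → ℝ, Measurable u → (∀ x, 0 ≤ u x) →
      ∫ y, S.lift u y ∂S.μY = S.meanTau * ∫ x, u x ∂m := by
    intro u hu hu0
    have h := S.lintegral_lift hf (h := fun x => ENNReal.ofReal (u x)) hu.ennreal_ofReal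
    have e : ∀ y, ENNReal.ofReal (S.lift u y) = S.lift (fun x => ENNReal.ofReal (u x)) y :=
      fun y => by
        rw [lift, birkhoffSum, ENNReal.ofReal_sum_of_nonneg fun i _ => hu0 _]; rfl
    have hnn : ∀ y, 0 ≤ S.lift u y := fun y => by
      unfold lift birkhoffSum
      exact Finset.sum_nonneg fun i _ => hu0 _
    rw [integral_eq_lintegral_of_nonneg_ae (Eventually.of_forall hnn)
      (S.measurable_lift hf hu).aestronglyMeasurable,
      integral_eq_lintegral_of_nonneg_ae (Eventually.of_forall hu0) hu.aestronglyMeasurable]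
    simp only [e, h, ENNReal.toReal_mul,
      ENNReal.toReal_ofReal (zero_le_one.trans S.one_le_meanTau)]
  have e : ∀ x, W x = max (W x) 0 - max (-W x) 0 := fun x => by
    rcases le_total 0 (W x) with h | h
    · rw [max_eq_left h, max_eq_right (by linarith)]; ring
    · rw [max_eq_right h, max_eq_left (by linarith)]; ring
  have e' : ∀ y, S.lift W y = S.lift (fun x => max (W x) 0) y - S.lift (fun x => max (-W x) 0) y :=
    fun y => by
      simp only [lift, birkhoffSum, ← Finset.sum_sub_distrib, ← e]
  have hp : Measurable fun x => max (W x) 0 := hW.max measurable_const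
  have hn : Measurable fun x => max (-W x) 0 := hW.neg.max measurable_const
  rw [integral_congr_ae (Eventually.of_forall e'),
    integral_sub (S.integrable_lift hf hp hWi.pos_part) (S.integrable_lift hf hn hWi.neg_part),
    key _ hp fun x => le_max_right _ _, key _ hn fun x => le_max_right _ _, ← mul_sub,
    ← integral_sub hWi.pos_part hWi.neg_part]
  simp only [← e]

theorem lintegral_pow_tau_lt_top (S : YoungTower f m) (N : ℕ) :
    ∫⁻ y, (S.τ y : ℝ≥0∞) ^ N ∂S.μY < ∞ := by
  have := S.isProbabilityMeasure
  obtain ⟨C, c, hC, hc, htail⟩ := S.exp_tails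
  have e : ∫⁻ y, (S.τ y : ℝ≥0∞) ^ N ∂S.μY =
      ∑' n : ℕ, (n : ℝ≥0∞) ^ N * S.μY (S.τ ⁻¹' {n}) := by
    rw [← lintegral_map (f := fun n : ℕ => (n : ℝ≥0∞) ^ N) measurable_from_top S.measurable_τ,
      lintegral_countable']
    exact tsum_congr fun n => by
      rw [Measure.map_apply S.measurable_τ (measurableSet_singleton n)]
  have hle : ∀ n : ℕ, (n : ℝ≥0∞) ^ N * S.μY (S.τ ⁻¹' {n}) ≤
      ENNReal.ofReal (C * Real.exp c * ((n : ℝ) ^ N * Real.exp (-c * n))) := by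
    intro n
    have h1 : S.μY.real (S.τ ⁻¹' {n}) ≤ C * Real.exp (-c * (n - 1)) := by
      rcases n with _ | n
      · have : S.τ ⁻¹' {0} = ∅ := by
          ext y
          simpa using Nat.one_le_iff_ne_zero.1 (S.one_le_τ y)
        rw [this]; simp; positivity
      · calc S.μY.real (S.τ ⁻¹' {n + 1}) ≤ S.μY.real {y | n < S.τ y} :=
              measureReal_mono fun y hy => by
                have : S.τ y = n + 1 := hy
                change n < S.τ y
                omega
          _ ≤ _ := by simpa using htail n
    have h2 : (n : ℝ≥0∞) ^ N = ENNReal.ofReal ((n : ℝ) ^ N) := by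
      rw [ENNReal.ofReal_pow (Nat.cast_nonneg _), ENNReal.ofReal_natCast]
    rw [h2, ← ofReal_measureReal, ← ENNReal.ofReal_mul (by positivity)]
    refine ENNReal.ofReal_le_ofReal ((mul_le_mul_of_nonneg_left h1 (by positivity)).trans_eq ?_)
    rw [show -c * ((n : ℝ) - 1) = c + -c * n by ring, Real.exp_add]
    ring
  rw [e]
  refine (ENNReal.tsum_le_tsum hle).trans_lt ?_
  have hsum := (Real.summable_pow_mul_exp_neg_nat_mul N hc).mul_left (C * Real.exp c)
  rw [← ENNReal.ofReal_tsum_of_nonneg (fun n => by positivity) hsum]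
  exact ENNReal.ofReal_lt_top

/-- Lifting to the base of the tower costs arbitrarily little integrability, since `τ` has moments
of all orders. -/
theorem memLp_lift (S : YoungTower f m) (hf : Measurable f) {W : 𝒳 → ℝ} (hW : Measurable W)
    {p q : ℝ} (hq : 0 < q) (hqp : q < p) (hWp : MemLp W (ENNReal.ofReal p) m) :
    MemLp (S.lift W) (ENNReal.ofReal q) S.μY := by
  have := S.isProbabilityMeasure
  have hp : 0 < p := hq.trans hqp
  obtain ⟨N, hN⟩ := exists_nat_ge (q * p / (p - q))
  refine ⟨(S.measurable_lift hf hW).aestronglyMeasurable, ?_⟩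
  rw [eLpNorm_lt_top_iff_lintegral_rpow_enorm_lt_top (ENNReal.ofReal_pos.2 hq).ne'
    ENNReal.ofReal_ne_top]
  rw [ENNReal.toReal_ofReal hq.le]
  have hWfin : ∫⁻ x, ‖W x‖ₑ ^ p ∂m < ∞ := by
    have := lintegral_rpow_enorm_lt_top_of_eLpNorm_lt_top (ENNReal.ofReal_pos.2 hp).ne'
      ENNReal.ofReal_ne_top hWp.2
    rwa [ENNReal.toReal_ofReal hp.le] at this
  -- `(t w) ^ q ≤ t ^ (q p / (p - q)) + w ^ p`, with `t = τ` and `w` the largest term of the sum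
  have hpt : ∀ y, ‖S.lift W y‖ₑ ^ q ≤ (S.τ y : ℝ≥0∞) ^ N + S.lift (fun x => ‖W x‖ₑ ^ p) y := by
    intro y
    obtain ⟨l, hl, hmax⟩ := Finset.exists_max_image (Finset.range (S.τ y))
      (fun l => |W (f^[l] (y : 𝒳))|) ⟨0, Finset.mem_range.2 (S.one_le_τ y)⟩
    set w := |W (f^[l] (y : 𝒳))| with hw
    have hw0 : 0 ≤ w := abs_nonneg _
    have ht : (1 : ℝ) ≤ S.τ y := by exact_mod_cast S.one_le_τ y
    have h1 : |S.lift W y| ≤ S.τ y * w := by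
      refine (Finset.abs_sum_le_sum_abs _ _).trans ((Finset.sum_le_card_nsmul _ _ _ hmax).trans_eq ?_)
      simp
    have h2 : |S.lift W y| ^ q ≤ (S.τ y : ℝ) ^ N + w ^ p := by
      refine (Real.rpow_le_rpow (abs_nonneg _) h1 hq.le).trans ?_
      rw [Real.mul_rpow (by positivity) hw0]
      have hpq : 0 < p - q := sub_pos.2 hqp
      rcases le_total ((S.τ y : ℝ) ^ q) (w ^ (p - q)) with h | h
      · refine (mul_le_mul_of_nonneg_right h (by positivity)).trans ?_
        rw [← Real.rpow_add_of_nonneg hw0 hpq.le hq.le, sub_add_cancel]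
        exact le_add_of_nonneg_left (by positivity)
      · have h3 : w ≤ (S.τ y : ℝ) ^ (q / (p - q)) := by
          rw [div_eq_mul_inv, Real.rpow_mul (by positivity)]
          rwa [Real.le_rpow_inv_iff_of_pos hw0 (by positivity) hpq]
        calc (S.τ y : ℝ) ^ q * w ^ q ≤ (S.τ y : ℝ) ^ q * ((S.τ y : ℝ) ^ (q / (p - q))) ^ q := by
              gcongr
          _ = (S.τ y : ℝ) ^ (q * p / (p - q)) := by
              rw [← Real.rpow_mul (by positivity), ← Real.rpow_add (by positivity)]
              congr 1
              field_simp
              ring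
          _ ≤ (S.τ y : ℝ) ^ N := by
              rw [← Real.rpow_natCast]
              exact Real.rpow_le_rpow_of_exponent_le ht hN
          _ ≤ _ := le_add_of_nonneg_right (by positivity)
    have h4 : ‖W (f^[l] (y : 𝒳))‖ₑ ^ p ≤ S.lift (fun x => ‖W x‖ₑ ^ p) y :=
      Finset.single_le_sum (f := fun l => ‖W (f^[l] (y : 𝒳))‖ₑ ^ p) (fun _ _ => zero_le) hl
    calc ‖S.lift W y‖ₑ ^ q = ENNReal.ofReal (|S.lift W y| ^ q) := by
          rw [Real.enorm_eq_ofReal_abs, ENNReal.ofReal_rpow_of_nonneg (abs_nonneg _) hq.le]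
      _ ≤ ENNReal.ofReal ((S.τ y : ℝ) ^ N + w ^ p) := ENNReal.ofReal_le_ofReal h2
      _ = (S.τ y : ℝ≥0∞) ^ N + ‖W (f^[l] (y : 𝒳))‖ₑ ^ p := by
          rw [ENNReal.ofReal_add (by positivity) (by positivity), ENNReal.ofReal_pow (by positivity),
            ENNReal.ofReal_natCast, Real.enorm_eq_ofReal_abs,
            ENNReal.ofReal_rpow_of_nonneg (abs_nonneg _) hp.le]
      _ ≤ _ := add_le_add le_rfl h4
  refine (lintegral_mono hpt).trans_lt ?_
  rw [lintegral_add_left (f := fun y => (S.τ y : ℝ≥0∞) ^ N)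
    ((measurable_from_top (f := fun n : ℕ => (n : ℝ≥0∞) ^ N)).comp S.measurable_τ),
    S.lintegral_lift hf (hW.enorm.pow_const p)]
  exact ENNReal.add_lt_top.2 ⟨S.lintegral_pow_tau_lt_top N,
    ENNReal.mul_lt_top ENNReal.ofReal_lt_top hWfin⟩

theorem memLp_tau (S : YoungTower f m) {q : ℝ≥0} (hq : 0 < q) :
    MemLp (fun y => (S.τ y : ℝ)) q S.μY := by
  have := S.isProbabilityMeasure
  obtain ⟨N, hN⟩ := exists_nat_ge (q : ℝ)
  refine ⟨(measurable_from_top.comp S.measurable_τ).aestronglyMeasurable, ?_⟩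
  rw [eLpNorm_lt_top_iff_lintegral_rpow_enorm_lt_top (by exact_mod_cast hq.ne')
    ENNReal.coe_ne_top]
  refine lt_of_le_of_lt (lintegral_mono fun y => ?_) (S.lintegral_pow_tau_lt_top N)
  rw [ENNReal.coe_toReal, Real.enorm_natCast, ← ENNReal.rpow_natCast]
  exact ENNReal.rpow_le_rpow_of_exponent_le (by exact_mod_cast S.one_le_τ y) hN

theorem ae_forall_F_eq (S : YoungTower f m) :
    ∀ᵐ y ∂S.μY, ∀ i : ℕ, ((S.F (S.F^[i] y) : S.Y) : 𝒳) = f^[S.τ (S.F^[i] y)] (S.F^[i] y : 𝒳) :=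
  ae_all_iff.2 fun i =>
    (S.ergodic_base.toMeasurePreserving.iterate i).quasiMeasurePreserving.ae S.F_eq

theorem iterate_birkhoffSum_tau (S : YoungTower f m) {y : S.Y}
    (hy : ∀ i : ℕ, ((S.F (S.F^[i] y) : S.Y) : 𝒳) = f^[S.τ (S.F^[i] y)] (S.F^[i] y : 𝒳)) (n : ℕ) :
    f^[birkhoffSum S.F S.τ n y] (y : 𝒳) = (S.F^[n] y : S.Y) := by
  induction n with
  | zero => simp
  | succ n ih =>
    rw [birkhoffSum_succ, add_comm, Function.iterate_add_apply, ih, Function.iterate_succ_apply',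
      hy]

/-- Sums under `F` of the lifted observable are sums under `f` up to the return to the base. -/
theorem birkhoffSum_lift {M : Type*} [AddCommMonoid M] (S : YoungTower f m) (W : 𝒳 → M) {y : S.Y}
    (hy : ∀ i : ℕ, ((S.F (S.F^[i] y) : S.Y) : 𝒳) = f^[S.τ (S.F^[i] y)] (S.F^[i] y : 𝒳)) (n : ℕ) :
    birkhoffSum S.F (S.lift W) n y = birkhoffSum f W (birkhoffSum S.F S.τ n y) y := by
  induction n with
  | zero => simp
  | succ n ih =>
    rw [birkhoffSum_succ, birkhoffSum_succ, ih, birkhoffSum_add, S.iterate_birkhoffSum_tau hy]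
    rfl

end YoungTower

/-! ### Moment bounds on the base of a Chernov-Markarian-Zhang structure -/

namespace YoungTower

variable {𝒳 : Type*} [MetricSpace 𝒳] [MeasurableSpace 𝒳] {f : 𝒳 → 𝒳} {m : Measure 𝒳}

theorem proj_out (S : YoungTower f m) (z : S.Ybar) : S.proj (Quotient.out z) = z :=
  Quotient.out_eq z

/-- A function that is constant on the partition elements is a function on the space of leaves. -/
theorem comp_out_proj (S : YoungTower f m) {β : Type*} {Φ : S.Y → β}
    (hΦ : ∀ a ∈ S.parts, ∀ y y', S.proj y ∈ a → S.proj y' ∈ a → Φ y = Φ y') (y : S.Y) :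
    Φ (Quotient.out (S.proj y)) = Φ y := by
  obtain ⟨a, ha, hya⟩ := S.isFullBranchGibbsMarkov.exists_mem (S.proj y)
  exact hΦ a ha _ _ (by rwa [proj_out]) hya

theorem measurable_comp_out (S : YoungTower f m) {Φ : S.Y → ℝ}
    (hΦ : ∀ a ∈ S.parts, ∀ y y', S.proj y ∈ a → S.proj y' ∈ a → Φ y = Φ y') :
    Measurable fun z : S.Ybar => Φ (Quotient.out z) :=
  S.isFullBranchGibbsMarkov.measurable_of_const fun a ha z hz z' hz' =>
    hΦ a ha _ _ (by rwa [proj_out]) (by rwa [proj_out])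

theorem stronglyMeasurable_of_const (S : YoungTower f m) {Φ : S.Y → ℝ}
    (hΦ : ∀ a ∈ S.parts, ∀ y y', S.proj y ∈ a → S.proj y' ∈ a → Φ y = Φ y') :
    StronglyMeasurable[S.leafAlgebra] Φ := by
  have : Φ = (fun z : S.Ybar => Φ (Quotient.out z)) ∘ S.proj :=
    funext fun y => (S.comp_out_proj hΦ y).symm
  rw [this]
  exact ((S.measurable_comp_out hΦ).comp (comap_measurable _)).stronglyMeasurable

theorem integrable_comp_out (S : YoungTower f m) {Φ : S.Y → ℝ}
    (hΦ : ∀ a ∈ S.parts, ∀ y y', S.proj y ∈ a → S.proj y' ∈ a → Φ y = Φ y')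
    (hΦi : Integrable Φ S.μY) :
    Integrable (fun z : S.Ybar => Φ (Quotient.out z)) (S.μY.map S.proj) := by
  rw [integrable_map_measure (S.measurable_comp_out hΦ).aestronglyMeasurable
    S.measurable_proj.aemeasurable]
  exact hΦi.congr (Eventually.of_forall fun y => (S.comp_out_proj hΦ y).symm)

/-- The moment bound for `τ`, which is constant along the leaves and on the partition elements. -/
theorem exists_eLpNorm_birkhoffSum_tau_le [StandardBorelSpace 𝒳] (S : YoungTower f m)
    {r : ℝ≥0} (hr : 1 < r) (hr2 : r ≤ 2) : ∃ K : ℝ≥0, ∀ n : ℕ,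
      eLpNorm (birkhoffSum S.F (fun y => (S.τ y : ℝ) - S.meanTau) n) r S.μY ≤
        K * (n : ℝ≥0∞) ^ (1 / (r : ℝ)) := by
  have := S.isProbabilityMeasure
  have hτ : Integrable (fun y => (S.τ y : ℝ) - S.meanTau) S.μY :=
    S.integrable_τ.sub (integrable_const _)
  have hconst : ∀ a ∈ S.parts, ∀ y y', S.proj y ∈ a → S.proj y' ∈ a →
      (S.τ y : ℝ) - S.meanTau = S.τ y' - S.meanTau := fun a ha y y' hy hy' => by
    rw [S.τ_const a ha y y' hy hy']
  refine S.exists_eLpNorm_birkhoffSum_le (q := r + 1) hr hr2 (by simp)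
    (Φ := fun _ => 0) (γ := 1 / 2) ((S.memLp_tau (by positivity)).sub (memLp_const _)) ?_
    (integrable_const _) (fun _ => le_rfl) (fun _ _ _ _ _ _ => rfl) (by norm_num) ?_
    (S.integrable_comp_out hconst hτ) ?_ ?_
  · rw [integral_sub S.integrable_τ (integrable_const _)]
    simp [meanTau]
  · intro y y' h n
    have h' := (S.leaf_iff _ _).1 (S.leaf_iterate h n)
    obtain ⟨a, ha, hya⟩ := S.isFullBranchGibbsMarkov.exists_mem (S.proj (S.F^[n] y))
    rw [hconst a ha _ _ hya (h' ▸ hya)]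
    simp
  · rw [condExp_of_stronglyMeasurable S.measurable_proj.comap_le
      (S.stronglyMeasurable_of_const hconst) hτ]
    exact Eventually.of_forall fun y => (S.comp_out_proj hconst y).symm
  · intro a ha y y' hy hy'
    rw [hconst a ha (Quotient.out (S.proj y)) (Quotient.out (S.proj y')) (by rwa [proj_out])
      (by rwa [proj_out])]
    simp

end YoungTower

namespace CMZStructure

variable {Λ : Type*} [MetricSpace Λ] [MeasurableSpace Λ] {T : Λ → Λ} {μ : Measure Λ} {X : Set Λ}
  {η : ℝ≥0}

theorem measurable_map (S : CMZStructure T μ X η) : Measurable (returnMap T X) :=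
  measurable_returnMap S.ergodic.measurable S.measurableSet_X

theorem inducedReturnTime_const (S : CMZStructure T μ X η) : ∀ a ∈ S.tower.parts, ∀ y y',
    S.tower.proj y ∈ a → S.tower.proj y' ∈ a →
      inducedReturnTime S.tower y = inducedReturnTime S.tower y' := by
  intro a ha y y' hy hy'
  unfold inducedReturnTime birkhoffSum
  rw [← S.tower.τ_const a ha y y' hy hy']
  exact Finset.sum_congr rfl fun l hl =>
    S.returnTime_const a ha y y' hy hy' l (Finset.mem_range.1 hl)

theorem inducedY_eq_lift (S : CMZStructure T μ X η) (v : Λ → ℝ) :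
    inducedY S.tower v = S.tower.lift (induced T X v) :=
  funext fun _ => birkhoffSum_birkhoffSum_returnTime v _ _

theorem natCast_inducedReturnTime (S : CMZStructure T μ X η) (y : S.tower.Y) :
    (inducedReturnTime S.tower y : ℝ) = S.tower.lift (fun x => (returnTime T X x : ℝ)) y :=
  natCast_birkhoffSum _ _ _ _

theorem measurable_natCast_returnTime (S : CMZStructure T μ X η) :
    Measurable fun x : X => (returnTime T X x : ℝ) :=
  measurable_from_top.comp (measurable_returnTime S.ergodic.measurable S.measurableSet_X)

/-- The observable on `Y` induced by `v`, minus `I` times the centred return time to `Y` under `T`.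
Its Birkhoff sums are the part of those of `v` that is negligible for the stable law. -/
def residual (S : CMZStructure T μ X η) (v : Λ → ℝ) (I : ℝ) (y : S.tower.Y) : ℝ :=
  inducedY S.tower v y -
    I * (inducedReturnTime S.tower y - S.tower.meanTau * meanReturnTime T μ X)

theorem residual_eq (S : CMZStructure T μ X η) (v : Λ → ℝ) (I : ℝ) (y : S.tower.Y) :
    S.residual v I y = S.tower.lift (fun x => induced T X v x - I * returnTime T X x) y +
      I * (S.tower.meanTau * meanReturnTime T μ X) := by
  rw [residual, inducedY_eq_lift, natCast_inducedReturnTime]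
  simp only [YoungTower.lift, birkhoffSum, Finset.sum_sub_distrib]
  rw [mul_sub, Finset.mul_sum]
  ring

variable [IsProbabilityMeasure μ]

theorem integrable_inducedReturnTime (S : CMZStructure T μ X η) :
    Integrable (fun y => (inducedReturnTime S.tower y : ℝ)) S.tower.μY := by
  simp only [natCast_inducedReturnTime]
  exact S.tower.integrable_lift S.measurable_map S.measurable_natCast_returnTime
    (integrable_returnTime S.ergodic S.measurableSet_X S.measure_X_ne_zero)

theorem integral_inducedReturnTime (S : CMZStructure T μ X η) :
    ∫ y, (inducedReturnTime S.tower y : ℝ) ∂S.tower.μY =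
      S.tower.meanTau * meanReturnTime T μ X := by
  simp only [natCast_inducedReturnTime]
  exact S.tower.integral_lift S.measurable_map S.measurable_natCast_returnTime
    (integrable_returnTime S.ergodic S.measurableSet_X S.measure_X_ne_zero)

/-- The moment bound for the residual. The return-time part of the residual is constant on the
partition elements, so that the regularity along leaves and across leaves is that of the observable
induced by `v`. -/
theorem exists_eLpNorm_birkhoffSum_residual_le [BorelSpace Λ] [StandardBorelSpace Λ]
    (S : CMZStructure T μ X η) (hη : 0 < η) {v : Λ → ℝ} (hv : IsHolderObservable η v)
    (hv0 : ∫ x, v x ∂μ = 0) {I p : ℝ} {r : ℝ≥0} (hr : 1 < r) (hr2 : r ≤ 2) (hrp : (r : ℝ) < p)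
    (hLp : MemLp (fun x : X => induced T X v x - I * returnTime T X x) (ENNReal.ofReal p)
      (restrictedMeasure μ X)) :
    ∃ K : ℝ≥0, ∀ n : ℕ, eLpNorm (birkhoffSum S.tower.F (S.residual v I) n) r S.tower.μY ≤
      K * (n : ℝ≥0∞) ^ (1 / (r : ℝ)) := by
  have := S.tower.isProbabilityMeasure
  have := S.measurableSet_X.standardBorel
  have hT := S.ergodic
  have hX := S.measurableSet_X
  have hX0 := S.measure_X_ne_zero
  obtain ⟨ζ, hζ, hζv, C₂, γ₂, hC₂, hγ₂, hζL⟩ := S.condExp_regular v hv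
  obtain ⟨⟨L, hL⟩, M, hM⟩ := hv
  obtain ⟨C₁, γ₁, hC₁, hγ₁, hcontr⟩ := S.excursion_contraction
  have hvm : Measurable v := (hL.continuous hη).measurable
  obtain ⟨q, hrq, hqp⟩ := exists_between hrp
  lift q to ℝ≥0 using r.coe_nonneg.trans hrq.le
  have hφc := S.inducedReturnTime_const
  have hφi := S.integrable_inducedReturnTime
  have hφX := integrable_returnTime hT hX hX0
  have hVi : Integrable (inducedY S.tower v) S.tower.μY := by
    rw [inducedY_eq_lift]
    exact S.tower.integrable_lift S.measurable_map (measurable_induced hT.measurable hX hvm)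
      (integrable_induced hT hX hX0 hvm hM)
  set c := S.tower.meanTau * meanReturnTime T μ X with hc
  set Θ : S.tower.Y → ℝ := fun y => I * (inducedReturnTime S.tower y - c) with hΘ
  have hΘc : ∀ a ∈ S.tower.parts, ∀ y y', S.tower.proj y ∈ a → S.tower.proj y' ∈ a →
      Θ y = Θ y' := fun a ha y y' hy hy' => by
    simp only [hΘ, hφc a ha y y' hy hy']
  have hΘi : Integrable Θ S.tower.μY := (hφi.sub (integrable_const c)).const_mul I
  set D : ℝ := L * C₁ ^ (η : ℝ) with hD
  have hγη : γ₁ ^ (η : ℝ) ∈ Ioo (0 : ℝ) 1 :=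
    ⟨Real.rpow_pos_of_pos hγ₁.1 _, Real.rpow_lt_one hγ₁.1.le hγ₁.2 (by exact_mod_cast hη)⟩
  have hD0 : 0 ≤ D := by positivity
  refine S.tower.exists_eLpNorm_birkhoffSum_le (q := q)
    (Φ := fun y => max D C₂ * inducedReturnTime S.tower y) (γ := max (γ₁ ^ (η : ℝ)) γ₂)
    (ζ := fun z => ζ z - Θ (Quotient.out z)) hr hr2 (by exact_mod_cast hrq) ?_ ?_
    (hφi.const_mul _) (fun y => by positivity)
    (fun a ha y y' hy hy' => by rw [hφc a ha y y' hy hy'])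
    ⟨lt_max_of_lt_left hγη.1, max_lt hγη.2 hγ₂.2⟩ ?_
    (hζ.sub (S.tower.integrable_comp_out hΘc hΘi)) ?_ ?_
  · have h := S.tower.memLp_lift S.measurable_map
      ((measurable_induced hT.measurable hX hvm).sub (S.measurable_natCast_returnTime.const_mul I))
      (q := q) ((zero_lt_one.trans (by exact_mod_cast hr)).trans hrq) hqp hLp
    rw [ENNReal.ofReal_coe_nnreal] at h
    have h' := h.add (memLp_const (I * c))
    exact h'.ae_eq (Eventually.of_forall fun y => (S.residual_eq v I y).symm)
  · have e : ∫ y, S.residual v I y ∂S.tower.μY =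
        ∫ y, inducedY S.tower v y ∂S.tower.μY - ∫ y, Θ y ∂S.tower.μY := integral_sub hVi hΘi
    rw [e, inducedY_eq_lift, S.tower.integral_lift S.measurable_map
      (measurable_induced hT.measurable hX hvm) (integrable_induced hT hX hX0 hvm hM),
      integral_induced_eq_zero hT hX hX0 hvm hM hv0, hΘ, integral_const_mul,
      integral_sub hφi (integrable_const c), S.integral_inducedReturnTime]
    simp [hc]
  · intro y y' h n
    have h' := (S.tower.leaf_iff _ _).1 (S.tower.leaf_iterate h n)
    obtain ⟨a, ha, hya⟩ := S.tower.isFullBranchGibbsMarkov.exists_mem (S.tower.proj (S.tower.F^[n] y))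
    have hφe := hφc a ha _ _ hya (h' ▸ hya)
    have e : S.residual v I (S.tower.F^[n] y) - S.residual v I (S.tower.F^[n] y') =
        ∑ l ∈ Finset.range (inducedReturnTime S.tower (S.tower.F^[n] y)),
          (v (T^[l] ((S.tower.F^[n] y : X) : Λ)) - v (T^[l] ((S.tower.F^[n] y' : X) : Λ))) := by
      rw [Finset.sum_sub_distrib, residual, residual, hφe]
      conv_lhs => rw [inducedY, inducedY, birkhoffSum, birkhoffSum, hφe]
      ring
    have hterm : ∀ l ∈ Finset.range (inducedReturnTime S.tower (S.tower.F^[n] y)),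
        |v (T^[l] ((S.tower.F^[n] y : X) : Λ)) - v (T^[l] ((S.tower.F^[n] y' : X) : Λ))| ≤
          D * (γ₁ ^ (η : ℝ)) ^ n := by
      intro l hl
      refine (hL.dist_le _ _).trans ?_
      have hd := hcontr y y' h n l (Finset.mem_range.1 hl)
      calc (L : ℝ) * dist _ _ ^ (η : ℝ) ≤ L * (C₁ * γ₁ ^ n) ^ (η : ℝ) := by gcongr
        _ = D * (γ₁ ^ (η : ℝ)) ^ n := by
          rw [Real.mul_rpow hC₁.le (pow_nonneg hγ₁.1.le n), hD, mul_assoc, ← Real.rpow_natCast γ₁,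
            ← Real.rpow_natCast (γ₁ ^ (η : ℝ)), ← Real.rpow_mul hγ₁.1.le,
            ← Real.rpow_mul hγ₁.1.le, mul_comm (n : ℝ)]
    rw [e]
    refine (Finset.abs_sum_le_sum_abs _ _).trans ((Finset.sum_le_card_nsmul _ _ _ hterm).trans ?_)
    rw [Finset.card_range, nsmul_eq_mul]
    have h1 : (γ₁ ^ (η : ℝ)) ^ n ≤ (max (γ₁ ^ (η : ℝ)) γ₂) ^ n :=
      pow_le_pow_left₀ hγη.1.le (le_max_left _ _) n
    have h2 : D ≤ max D C₂ := le_max_left _ _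
    have h3 : 0 ≤ (γ₁ ^ (η : ℝ)) ^ n := pow_nonneg hγη.1.le n
    calc (inducedReturnTime S.tower (S.tower.F^[n] y) : ℝ) * (D * (γ₁ ^ (η : ℝ)) ^ n)
        ≤ inducedReturnTime S.tower (S.tower.F^[n] y) *
          (max D C₂ * (max (γ₁ ^ (η : ℝ)) γ₂) ^ n) := by
          gcongr
      _ = _ := by ring
  · have h1 : S.tower.μY[fun y => inducedY S.tower v y - Θ y | S.tower.leafAlgebra]
        =ᵐ[S.tower.μY] S.tower.μY[inducedY S.tower v | S.tower.leafAlgebra] -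
          S.tower.μY[Θ | S.tower.leafAlgebra] := condExp_sub hVi hΘi _
    rw [condExp_of_stronglyMeasurable S.tower.measurable_proj.comap_le
      (S.tower.stronglyMeasurable_of_const hΘc) hΘi] at h1
    refine h1.trans ?_
    filter_upwards [hζv] with y hy
    simp only [Pi.sub_apply, Function.comp_apply, hy, S.tower.comp_out_proj hΘc]
  · intro a ha y y' hy hy'
    have e : Θ (Quotient.out (S.tower.proj y)) = Θ (Quotient.out (S.tower.proj y')) :=
      hΘc a ha _ _ (by rwa [YoungTower.proj_out]) (by rwa [YoungTower.proj_out])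
    rw [e, sub_sub_sub_cancel_right]
    refine (hζL a ha y y' hy hy').trans ?_
    have h1 := powSep_mono hγ₂.1.le (le_max_right (γ₁ ^ (η : ℝ)) γ₂)
      (separationTime S.tower.Fbar S.tower.parts (S.tower.proj y) (S.tower.proj y'))
    have h2 : C₂ ≤ max D C₂ := le_max_right _ _
    have h3 := powSep_nonneg hγ₂.1.le
      (separationTime S.tower.Fbar S.tower.parts (S.tower.proj y) (S.tower.proj y'))
    gcongr

end CMZStructure

/-! ### Convergence in distribution and in measure -/

section Convergence

variable {Ω Ω' Ω'' : Type*} [MeasurableSpace Ω] [MeasurableSpace Ω'] [MeasurableSpace Ω'']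
  {m : Measure Ω} {ν : Measure Ω'} {P : Measure Ω''}

/-- Lévy's continuity theorem. -/
theorem tendstoInDistribution_iff_tendsto_integral_exp [IsProbabilityMeasure m]
    [IsProbabilityMeasure P] {Z : ℕ → Ω → ℝ} (hZ : ∀ n, Measurable (Z n)) {G : Ω'' → ℝ} :
    TendstoInDistribution Z atTop G (fun _ => m) P ↔ AEMeasurable G P ∧ ∀ u : ℝ,
      Tendsto (fun n => ∫ x, Complex.exp (u * Z n x * Complex.I) ∂m) atTop
        (𝓝 (charFun (P.map G) u)) := by
  have e : ∀ n (u : ℝ), charFun (m.map (Z n)) u = ∫ x, Complex.exp (u * Z n x * Complex.I) ∂m := by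
    intro n u
    rw [charFun_apply_real, integral_map (hZ n).aemeasurable (by fun_prop)]
  constructor
  · intro h
    refine ⟨h.aemeasurable_limit, fun u => ?_⟩
    simp only [← e]
    exact ProbabilityMeasure.tendsto_iff_tendsto_charFun.1 h.tendsto u
  · rintro ⟨hG, h⟩
    refine ⟨fun n => (hZ n).aemeasurable, hG, ProbabilityMeasure.tendsto_iff_tendsto_charFun.2 ?_⟩
    intro u
    have := h u
    simp only [← e] at this
    exact this

theorem norm_exp_sub_exp_le (u s t : ℝ) :
    ‖Complex.exp (u * s * Complex.I) - Complex.exp (u * t * Complex.I)‖ ≤ |u| * |s - t| := by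
  have e : Complex.exp (u * s * Complex.I) - Complex.exp (u * t * Complex.I) =
      Complex.exp ((u * t : ℝ) * Complex.I) *
        (Complex.exp (Complex.I * (u * (s - t) : ℝ)) - 1) := by
    rw [mul_sub, mul_one, ← Complex.exp_add]
    push_cast
    ring_nf
  rw [e, norm_mul, Complex.norm_exp_ofReal_mul_I, one_mul, ← abs_mul]
  exact Real.norm_exp_I_mul_ofReal_sub_one_le

/-- Distributional limits of normalised Birkhoff sums of an ergodic map do not depend on the initial
measure, among the measures with a bounded density. -/
theorem tendstoInDistribution_birkhoffSum_iff [IsProbabilityMeasure m] [IsProbabilityMeasure ν]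
    [IsProbabilityMeasure P] {T : Ω → Ω} (hT : Ergodic T m) {g : Ω → ℝ} (hg : Measurable g)
    (hgi : Integrable g m) {d e : ℕ → ℝ} (hd : Tendsto d atTop (𝓝 0)) {i : Ω' → Ω}
    (hi : Measurable i) {c : ℝ≥0} (hc : ν.map i ≤ c • m) {G : Ω'' → ℝ} :
    TendstoInDistribution (fun n x => d n * (birkhoffSum T g n x - e n)) atTop G (fun _ => m) P ↔
      TendstoInDistribution (fun n y => d n * (birkhoffSum T g n (i y) - e n)) atTop G
        (fun _ => ν) P := by
  have hTm := hT.toMeasurePreserving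
  have : IsProbabilityMeasure (ν.map i) := Measure.isProbabilityMeasure_map hi.aemeasurable
  obtain ⟨ρ, hρ, hρc, hρν⟩ := exists_bounded_density hc
  set Z : ℕ → Ω → ℝ := fun n x => d n * (birkhoffSum T g n x - e n) with hZdef
  have hZ : ∀ n, Measurable (Z n) := fun n =>
    ((measurable_birkhoffSum hTm.measurable hg n).sub_const _).const_mul _
  have hρ1 : ∫ x, ρ x ∂m = 1 := by
    have h := hρν fun _ => 1
    simp only [integral_const, probReal_univ, one_smul, one_mul] at h
    rw [integral_complex_ofReal] at h
    exact_mod_cast h.symm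
  -- the sums are asymptotically invariant, as the sum of `g` telescopes along the orbit
  have hdiff : ∀ n x, Z n (T x) - Z n x = d n * (g (T^[n] x) - g x) := fun n x => by
    rw [← birkhoffSum_apply_sub_birkhoffSum]
    simp only [hZdef]
    ring
  have key : ∀ u : ℝ, Tendsto (fun n => ∫ y, Complex.exp (u * Z n (i y) * Complex.I) ∂ν -
      ∫ x, Complex.exp (u * Z n x * Complex.I) ∂m) atTop (𝓝 0) := by
    intro u
    have hinv : Tendsto (fun n => ∫ x, ‖Complex.exp (u * Z n (T x) * Complex.I) -
        Complex.exp (u * Z n x * Complex.I)‖ ∂m) atTop (𝓝 0) := by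
      have hlim : Tendsto (fun n => |u| * (|d n| * (2 * ∫ x, |g x| ∂m))) atTop (𝓝 0) := by
        simpa using (hd.abs.mul_const (2 * ∫ x, |g x| ∂m)).const_mul |u|
      refine squeeze_zero (fun n => integral_nonneg fun _ => norm_nonneg _) (fun n => ?_) hlim
      have hgn := integrable_comp_iterate hTm hgi n
      calc ∫ x, ‖Complex.exp (u * Z n (T x) * Complex.I) -
            Complex.exp (u * Z n x * Complex.I)‖ ∂m
          ≤ ∫ x, |u| * (|d n| * (|g (T^[n] x)| + |g x|)) ∂m := by
            refine integral_mono_of_nonneg (Eventually.of_forall fun _ => norm_nonneg _)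
              (((hgn.abs.add hgi.abs).const_mul _).const_mul _) (Eventually.of_forall fun x => ?_)
            refine (norm_exp_sub_exp_le _ _ _).trans ?_
            rw [hdiff, abs_mul]
            exact mul_le_mul_of_nonneg_left (mul_le_mul_of_nonneg_left (abs_sub _ _)
              (abs_nonneg _)) (abs_nonneg _)
        _ = |u| * (|d n| * (2 * ∫ x, |g x| ∂m)) := by
            rw [integral_const_mul, integral_const_mul, integral_add hgn.abs hgi.abs,
              integral_comp_measurePreserving (hTm.iterate n) (g := fun x => |g x|)
                hgi.abs.aestronglyMeasurable, two_mul]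
    have h := tendsto_integral_mul_density hT
      (h := fun n x => Complex.exp (u * Z n x * Complex.I))
      (fun n => by have := hZ n; fun_prop) (fun n x => ?_) hinv hρ hρc
    · refine h.congr fun n => ?_
      rw [← hρν, hρ1, integral_map hi.aemeasurable (by have := hZ n; fun_prop)]
      simp
    · rw [← Complex.ofReal_mul, Complex.norm_exp_ofReal_mul_I]
  rw [tendstoInDistribution_iff_tendsto_integral_exp hZ,
    tendstoInDistribution_iff_tendsto_integral_exp (Z := fun n y => Z n (i y))
      fun n => (hZ n).comp hi]
  refine and_congr_right fun _ => forall_congr' fun u => ⟨fun h => ?_, fun h => ?_⟩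
  · simpa using h.add (key u)
  · simpa using h.sub (key u)

/-- A sequence that converges in distribution is tight. -/
theorem exists_forall_measure_lt_abs_le [IsProbabilityMeasure m] [IsProbabilityMeasure P]
    {Z : ℕ → Ω → ℝ} {G : Ω'' → ℝ} (h : TendstoInDistribution Z atTop G (fun _ => m) P)
    {κ : ℝ} (hκ : 0 < κ) : ∃ A : ℝ, 0 < A ∧ ∀ n, m.real {x | A < |Z n x|} ≤ κ := by
  have := fun n => Measure.isProbabilityMeasure_map (h.forall_aemeasurable n)
  have := Measure.isProbabilityMeasure_map h.aemeasurable_limit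
  have htight : IsTightMeasureSet {x | ∃ n, m.map (Z n) = x} :=
    isTightMeasureSet_of_tendsto_charFun (f := charFun (P.map G)) (by fun_prop)
      fun u => ProbabilityMeasure.tendsto_iff_tendsto_charFun.1 h.tendsto u
  have hlim := tendsto_measure_norm_gt_of_isTightMeasureSet htight
  obtain ⟨A, hA, hA0⟩ := ((hlim.eventually (gt_mem_nhds (ENNReal.ofReal_pos.2 hκ))).and
    (eventually_gt_atTop 0)).exists
  refine ⟨A, hA0, fun n => ?_⟩
  refine ENNReal.toReal_le_of_le_ofReal hκ.le (le_trans ?_ hA.le)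
  refine le_trans ?_ (le_iSup₂ (f := fun (ρ : Measure ℝ) (_ : ρ ∈ {x | ∃ n, m.map (Z n) = x}) =>
    ρ {x | A < ‖x‖}) (m.map (Z n)) ⟨n, rfl⟩)
  rw [Measure.map_apply_of_aemeasurable (h.forall_aemeasurable n)
    (measurableSet_lt measurable_const measurable_norm)]
  exact le_rfl

theorem tendstoInMeasure_zero_iff [IsFiniteMeasure m] {W : ℕ → Ω → ℝ} :
    TendstoInMeasure m W atTop 0 ↔
      ∀ ε, 0 < ε → Tendsto (fun n => m.real {x | ε ≤ |W n x|}) atTop (𝓝 0) := by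
  rw [tendstoInMeasure_iff_measureReal_norm]
  simp

theorem tendstoInMeasure_zero_of_abs_le [IsFiniteMeasure m] {U V W : ℕ → Ω → ℝ} {A B : ℝ}
    (hA : 0 < A) (hB : 0 < B) (hU : TendstoInMeasure m U atTop 0) (hV : TendstoInMeasure m V atTop 0)
    (h : ∀ n, ∀ᵐ x ∂m, |W n x| ≤ A * |U n x| + B * |V n x|) : TendstoInMeasure m W atTop 0 := by
  rw [tendstoInMeasure_zero_iff] at *
  intro ε hε
  have hlim := (hU (ε / (2 * A)) (by positivity)).add (hV (ε / (2 * B)) (by positivity))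
  rw [add_zero] at hlim
  refine squeeze_zero (fun _ => measureReal_nonneg) (fun n => ?_) hlim
  refine le_trans ?_ (measureReal_union_le _ _)
  refine ENNReal.toReal_mono (measure_ne_top _ _) (measure_mono_ae ?_)
  filter_upwards [h n] with x hx hε'
  by_contra hcon
  have hcon' : ¬ (ε / (2 * A) ≤ |U n x| ∨ ε / (2 * B) ≤ |V n x|) := hcon
  push Not at hcon'
  have h1 : A * |U n x| < ε / 2 := by
    have := mul_lt_mul_of_pos_left hcon'.1 hA
    rwa [show A * (ε / (2 * A)) = ε / 2 by field_simp] at this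
  have h2 : B * |V n x| < ε / 2 := by
    have := mul_lt_mul_of_pos_left hcon'.2 hB
    rwa [show B * (ε / (2 * B)) = ε / 2 by field_simp] at this
  have h3 : ε ≤ |W n x| := hε'
  linarith

theorem tendstoInMeasure_const [IsFiniteMeasure m] {c : ℕ → ℝ} {c₀ : ℝ}
    (hc : Tendsto c atTop (𝓝 c₀)) : TendstoInMeasure m (fun n _ => c n) atTop fun _ => c₀ :=
  tendstoInMeasure_of_tendsto_ae (fun _ => aestronglyMeasurable_const)
    (Eventually.of_forall fun _ => hc)

/-- A sequence whose `L^r` norms are `O(n^{1/r})` is `o(n^{1/α})` in probability, for `α < r`. -/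
theorem tendstoInMeasure_div_of_eLpNorm_le [IsFiniteMeasure m] {W : ℕ → Ω → ℝ}
    (hW : ∀ n, Measurable (W n)) {r : ℝ≥0} {α : ℝ} (hα : 0 < α) (hr : α < r) {K : ℝ≥0}
    (h : ∀ n, eLpNorm (W n) r m ≤ K * (n : ℝ≥0∞) ^ (1 / (r : ℝ))) :
    TendstoInMeasure m (fun n x => W n x / (n : ℝ) ^ (1 / α)) atTop 0 := by
  have hr0 : (0 : ℝ) < r := hα.trans hr
  refine tendstoInMeasure_of_tendsto_eLpNorm (p := r) (by exact_mod_cast hr0.ne')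
    (fun n => ((hW n).div_const _).aestronglyMeasurable) aestronglyMeasurable_const ?_
  have hlim : Tendsto (fun n : ℕ => (K : ℝ) * (n : ℝ) ^ (-(1 / α - 1 / r))) atTop (𝓝 0) := by
    have h0 : 0 < 1 / α - 1 / (r : ℝ) := sub_pos.2 (one_div_lt_one_div_of_lt hα hr)
    simpa using ((tendsto_rpow_neg_atTop h0).comp tendsto_natCast_atTop_atTop).const_mul (K : ℝ)
  have hlim' := (ENNReal.continuous_ofReal.tendsto 0).comp hlim
  rw [ENNReal.ofReal_zero] at hlim'
  refine tendsto_of_tendsto_of_tendsto_of_le_of_le' tendsto_const_nhds hlim'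
    (Eventually.of_forall fun _ => zero_le) ?_
  filter_upwards [eventually_gt_atTop 0] with n hn
  have hn' : (0 : ℝ) < n := by exact_mod_cast hn
  have e : (fun x => W n x / (n : ℝ) ^ (1 / α)) - 0 = ((n : ℝ) ^ (1 / α))⁻¹ • W n := by
    ext x
    simp [div_eq_inv_mul]
  rw [e, eLpNorm_const_smul]
  calc ‖((n : ℝ) ^ (1 / α))⁻¹‖ₑ * eLpNorm (W n) r m
      ≤ ENNReal.ofReal (((n : ℝ) ^ (1 / α))⁻¹) * (K * (n : ℝ≥0∞) ^ (1 / (r : ℝ))) := by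
        rw [Real.enorm_eq_ofReal (by positivity)]
        gcongr
        exact h n
    _ = ENNReal.ofReal (((n : ℝ) ^ (1 / α))⁻¹ * (K * (n : ℝ) ^ (1 / (r : ℝ)))) := by
        rw [ENNReal.ofReal_mul (by positivity), ENNReal.ofReal_mul K.coe_nonneg,
          ENNReal.ofReal_coe_nnreal, ← ENNReal.ofReal_rpow_of_pos hn', ENNReal.ofReal_natCast]
    _ = _ := by
        simp only [Function.comp_apply]
        congr 1
        rw [neg_sub, Real.rpow_sub hn']
        ring

end Convergence

/-! ### Birkhoff sums at random times -/

section RandomTimes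

variable {Ω Ω' : Type*} [MeasurableSpace Ω] [MeasurableSpace Ω'] {m : Measure Ω} {ν : Measure Ω'}

theorem measureReal_iterate_mem_le [IsFiniteMeasure m] {T : Ω → Ω} (hT : MeasurePreserving T m m)
    {i : Ω' → Ω} (hi : Measurable i) {c : ℝ≥0} (hc : ν.map i ≤ c • m) (k : ℕ) {E : Set Ω}
    (hE : MeasurableSet E) : ν.real {y | T^[k] (i y) ∈ E} ≤ c * m.real E := by
  have h : ν {y | T^[k] (i y) ∈ E} ≤ c * m E := by
    have hE' : MeasurableSet (T^[k] ⁻¹' E) := (hT.iterate k).measurable hE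
    calc ν {y | T^[k] (i y) ∈ E} = ν.map i (T^[k] ⁻¹' E) := (Measure.map_apply hi hE').symm
      _ ≤ (c • m) (T^[k] ⁻¹' E) := hc _
      _ = c * m E := by
        rw [Measure.smul_apply, (hT.iterate k).measure_preimage hE.nullMeasurableSet]; rfl
  have := ENNReal.toReal_mono (ENNReal.mul_ne_top ENNReal.coe_ne_top (measure_ne_top _ _)) h
  rwa [ENNReal.toReal_mul, ENNReal.coe_toReal] at this

/-- The sums of a nonnegative integrable function over random times that are `o(b n)` apart are
`o(b n)` apart. -/
theorem tendstoInMeasure_birkhoffSum_sub_birkhoffSum [IsFiniteMeasure m] [IsFiniteMeasure ν]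
    {T : Ω → Ω} (hT : MeasurePreserving T m m) {φ : Ω → ℕ} (hφ : Measurable φ)
    (hφi : Integrable (fun x => (φ x : ℝ)) m) {i : Ω' → Ω} (hi : Measurable i) {c : ℝ≥0}
    (hc : ν.map i ≤ c • m) {N : ℕ → ℕ} {σ : ℕ → Ω' → ℕ} {b : ℕ → ℝ}
    (hb : Tendsto b atTop atTop) (hbN : ∀ᶠ n in atTop, b n ≤ N n)
    (hσ : TendstoInMeasure ν (fun n y => ((σ n y : ℝ) - N n) / b n) atTop 0) :
    TendstoInMeasure ν (fun n y => (((birkhoffSum T φ (σ n y) (i y) : ℕ) : ℝ) -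
      birkhoffSum T φ (N n) (i y)) / b n) atTop 0 := by
  rw [tendstoInMeasure_zero_iff] at *
  intro ε hε
  have hmono : ∀ x, Monotone fun n => birkhoffSum T φ n x := fun x p q hpq =>
    Finset.sum_le_sum_of_subset (Finset.range_mono hpq)
  set J := ∫ x, (φ x : ℝ) ∂m with hJ
  have hJ0 : 0 ≤ J := integral_nonneg fun _ => Nat.cast_nonneg _
  have hmarkov : ∀ (k : ℕ) (B : ℝ), 0 < B → m.real {x | B ≤ birkhoffSum T φ k x} ≤ k * J / B := by
    intro k B hB
    have hint := integrable_birkhoffSum hT hφi k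
    have hnn : ∀ x, 0 ≤ birkhoffSum T (fun z => (φ z : ℝ)) k x := fun x =>
      Finset.sum_nonneg fun _ _ => Nat.cast_nonneg _
    have h := mul_meas_ge_le_integral_of_nonneg (Eventually.of_forall hnn) hint B
    have e : ∫ x, birkhoffSum T (fun z => (φ z : ℝ)) k x ∂m = k * J := by
      simp only [birkhoffSum]
      rw [integral_finsetSum _ fun l _ => integrable_comp_iterate hT hφi l]
      simp [integral_comp_measurePreserving (hT.iterate _) hφi.aestronglyMeasurable, hJ]
    rw [e] at h
    rw [le_div_iff₀ hB, mul_comm]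
    simpa only [natCast_birkhoffSum] using h
  rw [Metric.tendsto_atTop']
  intro κ hκ
  -- with probability close to one `σ n` is within `M ≈ δ b n` of `N n`, and then the sums differ by at
  -- most a sum of `2 M` terms, which is small by Markov's inequality if `δ` is small
  set δ : ℝ := min 1 (κ * ε / (8 * (c * J + 1))) with hδ
  have hcJ : 0 ≤ c * J := mul_nonneg c.coe_nonneg hJ0
  have hδ0 : 0 < δ := lt_min one_pos (by positivity)
  have hδ1 : δ ≤ 1 := min_le_left _ _
  have hδκ : δ * (8 * (c * J + 1)) ≤ κ * ε := by
    rw [← le_div_iff₀ (by positivity)]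
    exact min_le_right _ _
  have hev : ∀ᶠ n in atTop, ν.real {y | δ ≤ |((σ n y : ℝ) - N n) / b n|} < κ / 2 :=
    (hσ δ hδ0).eventually (gt_mem_nhds (by positivity))
  obtain ⟨n₀, hn₀⟩ := eventually_atTop.1 ((hev.and hbN).and (hb.eventually_ge_atTop (1 / δ)))
  refine ⟨n₀, fun n hn => ?_⟩
  obtain ⟨⟨h1, h2⟩, h3⟩ := hn₀ n hn.le
  have hb0 : 0 < b n := (by positivity : (0 : ℝ) < 1 / δ).trans_le h3
  have hδb : 1 ≤ δ * b n := by rwa [div_le_iff₀' hδ0] at h3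
  set M := ⌈δ * b n⌉₊ with hM
  have hMN : M ≤ N n := Nat.ceil_le.2 ((mul_le_of_le_one_left hb0.le hδ1).trans h2)
  have hMb : (M : ℝ) ≤ 2 * (δ * b n) := by
    have := (Nat.ceil_lt_add_one (zero_le_one.trans hδb)).le
    linarith
  rw [Real.dist_eq, sub_zero, abs_of_nonneg measureReal_nonneg]
  have hsub : {y | ε ≤ |(((birkhoffSum T φ (σ n y) (i y) : ℕ) : ℝ) -
        birkhoffSum T φ (N n) (i y)) / b n|} ⊆
      {y | δ ≤ |((σ n y : ℝ) - N n) / b n|} ∪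
        {y | T^[N n - M] (i y) ∈ {x | ε * b n ≤ birkhoffSum T φ (2 * M) x}} := by
    intro y hy
    by_contra hcon
    have hcon' : ¬ (δ ≤ |((σ n y : ℝ) - N n) / b n| ∨
      ε * b n ≤ birkhoffSum T φ (2 * M) (T^[N n - M] (i y))) := hcon
    push Not at hcon'
    have hy' : ε ≤ |(((birkhoffSum T φ (σ n y) (i y) : ℕ) : ℝ) -
      birkhoffSum T φ (N n) (i y)) / b n| := hy
    rw [abs_div, abs_of_pos hb0, le_div_iff₀ hb0] at hy'
    have hσN := hcon'.1
    rw [abs_div, abs_of_pos hb0, div_lt_iff₀ hb0] at hσN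
    have hσM := (hσN.trans_le (Nat.le_ceil _)).le
    rw [abs_le, ← hM] at hσM
    have hσ1 : σ n y ≤ N n + M := by
      have : (σ n y : ℝ) ≤ (N n + M : ℕ) := by push_cast; linarith [hσM.2]
      exact_mod_cast this
    have hσ2 : N n - M ≤ σ n y := by
      have : (N n : ℝ) ≤ (σ n y + M : ℕ) := by push_cast; linarith [hσM.1]
      have : N n ≤ σ n y + M := by exact_mod_cast this
      omega
    have e : birkhoffSum T φ (N n + M) (i y) = birkhoffSum T φ (N n - M) (i y) +
        birkhoffSum T φ (2 * M) (T^[N n - M] (i y)) := by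
      rw [← birkhoffSum_add]; congr 1; omega
    have i1 := hmono (i y) hσ1
    have i2 := hmono (i y) hσ2
    have i3 := hmono (i y) (Nat.le_add_right (N n) M)
    have i4 := hmono (i y) (Nat.sub_le (N n) M)
    simp only [e] at i1 i2 i3 i4
    have : |((birkhoffSum T φ (σ n y) (i y) : ℕ) : ℝ) - birkhoffSum T φ (N n) (i y)| ≤
        birkhoffSum T φ (2 * M) (T^[N n - M] (i y)) := by
      rw [abs_le]
      have j1 : ((birkhoffSum T φ (σ n y) (i y) : ℕ) : ℝ) ≤ birkhoffSum T φ (N n - M) (i y) +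
        birkhoffSum T φ (2 * M) (T^[N n - M] (i y)) := by exact_mod_cast i1
      have j2 : ((birkhoffSum T φ (N n - M) (i y) : ℕ) : ℝ) ≤ birkhoffSum T φ (σ n y) (i y) := by
        exact_mod_cast i2
      have j3 : ((birkhoffSum T φ (N n) (i y) : ℕ) : ℝ) ≤ birkhoffSum T φ (N n - M) (i y) +
        birkhoffSum T φ (2 * M) (T^[N n - M] (i y)) := by exact_mod_cast i3
      have j4 : ((birkhoffSum T φ (N n - M) (i y) : ℕ) : ℝ) ≤ birkhoffSum T φ (N n) (i y) := by
        exact_mod_cast i4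
      constructor <;> linarith
    linarith [hcon'.2]
  have hmeas : MeasurableSet {x | ε * b n ≤ birkhoffSum T φ (2 * M) x} :=
    measurableSet_le measurable_const
      (measurable_from_top.comp (measurable_birkhoffSum hT.measurable hφ (2 * M)))
  have h4 := measureReal_iterate_mem_le hT hi hc (N n - M) hmeas
  have h5 := hmarkov (2 * M) (ε * b n) (by positivity)
  have h6 : c * (((2 * M : ℕ) : ℝ) * J / (ε * b n)) ≤ κ / 2 := by
    rw [← mul_div_assoc, div_le_iff₀ (by positivity)]
    push_cast
    have h7 : c * J * M ≤ c * J * (2 * (δ * b n)) := by gcongr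
    have h8 := mul_le_mul_of_nonneg_right hδκ hb0.le
    nlinarith [mul_pos hδ0 hb0]
  calc ν.real {y | ε ≤ |(((birkhoffSum T φ (σ n y) (i y) : ℕ) : ℝ) -
        birkhoffSum T φ (N n) (i y)) / b n|}
      ≤ _ := measureReal_mono hsub
    _ ≤ _ := measureReal_union_le _ _
    _ < κ / 2 + κ / 2 := add_lt_add_of_lt_of_le h1
        (h4.trans ((mul_le_mul_of_nonneg_left h5 c.coe_nonneg).trans h6))
    _ = κ := by ring

/-- The Birkhoff sums of a bounded observable of mean zero at the times `n` and `t n` are `o(b n)`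
apart, if the differences `t n - n` divided by `b n` are tight. -/
theorem tendstoInMeasure_birkhoffSum_randomTime [IsProbabilityMeasure m] [IsFiniteMeasure ν]
    {T : Ω → Ω} (hT : Ergodic T m) {v : Ω → ℝ} (hv : Measurable v) {C : ℝ} (hC : ∀ x, |v x| ≤ C)
    (hv0 : ∫ x, v x ∂m = 0) {i : Ω' → Ω} (hi : Measurable i) {c : ℝ≥0} (hc : ν.map i ≤ c • m)
    {t : ℕ → Ω' → ℕ} {b : ℕ → ℝ} (hb : Tendsto b atTop atTop)
    (hbn : Tendsto (fun n => b n / n) atTop (𝓝 0))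
    (ht : ∀ κ > 0, ∃ A : ℝ, 0 < A ∧ ∀ n, ν.real {y | A < |((t n y : ℝ) - n) / b n|} ≤ κ) :
    TendstoInMeasure ν (fun n y => (birkhoffSum T v n (i y) - birkhoffSum T v (t n y) (i y)) / b n)
      atTop 0 := by
  rw [tendstoInMeasure_zero_iff]
  intro ε hε
  rw [Metric.tendsto_atTop']
  intro κ hκ
  obtain ⟨A, hA, hAκ⟩ := ht (κ / 2) (by positivity)
  -- with probability close to one `t n` is within `M ≈ A b n` of `n`, and then both sums split off the
  -- sum up to time `n - M`, leaving sums of at most `2 M` terms; `E (2 M)` is the event that one of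
  -- the latter is large
  set E : ℕ → Set Ω := fun k => {x | ∃ j ≤ k, ε / (16 * A) * k < |birkhoffSum T v j x|} with hE
  have hEm : ∀ k, MeasurableSet (E k) := by
    intro k
    have : E k = ⋃ j ∈ Finset.range (k + 1), {x | ε / (16 * A) * k < |birkhoffSum T v j x|} := by
      ext x
      simp [hE]
    rw [this]
    exact Finset.measurableSet_biUnion _ fun j _ => measurableSet_lt measurable_const
      (measurable_birkhoffSum hT.measurable hv j).abs
  have hlim : Tendsto (fun n => c * m.real (E (2 * ⌈A * b n⌉₊))) atTop (𝓝 0) := by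
    have h1 := tendsto_measure_exists_lt_abs_birkhoffSum hT hv hC hv0
      (ε := ε / (16 * A)) (by positivity)
    have h2 : Tendsto (fun n => 2 * ⌈A * b n⌉₊) atTop atTop :=
      (tendsto_id.const_mul_atTop' (by norm_num)).comp
        (tendsto_nat_ceil_atTop.comp (hb.const_mul_atTop hA))
    have h3 := (h1.comp h2).const_mul (c : ℝ)
    rw [mul_zero] at h3
    exact h3
  obtain ⟨n₀, hn₀⟩ := eventually_atTop.1 (((hlim.eventually (gt_mem_nhds (half_pos hκ))).and
    (hbn.eventually (gt_mem_nhds (inv_pos.2 hA)))).and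
      ((hb.eventually_ge_atTop (1 / A)).and (eventually_gt_atTop 0)))
  refine ⟨n₀, fun n hn => ?_⟩
  obtain ⟨⟨h1, h2⟩, h3, hn0⟩ := hn₀ n hn.le
  have hn' : (0 : ℝ) < n := by exact_mod_cast hn0
  have hb0 : 0 < b n := (by positivity : (0 : ℝ) < 1 / A).trans_le h3
  have hAb : 1 ≤ A * b n := by rwa [div_le_iff₀' hA] at h3
  set M := ⌈A * b n⌉₊ with hM
  have hMn : M ≤ n := by
    refine Nat.ceil_le.2 ?_
    rw [div_lt_iff₀ hn', ← div_eq_inv_mul, lt_div_iff₀' hA] at h2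
    exact h2.le
  have hMb : (M : ℝ) ≤ 2 * (A * b n) := by
    have := (Nat.ceil_lt_add_one (zero_le_one.trans hAb)).le
    linarith
  rw [Real.dist_eq, sub_zero, abs_of_nonneg measureReal_nonneg]
  have hsub : {y | ε ≤ |(birkhoffSum T v n (i y) - birkhoffSum T v (t n y) (i y)) / b n|} ⊆
      {y | A < |((t n y : ℝ) - n) / b n|} ∪ {y | T^[n - M] (i y) ∈ E (2 * M)} := by
    intro y hy
    by_contra hcon
    have hcon' : ¬ (A < |((t n y : ℝ) - n) / b n| ∨ T^[n - M] (i y) ∈ E (2 * M)) := hcon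
    push Not at hcon'
    have hy' : ε ≤ |(birkhoffSum T v n (i y) - birkhoffSum T v (t n y) (i y)) / b n| := hy
    rw [abs_div, abs_of_pos hb0, le_div_iff₀ hb0] at hy'
    have htn := hcon'.1
    rw [abs_div, abs_of_pos hb0, div_le_iff₀ hb0] at htn
    have htM := htn.trans (Nat.le_ceil _)
    rw [abs_le, ← hM] at htM
    have ht1 : t n y ≤ n + M := by
      have : (t n y : ℝ) ≤ (n + M : ℕ) := by push_cast; linarith [htM.2]
      exact_mod_cast this
    have ht2 : n ≤ t n y + M := by
      have : (n : ℝ) ≤ (t n y + M : ℕ) := by push_cast; linarith [htM.1]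
      exact_mod_cast this
    have hsmall : ∀ j ≤ 2 * M, |birkhoffSum T v j (T^[n - M] (i y))| ≤ ε / 4 * b n := by
      intro j hj
      refine (not_lt.1 fun h => hcon'.2 ⟨j, hj, h⟩).trans ?_
      push_cast
      calc ε / (16 * A) * (2 * M) ≤ ε / (16 * A) * (2 * (2 * (A * b n))) := by gcongr
        _ = ε / 4 * b n := by field_simp; ring
    have e1 : birkhoffSum T v n (i y) = birkhoffSum T v (n - M) (i y) +
        birkhoffSum T v M (T^[n - M] (i y)) := by
      rw [← birkhoffSum_add]; congr 1; omega
    have e2 : birkhoffSum T v (t n y) (i y) = birkhoffSum T v (n - M) (i y) +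
        birkhoffSum T v (t n y - (n - M)) (T^[n - M] (i y)) := by
      rw [← birkhoffSum_add]; congr 1; omega
    rw [e1, e2, add_sub_add_left_eq_sub] at hy'
    have h4 := hsmall M (by omega)
    have h5 := hsmall (t n y - (n - M)) (by omega)
    have h6 := abs_sub (birkhoffSum T v M (T^[n - M] (i y)))
      (birkhoffSum T v (t n y - (n - M)) (T^[n - M] (i y)))
    nlinarith [mul_pos hε hb0]
  calc ν.real {y | ε ≤ |(birkhoffSum T v n (i y) - birkhoffSum T v (t n y) (i y)) / b n|}
      ≤ _ := measureReal_mono hsub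
    _ ≤ _ := measureReal_union_le _ _
    _ < κ / 2 + κ / 2 := add_lt_add_of_le_of_lt (hAκ n)
        ((measureReal_iterate_mem_le hT.toMeasurePreserving hi hc (n - M) (hEm _)).trans_lt h1)
    _ = κ := by ring

end RandomTimes

/-! ### The stable law -/

section FloorTimes

theorem abs_floor_mul_sub_le {c : ℝ} (hc : 0 < c) (n : ℕ) : |⌊c⁻¹ * n⌋₊ * c - n| ≤ c := by
  have h0 : (0 : ℝ) ≤ c⁻¹ * n := by positivity
  have h1 := mul_le_mul_of_nonneg_right (Nat.floor_le h0) hc.le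
  have h2 := mul_lt_mul_of_pos_right (Nat.lt_floor_add_one (c⁻¹ * n)) hc
  have e : c⁻¹ * n * c = n := by field_simp
  rw [e] at h1 h2
  rw [abs_le]
  constructor <;> nlinarith

variable {Ω : Type*} [MeasurableSpace Ω] {m : Measure Ω}

theorem tendstoInMeasure_floor_div_of_eLpNorm_le [IsFiniteMeasure m] {W : ℕ → Ω → ℝ}
    (hW : ∀ n, Measurable (W n)) {r : ℝ≥0} {α : ℝ} (hα : 0 < α) (hr : α < r) {K : ℝ≥0}
    (h : ∀ n, eLpNorm (W n) r m ≤ K * (n : ℝ≥0∞) ^ (1 / (r : ℝ))) {c : ℝ} (hc : 0 ≤ c) :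
    TendstoInMeasure m (fun (n : ℕ) x => W ⌊c * n⌋₊ x / (n : ℝ) ^ (1 / α)) atTop 0 := by
  refine tendstoInMeasure_div_of_eLpNorm_le (W := fun n => W ⌊c * n⌋₊) (fun n => hW _) hα hr
    (K := K * c.toNNReal ^ (1 / (r : ℝ))) fun n => (h _).trans ?_
  have hr0 : 0 ≤ 1 / (r : ℝ) := by positivity
  rw [ENNReal.coe_mul, mul_assoc, ENNReal.coe_rpow_of_nonneg _ hr0,
    ← ENNReal.mul_rpow_of_nonneg _ _ hr0]
  gcongr
  have h1 : (⌊c * n⌋₊ : ℝ≥0) ≤ c.toNNReal * n := by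
    rw [← NNReal.coe_le_coe]
    push_cast
    rw [Real.coe_toNNReal _ hc]
    exact Nat.floor_le (by positivity)
  exact_mod_cast h1

theorem tendstoInMeasure_const_div [IsFiniteMeasure m] {e b : ℕ → ℝ} {C : ℝ}
    (he : ∀ n, |e n| ≤ C) (hb : Tendsto b atTop atTop) :
    TendstoInMeasure m (fun n _ => e n / b n) atTop 0 := by
  refine tendstoInMeasure_const (c₀ := 0) (squeeze_zero_norm' ?_ (hb.const_div_atTop C))
  filter_upwards [hb.eventually_gt_atTop 0] with n hn
  rw [Real.norm_eq_abs, abs_div, abs_of_pos hn]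
  gcongr
  exact he n

end FloorTimes

namespace CMZStructure

variable {Λ : Type*} [MetricSpace Λ] [MeasurableSpace Λ] {T : Λ → Λ} {μ : Measure Λ} {X : Set Λ}
  {η : ℝ≥0}

/-- The time under `T` of the `k`-th return to the base `Y` of the tower. -/
def cycleTime (S : CMZStructure T μ X η) (k : ℕ) (y : S.tower.Y) : ℕ :=
  birkhoffSum S.tower.F (inducedReturnTime S.tower) k y

/-- The mean of the return time to `Y` under `T`. -/
def meanCycle (S : CMZStructure T μ X η) : ℝ := S.tower.meanTau * meanReturnTime T μ X

/-- The `k`-th return to `Y` is the return to `X` of index `∑_{j < k} τ ∘ F^j`. -/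
theorem ae_cycleTime_eq (S : CMZStructure T μ X η) : ∀ᵐ y ∂S.tower.μY, ∀ k,
    S.cycleTime k y =
      birkhoffSum (returnMap T X) (returnTime T X) (birkhoffSum S.tower.F S.tower.τ k y) y := by
  filter_upwards [S.tower.ae_forall_F_eq] with y hy k
  exact S.tower.birkhoffSum_lift (returnTime T X) hy k

/-- At the returns to `Y`, the sums of `v` are `I` times the centred time, up to the sums of the
residual. -/
theorem ae_birkhoffSum_cycleTime_eq (S : CMZStructure T μ X η) (v : Λ → ℝ) (I : ℝ) :
    ∀ᵐ y ∂S.tower.μY, ∀ k, birkhoffSum T v (S.cycleTime k y) ((y : X) : Λ) =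
      birkhoffSum S.tower.F (S.residual v I) k y + I * (S.cycleTime k y - k * S.meanCycle) := by
  filter_upwards [S.tower.ae_forall_F_eq, S.ae_cycleTime_eq] with y hy hc k
  have h1 : birkhoffSum T v (S.cycleTime k y) ((y : X) : Λ) =
      birkhoffSum S.tower.F (inducedY S.tower v) k y := by
    rw [inducedY_eq_lift, S.tower.birkhoffSum_lift _ hy, hc, birkhoffSum_birkhoffSum_returnTime]
    rfl
  rw [h1, cycleTime, natCast_birkhoffSum]
  simp only [residual, birkhoffSum, Finset.sum_sub_distrib, ← Finset.mul_sum, Finset.sum_const,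
    Finset.card_range, nsmul_eq_mul, meanCycle]
  ring

theorem measurable_residual (S : CMZStructure T μ X η) {v : Λ → ℝ} (hv : Measurable v) (I : ℝ) :
    Measurable (S.residual v I) := by
  have e : S.residual v I = _ := funext (S.residual_eq v I)
  rw [e]
  exact (S.tower.measurable_lift S.measurable_map
    ((measurable_induced S.ergodic.measurable S.measurableSet_X hv).sub
      (S.measurable_natCast_returnTime.const_mul I))).add_const _

/-- The measure on the base, seen on `Λ`, is dominated by a multiple of `μ`. -/
theorem exists_map_le (S : CMZStructure T μ X η) :
    ∃ c : ℝ≥0, S.tower.μY.map (fun y : S.tower.Y => ((y : X) : Λ)) ≤ c • μ := by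
  have hX0 := ENNReal.inv_ne_top.2 S.measure_X_ne_zero
  refine ⟨S.tower.meanTau.toNNReal * ((μ X)⁻¹).toNNReal, Measure.le_iff.2 fun s hs => ?_⟩
  have hs' : MeasurableSet (Subtype.val ⁻¹' s : Set X) := measurable_subtype_coe hs
  have h1 := S.tower.map_val_le S.measurable_map (Subtype.val ⁻¹' s)
  rw [Measure.map_apply measurable_subtype_coe hs'] at h1
  rw [Measure.map_apply (f := fun y : S.tower.Y => ((y : X) : Λ))
    (measurable_subtype_coe.comp measurable_subtype_coe) hs]
  have e1 : restrictedMeasure μ X (Subtype.val ⁻¹' s) =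
      (μ X)⁻¹ * μ (Subtype.val '' (Subtype.val ⁻¹' s : Set X)) := by
    rw [restrictedMeasure, Measure.smul_apply, comap_subtype_coe_apply S.measurableSet_X,
      smul_eq_mul]
  calc _ ≤ (S.tower.meanTau.toNNReal : ℝ≥0∞) * restrictedMeasure μ X (Subtype.val ⁻¹' s) := h1
    _ ≤ S.tower.meanTau.toNNReal * ((μ X)⁻¹ * μ s) := by
      rw [e1]
      gcongr
      exact image_preimage_subset _ _
    _ = ((S.tower.meanTau.toNNReal * ((μ X)⁻¹).toNNReal : ℝ≥0) : ℝ≥0∞) * μ s := by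
      rw [ENNReal.coe_mul, ENNReal.coe_toNNReal hX0, mul_assoc]

variable [IsProbabilityMeasure μ]

theorem meanCycle_pos (S : CMZStructure T μ X η) : 0 < S.meanCycle :=
  mul_pos (zero_lt_one.trans_le S.tower.one_le_meanTau)
    (meanReturnTime_pos S.ergodic S.measurableSet_X S.measure_X_ne_zero)

variable [StandardBorelSpace Λ] {α : ℝ} {Ω : Type*} [MeasurableSpace Ω]
  {P : Measure Ω} [IsProbabilityMeasure P] {G : Ω → ℝ}

/-- Under `μ_Y`, the time taken by `⌊n / φ̃⌋` returns to `Y`, with `φ̃` the mean of the return time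
to `Y`, fluctuates about `n` like the sum of `⌊n / φ̄⌋` return times to the cross-section. -/
theorem tendstoInDistribution_cycleTime (S : CMZStructure T μ X η) (hα1 : 1 < α) (hα2 : α < 2)
    [IsProbabilityMeasure S.tower.μY] [IsProbabilityMeasure (restrictedMeasure μ X)]
    (hstable : TendstoInDistribution
      (fun (n : ℕ) (x : X) =>
        (birkhoffSum (returnMap T X) (fun z => (returnTime T X z : ℝ)) n x
          - n * meanReturnTime T μ X) / (n : ℝ) ^ (1 / α))
      atTop G (fun _ => restrictedMeasure μ X) P) :
    TendstoInDistribution (fun (n : ℕ) y =>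
      ((S.cycleTime ⌊S.meanCycle⁻¹ * n⌋₊ y : ℝ) - n) / (n : ℝ) ^ (1 / α)) atTop
      (fun ω => meanReturnTime T μ X ^ (-(1 / α)) * G ω) (fun _ => S.tower.μY) P := by
  have := S.measurableSet_X.standardBorel
  have hα0 : 0 < α := one_pos.trans hα1
  have ha0 : 0 < 1 / α := by positivity
  have ha1 : 1 / α < 1 := by rwa [div_lt_one hα0]
  set φbar := meanReturnTime T μ X with hφbar
  have hφ0 : 0 < φbar := meanReturnTime_pos S.ergodic S.measurableSet_X S.measure_X_ne_zero
  have hφi := integrable_returnTime S.ergodic S.measurableSet_X S.measure_X_ne_zero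
  have hφm := measurable_returnTime S.ergodic.measurable S.measurableSet_X
  have hf := S.tower.ergodic S.measurable_map
  have hle := S.tower.map_val_le S.measurable_map
  have hc0 := S.meanCycle_pos
  have hτ0 : 0 < S.tower.meanTau := zero_lt_one.trans_le S.tower.one_le_meanTau
  set b : ℕ → ℝ := fun n => (n : ℝ) ^ (1 / α) with hbdef
  have hb : Tendsto b atTop atTop := (tendsto_rpow_atTop ha0).comp tendsto_natCast_atTop_atTop
  set N : ℕ → ℕ := fun n => ⌊φbar⁻¹ * n⌋₊ with hNdef
  have hN : Tendsto N atTop atTop := tendsto_nat_floor_atTop.comp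
    (tendsto_natCast_atTop_atTop.const_mul_atTop (inv_pos.2 hφ0))
  have hNn : Tendsto (fun n : ℕ => (N n : ℝ) / n) atTop (𝓝 φbar⁻¹) :=
    (tendsto_nat_floor_mul_div_atTop (inv_nonneg.2 hφ0.le)).comp tendsto_natCast_atTop_atTop
  -- the normalised return times, under the measure on the base
  have hY : TendstoInDistribution (fun (n : ℕ) (y : S.tower.Y) => ((n : ℝ) ^ (1 / α))⁻¹ *
      (birkhoffSum (returnMap T X) (fun z => (returnTime T X z : ℝ)) n y - n * φbar))
      atTop G (fun _ => S.tower.μY) P := by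
    refine (tendstoInDistribution_birkhoffSum_iff hf S.measurable_natCast_returnTime hφi
      (hb.inv_tendsto_atTop) measurable_subtype_coe hle).1 ?_
    have e : ∀ (n : ℕ) (x : X), (birkhoffSum (returnMap T X) (fun z => (returnTime T X z : ℝ)) n x
        - n * φbar) / (n : ℝ) ^ (1 / α) = ((n : ℝ) ^ (1 / α))⁻¹ *
          (birkhoffSum (returnMap T X) (fun z => (returnTime T X z : ℝ)) n x - n * φbar) :=
      fun n x => div_eq_inv_mul _ _
    simp only [e] at hstable
    exact hstable
  have hYN : TendstoInDistribution (fun (n : ℕ) (y : S.tower.Y) => ((N n : ℝ) ^ (1 / α))⁻¹ *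
      (birkhoffSum (returnMap T X) (fun z => (returnTime T X z : ℝ)) (N n) y - N n * φbar))
      atTop G (fun _ => S.tower.μY) P :=
    ⟨fun n => hY.forall_aemeasurable (N n), hY.aemeasurable_limit, hY.tendsto.comp hN⟩
  have hratio : Tendsto (fun n : ℕ => (N n : ℝ) ^ (1 / α) / b n) atTop
      (𝓝 (φbar ^ (-(1 / α)))) := by
    have h := (hNn.rpow_const (p := 1 / α) (Or.inr ha0.le))
    rw [Real.inv_rpow hφ0.le, ← Real.rpow_neg hφ0.le] at h
    refine h.congr fun n => ?_
    rw [Real.div_rpow (Nat.cast_nonneg _) (Nat.cast_nonneg _)]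
  have hlim := hYN.continuous_comp_prodMk_of_tendstoInMeasure_const (g := fun p : ℝ × ℝ => p.2 * p.1)
    (by fun_prop) (tendstoInMeasure_const (m := S.tower.μY) hratio) (fun n => aemeasurable_const)
  -- the number of returns to the cross-section
  have hσ : TendstoInMeasure S.tower.μY (fun (n : ℕ) y =>
      ((birkhoffSum S.tower.F S.tower.τ ⌊S.meanCycle⁻¹ * n⌋₊ y : ℕ) - (N n : ℝ)) / b n)
      atTop 0 := by
    obtain ⟨r, hαr, hr2⟩ := exists_between hα2
    lift r to ℝ≥0 using hα0.le.trans hαr.le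
    obtain ⟨K, hK⟩ := S.tower.exists_eLpNorm_birkhoffSum_tau_le (r := r)
      (by exact_mod_cast hα1.trans hαr) (by exact_mod_cast hr2.le)
    have hτm : Measurable fun y => (S.tower.τ y : ℝ) - S.tower.meanTau :=
      (measurable_from_top.comp S.tower.measurable_τ).sub_const _
    have h1 := tendstoInMeasure_floor_div_of_eLpNorm_le
      (fun n => measurable_birkhoffSum S.tower.ergodic_base.measurable hτm n) hα0 hαr hK
      (inv_nonneg.2 hc0.le)
    have h2 : TendstoInMeasure S.tower.μY
        (fun (n : ℕ) _ => (⌊S.meanCycle⁻¹ * n⌋₊ * S.tower.meanTau - N n) / b n) atTop 0 := by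
      refine tendstoInMeasure_const_div (C := S.tower.meanTau + 1) (fun n => ?_) hb
      have h3 := abs_floor_mul_sub_le hc0 n
      have h4 := abs_floor_mul_sub_le hφ0 n
      have h5 : S.meanCycle = S.tower.meanTau * φbar := rfl
      rw [abs_le] at h3 h4 ⊢
      constructor
      · refine le_of_mul_le_mul_right ?_ hφ0
        rw [h5] at h3 ⊢
        simp only [hNdef]
        linarith [h3.1, h4.2]
      · refine le_of_mul_le_mul_right ?_ hφ0
        rw [h5] at h3 ⊢
        simp only [hNdef]
        linarith [h3.2, h4.1]
    refine tendstoInMeasure_zero_of_abs_le one_pos one_pos h1 h2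
      fun n => Eventually.of_forall fun y => ?_
    rw [one_mul, one_mul]
    refine (le_of_eq ?_).trans (abs_add_le _ _)
    congr 1
    rw [← add_div, natCast_birkhoffSum]
    congr 1
    simp only [birkhoffSum, Finset.sum_sub_distrib, Finset.sum_const, Finset.card_range,
      nsmul_eq_mul]
    ring
  have hbN : ∀ᶠ n in atTop, b n ≤ N n := by
    have h1 : Tendsto (fun n : ℕ => b n / n) atTop (𝓝 0) := by
      have h := (tendsto_rpow_neg_atTop (sub_pos.2 ha1)).comp tendsto_natCast_atTop_atTop
      refine h.congr' ?_
      filter_upwards [eventually_gt_atTop 0] with n hn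
      rw [Function.comp_apply, neg_sub, Real.rpow_sub_one (by exact_mod_cast hn.ne')]
    filter_upwards [h1.eventually_lt hNn (inv_pos.2 hφ0), eventually_gt_atTop 0] with n hn hn0
    have hn' : (0 : ℝ) < n := by exact_mod_cast hn0
    exact (div_le_div_iff_of_pos_right hn').1 hn.le
  have hE := tendstoInMeasure_birkhoffSum_sub_birkhoffSum hf.toMeasurePreserving hφm hφi
    measurable_subtype_coe hle hb hbN hσ
  have hE' : TendstoInMeasure S.tower.μY (fun n _ => (N n * φbar - n) / b n) atTop 0 :=
    tendstoInMeasure_const_div (C := φbar) (fun n => abs_floor_mul_sub_le hφ0 n) hb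
  have hmeas : ∀ k, Measurable (S.cycleTime k) := fun k =>
    measurable_birkhoffSum S.tower.ergodic_base.measurable
      (S.tower.measurable_lift S.measurable_map hφm) k
  refine tendstoInDistribution_of_tendstoInMeasure_sub _ _ hlim
    (tendstoInMeasure_zero_of_abs_le one_pos one_pos hE hE' fun n => ?_)
    fun n => (((measurable_from_top.comp (hmeas _)).sub_const _).div_const _).aemeasurable
  filter_upwards [S.ae_cycleTime_eq] with y hy
  rw [one_mul, one_mul]
  refine (le_of_eq ?_).trans (abs_add_le _ _)
  congr 1
  have hcancel : (N n : ℝ) ^ (1 / α) / b n * (((N n : ℝ) ^ (1 / α))⁻¹ *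
      (birkhoffSum (returnMap T X) (fun z => (returnTime T X z : ℝ)) (N n) y - N n * φbar)) =
      (birkhoffSum (returnMap T X) (fun z => (returnTime T X z : ℝ)) (N n) y - N n * φbar) /
        b n := by
    -- for `N n = 0` both sides vanish, as the sums are empty
    rcases Nat.eq_zero_or_pos (N n) with h0 | h0
    · simp [h0]
    · have : (N n : ℝ) ^ (1 / α) ≠ 0 := (Real.rpow_pos_of_pos (by exact_mod_cast h0) _).ne'
      field_simp
  simp only [Pi.sub_apply]
  rw [hcancel, hy, natCast_birkhoffSum, natCast_birkhoffSum]
  ring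

/-- The limit law of the return times passes to the Birkhoff sums of `v`. -/
theorem tendstoInDistribution_birkhoffSum [BorelSpace Λ] (S : CMZStructure T μ X η) (hη : 0 < η)
    (hα1 : 1 < α) (hα2 : α < 2) [IsProbabilityMeasure (restrictedMeasure μ X)]
    (hstable : TendstoInDistribution
      (fun (n : ℕ) (x : X) =>
        (birkhoffSum (returnMap T X) (fun z => (returnTime T X z : ℝ)) n x
          - n * meanReturnTime T μ X) / (n : ℝ) ^ (1 / α))
      atTop G (fun _ => restrictedMeasure μ X) P)
    {v : Λ → ℝ} (hv : IsHolderObservable η v) (hv0 : ∫ x, v x ∂μ = 0) {I p : ℝ} (hp : α < p)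
    (hLp : MemLp (fun x : X => induced T X v x - I * returnTime T X x)
      (ENNReal.ofReal p) (restrictedMeasure μ X)) :
    TendstoInDistribution (fun (n : ℕ) (x : Λ) => (n : ℝ) ^ (-(1 / α)) * birkhoffSum T v n x)
      atTop (fun ω => meanReturnTime T μ X ^ (-(1 / α)) * I * G ω) (fun _ => μ) P := by
  have := S.tower.isProbabilityMeasure
  have := S.measurableSet_X.standardBorel
  have hα0 : 0 < α := one_pos.trans hα1
  have ha0 : 0 < 1 / α := by positivity
  have ha1 : 1 / α < 1 := by rwa [div_lt_one hα0]
  obtain ⟨r, hαr, hr⟩ := exists_between (lt_min hp hα2)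
  lift r to ℝ≥0 using hα0.le.trans hαr.le
  obtain ⟨K, hK⟩ := S.exists_eLpNorm_birkhoffSum_residual_le hη hv hv0 (r := r)
    (by exact_mod_cast hα1.trans hαr) (by exact_mod_cast (hr.trans_le (min_le_right _ _)).le)
    (hr.trans_le (min_le_left _ _)) hLp
  obtain ⟨⟨L, hL⟩, M, hM⟩ := hv
  have hvm : Measurable v := (hL.continuous hη).measurable
  have hvi : Integrable v μ := Integrable.of_bound hvm.aestronglyMeasurable M
    (Eventually.of_forall hM)
  obtain ⟨c, hc⟩ := S.exists_map_le
  have hi : Measurable fun y : S.tower.Y => ((y : X) : Λ) :=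
    measurable_subtype_coe.comp measurable_subtype_coe
  have hc0 := S.meanCycle_pos
  set b : ℕ → ℝ := fun n => (n : ℝ) ^ (1 / α) with hbdef
  have hb : Tendsto b atTop atTop := (tendsto_rpow_atTop ha0).comp tendsto_natCast_atTop_atTop
  have hbn : Tendsto (fun n : ℕ => b n / n) atTop (𝓝 0) := by
    have h := (tendsto_rpow_neg_atTop (sub_pos.2 ha1)).comp tendsto_natCast_atTop_atTop
    refine h.congr' ?_
    filter_upwards [eventually_gt_atTop 0] with n hn
    rw [Function.comp_apply, neg_sub, Real.rpow_sub_one (by exact_mod_cast hn.ne')]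
  have hbinv : ∀ n : ℕ, (n : ℝ) ^ (-(1 / α)) = (b n)⁻¹ := fun n =>
    Real.rpow_neg (Nat.cast_nonneg n) _
  have hQ := S.tendstoInDistribution_cycleTime hα1 hα2 hstable
  have hIQ := hQ.continuous_comp (continuous_const_mul I)
  -- it is enough to argue under the measure on the base
  have key := tendstoInDistribution_birkhoffSum_iff S.ergodic hvm hvi (d := fun n => (b n)⁻¹)
    (e := fun _ => 0) hb.inv_tendsto_atTop hi hc (P := P)
    (G := fun ω => meanReturnTime T μ X ^ (-(1 / α)) * I * G ω)
  simp only [sub_zero] at key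
  simp only [hbinv]
  rw [key]
  have h1 := tendstoInMeasure_birkhoffSum_randomTime S.ergodic hvm hM hv0 hi hc hb hbn
    fun κ hκ => exists_forall_measure_lt_abs_le hQ hκ
  have hR : ∀ n, Measurable (birkhoffSum S.tower.F (S.residual v I) n) := fun n =>
    measurable_birkhoffSum S.tower.ergodic_base.measurable (S.measurable_residual hvm I) n
  have h2 := tendstoInMeasure_floor_div_of_eLpNorm_le hR hα0 hαr hK (inv_nonneg.2 hc0.le)
  have h3 : TendstoInMeasure S.tower.μY
      (fun (n : ℕ) _ => (⌊S.meanCycle⁻¹ * n⌋₊ * S.meanCycle - n) / b n) atTop 0 :=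
    tendstoInMeasure_const_div (fun n => abs_floor_mul_sub_le hc0 n) hb
  have h12 := tendstoInMeasure_zero_of_abs_le one_pos one_pos h1 h2
    (W := fun (n : ℕ) (y : S.tower.Y) => (birkhoffSum T v n ((y : X) : Λ) -
      birkhoffSum T v (S.cycleTime ⌊S.meanCycle⁻¹ * n⌋₊ y) ((y : X) : Λ)) / b n +
        birkhoffSum S.tower.F (S.residual v I) ⌊S.meanCycle⁻¹ * n⌋₊ y / b n)
    fun n => Eventually.of_forall fun y => by
      rw [one_mul, one_mul]
      exact abs_add_le _ _
  have e : (fun ω => meanReturnTime T μ X ^ (-(1 / α)) * I * G ω) =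
      (fun x => I * x) ∘ fun ω => meanReturnTime T μ X ^ (-(1 / α)) * G ω := by
    ext ω
    simp only [Function.comp_apply]
    ring
  rw [e]
  refine tendstoInDistribution_of_tendstoInMeasure_sub _ _ hIQ
    (tendstoInMeasure_zero_of_abs_le one_pos (by positivity : 0 < |I| + 1) h12 h3 fun n => ?_)
    fun n => (((measurable_birkhoffSum S.ergodic.measurable hvm n).comp hi).const_mul _).aemeasurable
  filter_upwards [S.ae_birkhoffSum_cycleTime_eq v I] with y hy
  simp only [Pi.sub_apply, Function.comp_apply]
  rw [hy]
  set k := ⌊S.meanCycle⁻¹ * n⌋₊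
  set R := birkhoffSum S.tower.F (S.residual v I) k y
  -- `v_n - I (t - n) = (v_n - v_t) + R - I (k φ̃ - n)`, where `t = t_k` and `v_t = R + I (t - k φ̃)`
  have e2 : (b n)⁻¹ * birkhoffSum T v n ((y : X) : Λ) - I * (((S.cycleTime k y : ℝ) - n) / b n) =
      ((birkhoffSum T v n ((y : X) : Λ) - (R + I * (S.cycleTime k y - k * S.meanCycle))) / b n +
        R / b n) - I * ((k * S.meanCycle - n) / b n) := by
    ring
  have e3 := abs_sub ((birkhoffSum T v n ((y : X) : Λ) -
    (R + I * (S.cycleTime k y - k * S.meanCycle))) / b n + R / b n)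
    (I * ((k * S.meanCycle - n) / b n))
  rw [abs_mul] at e3
  change |(b n)⁻¹ * birkhoffSum T v n ((y : X) : Λ) -
    I * (((S.cycleTime k y : ℝ) - n) / b n)| ≤ _
  rw [e2]
  nlinarith [abs_nonneg ((k * S.meanCycle - n) / b n)]

end CMZStructure
end CMZ

end

theorem mainTheorem4
    {Λ : Type*} [MetricSpace Λ] [MeasurableSpace Λ] [BorelSpace Λ] [StandardBorelSpace Λ]
    (T : Λ → Λ) (μ : Measure Λ) [IsProbabilityMeasure μ] (X : Set Λ)
    (η : ℝ≥0) (_hη : 0 < η ∧ η ≤ 1)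
    (S : CMZ.CMZStructure T μ X η)
    (α : ℝ) (_hα : 1 < α ∧ α < 2)
    {Ω : Type*} [MeasurableSpace Ω] (P : Measure Ω) [IsProbabilityMeasure P] (G : Ω → ℝ)
    (_hG : CMZ.IsStableLaw α (P.map G))
    (_hstable :
      haveI := S.isProbabilityMeasure
      TendstoInDistribution
        (fun (n : ℕ) (x : X) =>
          (birkhoffSum (CMZ.returnMap T X) (fun z => (CMZ.returnTime T X z : ℝ)) n x
            - n * CMZ.meanReturnTime T μ X) / (n : ℝ) ^ (1 / α))
        atTop G (fun _ => CMZ.restrictedMeasure μ X) P)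
    (v : Λ → ℝ) (_hv : CMZ.IsHolderObservable η v) (_hv0 : ∫ x, v x ∂μ = 0)
    (I : ℝ) (_hI : I ≠ 0) (p : ℝ) (_hp : α < p)
    (_hLp : MemLp (fun x : X => CMZ.induced T X v x - I * CMZ.returnTime T X x)
      (ENNReal.ofReal p) (CMZ.restrictedMeasure μ X)) :
    TendstoInDistribution
      (fun (n : ℕ) (x : Λ) => (n : ℝ) ^ (-(1 / α)) * birkhoffSum T v n x)
      atTop (fun ω => CMZ.meanReturnTime T μ X ^ (-(1 / α)) * I * G ω) (fun _ => μ) P := by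
  have := S.isProbabilityMeasure
  exact S.tendstoInDistribution_birkhoffSum _hη.1 _hα.1 _hα.2 _hstable _hv _hv0 _hp _hLp
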